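/- **The Slider Theorem.** Let $d\ge 2$ and let $\beta=1$ (field $\mathbb R$) or $\beta=2$ (field $\mathbb C$). For $N\ge 3$ consider a chain of $N$ sites of local dimension $d$, with bonds $l=1,\dots,N-1$ joining the sites $l,l+1$. Let $\Lambda_l$ be the real diagonal $d^2\times d^2$ matrix of the eigenvalues of the $l$-th local term; the $\Lambda_l$ are independent, have finite fourth moments, and are identically distributed over the odd $l$ and over the even $l$. Let $U_l$ be independent $\beta$-Haar (orthogonal resp. unitary) $d^2\times d^2$ matrices, independent of the eigenvalues. Put $$A=\sum_{l\ \mathrm{odd}} I\otimes\Lambda_l\otimes I,\qquad B=\sum_{l\ \mathrm{even}} I\otimes\Lambda_l\otimes I,$$ $$Q^{(A)}=\prod_{l\ \mathrm{odd}} I\otimes U_l\otimes I,\qquad Q^{(B)}=\prod_{l\ \mathrm{even}} I\otimes U_l\otimes I,\qquad Q_q=Q^{(B)}\bigl(Q^{(A)}\bigr)^{-1},$$ so that $A+Q_q^{-1}BQ_q$ is unitarily equivalent to the Hamiltonian $\sum_l I\otimes U_l^{-1}\Lambda_lU_l\otimes I$. Let $Q$ be a $\beta$-Haar matrix of size $d^N$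 and $\Pi$ a uniformly random $d^N\times d^N$ permutation matrix, both independent of the eigenvalues, and define $$m_r^{q}=\tfrac1{d^N}\mathbb E\operatorname{Tr}(A+Q_q^{-1}BQ_q)^r,\quad m_r^{iso}=\tfrac1{d^N}\mathbb E\operatorname{Tr}(A+Q^{-1}BQ)^r,\quad m_r^{c}=\tfrac1{d^N}\mathbb E\operatorname{Tr}(A+\Pi^{-1}B\Pi)^r .$$ For $\bullet\in\{q,iso,c\}$ let $\gamma_2^\bullet=m_4^\bullet/\sigma_\bullet^4$ with $\sigma_\bullet^2=m_2^\bullet-(m_1^\bullet)^2$ be the kurtosis (taken to be $0$ when $\sigma_\bullet=0$). Then: 1. $\gamma_2^{iso}\le\gamma_2^{q}\le\gamma_2^{c}$. 2. There are numbers $p=p(N,d,\beta)\in[0,1]$, not depending on the distributions of the local eigenvalues, such that $\gamma_2^{q}=p\,\gamma_2^{c}+(1-p)\,\gamma_2^{iso}$. If neither the odd nor the even local terms are almost surely scalar matrices, then $\gamma_2^{iso}<\gamma_2^{c}$, so that $p$ is unique. 3. For odd $N=2k+1$, $$1-p=\bigl(1-d^{-2k-1}\bigr)\Bigl[1-\bigl(\tfrac{k-1}{k}\bigr)^2\Bigr]\Bigl(1-\frac{1-d^{-2k+1}}{1+\beta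 d^2/2}\Bigr)\Bigl(\frac d{d+1}\Bigr)^2\,\frac{\beta(d^3+d^2-2d+1)+4d-2}{(d-1)(\beta d^2+2)} .$$ 4. $\lim_{N\to\infty}p(N,d,\beta)=1$. Statements 1 and 2 hold with the same $p$ if $\gamma_2^\bullet$ is replaced by the fourth moment $m_4^\bullet$, or by the kurtosis formed with the fourth moment about the mean. Moreover, for every real $\beta\ge1$ the right-hand side in 3 lies in $[0,1]$ for all $k\ge1$, and it tends to $0$ as $k\to\infty$. -/

import Mathlib

open MeasureTheory Matrix Filter Topology

noncomputable section

/-! ### The Haar probability measure on the orthogonal and unitary groups -/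

section Haar

variable {n : Type*} [Fintype n] [DecidableEq n] {𝕜 : Type*} [RCLike 𝕜]

theorem isCompact_unitaryGroup : IsCompact (unitaryGroup n 𝕜 : Set (Matrix n n 𝕜)) := by
  have hK : IsCompact (Set.univ.pi fun _ : n => Set.univ.pi fun _ : n =>
      Metric.closedBall (0 : 𝕜) 1) :=
    isCompact_univ_pi fun _ => isCompact_univ_pi fun _ => isCompact_closedBall 0 1
  refine hK.of_isClosed_subset (isClosed_unitary (R := Matrix n n 𝕜)) ?_
  intro U hU i _ j _
  simpa using entry_norm_bound_of_unitary hU i j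

instance instCompactSpaceUnitaryGroup : CompactSpace (unitaryGroup n 𝕜) :=
  isCompact_iff_compactSpace.mp isCompact_unitaryGroup

instance instMeasurableSpaceUnitaryGroup : MeasurableSpace (unitaryGroup n 𝕜) := borel _

instance instBorelSpaceUnitaryGroup : BorelSpace (unitaryGroup n 𝕜) := ⟨rfl⟩

variable (n 𝕜) in
/-- The Haar probability measure on the group of `n × n` matrices `Q` over `𝕜` with `Qᴴ Q = 1`
(the orthogonal group for `𝕜 = ℝ`, the unitary group for `𝕜 = ℂ`). -/
def haarUnitary : Measure (unitaryGroup n 𝕜) := Measure.haarMeasure ⊤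

instance instIsProbabilityMeasureHaarUnitary : IsProbabilityMeasure (haarUnitary n 𝕜) :=
  ⟨by simpa [haarUnitary] using
    Measure.haarMeasure_self (K₀ := (⊤ : TopologicalSpace.PositiveCompacts (unitaryGroup n 𝕜)))⟩

end Haar

/-! ### The chain

A chain with `M` bonds has `N = M + 1` sites, each of local dimension `d`; its computational basis is
indexed by `Fin (M + 1) → Fin d`. Bond `l : Fin M` joins the sites `l.castSucc` and `l.succ`.
Bonds are numbered from `0` here, so the "odd" bonds `1, 3, 5, …` of the usual numbering from `1`
are those with `l` even. -/

section Chain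

variable {𝕜 : Type*} [RCLike 𝕜] {d M : ℕ}

/-- `I ⊗ X ⊗ I`, with the two-site matrix `X` acting on the two sites of the bond `l`. -/
def embedBond (l : Fin M) (X : Matrix (Fin d × Fin d) (Fin d × Fin d) 𝕜) :
    Matrix (Fin (M + 1) → Fin d) (Fin (M + 1) → Fin d) 𝕜 :=
  fun x y =>
    if ∀ s, s ≠ l.castSucc → s ≠ l.succ → x s = y s then
      X (x l.castSucc, x l.succ) (y l.castSucc, y l.succ)
    else 0

/-- The odd bonds `1, 3, 5, …` (numbering from `1`). -/
def IsOddBond (l : Fin M) : Prop := Odd ((l : ℕ) + 1)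

instance instDecidablePredIsOddBond : DecidablePred (IsOddBond (M := M)) :=
  fun l => inferInstanceAs (Decidable (Odd ((l : ℕ) + 1)))

/-- The diagonal matrix of the local eigenvalues `v`. -/
def localDiag (𝕜 : Type*) [RCLike 𝕜] (v : Fin d × Fin d → ℝ) :
    Matrix (Fin d × Fin d) (Fin d × Fin d) 𝕜 :=
  diagonal fun i => (v i : 𝕜)

/-- `A = ∑_{l odd} I ⊗ Λ_l ⊗ I`. -/
def diagA (𝕜 : Type*) [RCLike 𝕜] (Λ : Fin M → Fin d × Fin d → ℝ) :
    Matrix (Fin (M + 1) → Fin d) (Fin (M + 1) → Fin d) 𝕜 :=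
  ∑ l with IsOddBond l, embedBond l (localDiag 𝕜 (Λ l))

/-- `B = ∑_{l even} I ⊗ Λ_l ⊗ I`. -/
def diagB (𝕜 : Type*) [RCLike 𝕜] (Λ : Fin M → Fin d × Fin d → ℝ) :
    Matrix (Fin (M + 1) → Fin d) (Fin (M + 1) → Fin d) 𝕜 :=
  ∑ l with ¬ IsOddBond l, embedBond l (localDiag 𝕜 (Λ l))

/-- `Q^{(A)} = U₁ ⊗ U₃ ⊗ U₅ ⊗ ⋯` (times an identity on the last site if that is uncovered),
written as the product of the commuting factors `I ⊗ U_l ⊗ I` over the odd bonds `l`. -/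
def layerA (U : Fin M → unitaryGroup (Fin d × Fin d) 𝕜) :
    Matrix (Fin (M + 1) → Fin d) (Fin (M + 1) → Fin d) 𝕜 :=
  (((List.finRange M).filter fun l => IsOddBond l).map fun l => embedBond l (U l).1).prod

/-- `Q^{(B)} = I ⊗ U₂ ⊗ U₄ ⊗ ⋯` (times an identity on the last site if that is uncovered),
written as the product of the commuting factors `I ⊗ U_l ⊗ I` over the even bonds `l`. -/
def layerB (U : Fin M → unitaryGroup (Fin d × Fin d) 𝕜) :
    Matrix (Fin (M + 1) → Fin d) (Fin (M + 1) → Fin d) 𝕜 :=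
  (((List.finRange M).filter fun l => ¬ IsOddBond l).map fun l => embedBond l (U l).1).prod

/-- `Q_q = Q^{(B)} (Q^{(A)})⁻¹`. With `H_odd = (Q^{(A)})⁻¹ A Q^{(A)}` and
`H_even = (Q^{(B)})⁻¹ B Q^{(B)}`, i.e. with local terms `U_l⁻¹ Λ_l U_l`, the chain Hamiltonian
`H_odd + H_even` becomes `A + Q_q⁻¹ B Q_q` in the basis in which `H_odd` is diagonal. -/
def quantumQ (U : Fin M → unitaryGroup (Fin d × Fin d) 𝕜) :
    Matrix (Fin (M + 1) → Fin d) (Fin (M + 1) → Fin d) 𝕜 :=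
  layerB U * (layerA U)ᴴ

/-- `(1 / d^N) Tr (A + Qᴴ B Q)^r` (a real number, since the matrix is Hermitian). -/
def traceMoment (Λ : Fin M → Fin d × Fin d → ℝ)
    (Q : Matrix (Fin (M + 1) → Fin d) (Fin (M + 1) → Fin d) 𝕜) (r : ℕ) : ℝ :=
  ((d : ℝ) ^ (M + 1))⁻¹ * RCLike.re (trace ((diagA 𝕜 Λ + Qᴴ * diagB 𝕜 Λ * Q) ^ r))

end Chain

/-! ### Moments of the three sums

`ρo` and `ρe` are the laws of the `d²` eigenvalues of an odd and of an even local term. The local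
eigenvalues of different bonds are independent, and independent of the eigenvectors. -/

section Moments

variable {d : ℕ} (𝕜 : Type*) [RCLike 𝕜]

/-- The joint law of the local eigenvalues of a chain with `M` bonds. -/
def eigenvalueLaw (ρo ρe : Measure (Fin d × Fin d → ℝ)) (M : ℕ) :
    Measure (Fin M → Fin d × Fin d → ℝ) :=
  Measure.pi fun l => if IsOddBond l then ρo else ρe

/-- `m_r^q = d^{-N} E Tr (A + Q_qᴴ B Q_q)^r`, the local eigenvectors being independent Haar. -/
def momentQuantum (ρo ρe : Measure (Fin d × Fin d → ℝ)) (M r : ℕ) : ℝ :=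
  ∫ Λ, ∫ U : Fin M → unitaryGroup (Fin d × Fin d) 𝕜, traceMoment Λ (quantumQ U) r
    ∂(Measure.pi fun _ => haarUnitary (Fin d × Fin d) 𝕜) ∂(eigenvalueLaw ρo ρe M)

/-- `m_r^iso = d^{-N} E Tr (A + Qᴴ B Q)^r`, with `Q` Haar of size `d^N`. -/
def momentIso (ρo ρe : Measure (Fin d × Fin d → ℝ)) (M r : ℕ) : ℝ :=
  ∫ Λ, ∫ Q : unitaryGroup (Fin (M + 1) → Fin d) 𝕜, traceMoment Λ Q.1 r
    ∂(haarUnitary (Fin (M + 1) → Fin d) 𝕜) ∂(eigenvalueLaw ρo ρe M)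

/-- `m_r^c = d^{-N} E Tr (A + Πᵀ B Π)^r`, with `Π` a uniformly random permutation matrix. -/
def momentClassical (ρo ρe : Measure (Fin d × Fin d → ℝ)) (M r : ℕ) : ℝ :=
  ∫ Λ, (Fintype.card (Equiv.Perm (Fin (M + 1) → Fin d)) : ℝ)⁻¹ *
      ∑ σ : Equiv.Perm (Fin (M + 1) → Fin d), traceMoment Λ (σ.permMatrix 𝕜) r
    ∂(eigenvalueLaw ρo ρe M)

end Moments

/-- The fourth moment of a distribution with moments `m 1, m 2, …`. -/
def fourthMoment (m : ℕ → ℝ) : ℝ := m 4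

/-- The kurtosis `m₄ / σ⁴`, with `m₄` the fourth moment about `0`. -/
def rawKurtosis (m : ℕ → ℝ) : ℝ := m 4 / (m 2 - m 1 ^ 2) ^ 2

/-- The kurtosis `μ₄ / σ⁴`, with `μ₄` the fourth moment about the mean. -/
def centralKurtosis (m : ℕ → ℝ) : ℝ :=
  (m 4 - 4 * m 1 * m 3 + 6 * m 1 ^ 2 * m 2 - 3 * m 1 ^ 4) / (m 2 - m 1 ^ 2) ^ 2

/-- The closed form of `1 - p` for a chain of `N = 2 k + 1` sites. -/
def sliderOneSubP (d k : ℕ) (β : ℝ) : ℝ :=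
  (1 - (d : ℝ) ^ (-2 * (k : ℤ) - 1)) * (1 - (((k : ℝ) - 1) / k) ^ 2) *
    ((1 - (1 - (d : ℝ) ^ (-2 * (k : ℤ) + 1)) / (1 + β * (d : ℝ) ^ 2 / 2)) *
      ((d : ℝ) / (d + 1)) ^ 2 *
      ((β * ((d : ℝ) ^ 3 + (d : ℝ) ^ 2 - 2 * d + 1) + 4 * d - 2) /
        (((d : ℝ) - 1) * (β * (d : ℝ) ^ 2 + 2))))

end

/-! Fix the local eigenvalues and remove their means, so that in each model the matrix is c + Y + Z,
with c the mean energy and Y, Z the traceless odd and even layers. The powers of Y and of Z have the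
same deterministic traces in all three models. In the expansion of Tr (Y + Z)^r for r ≤ 4, every
word is cyclically of the form Y^a Z^b, except YZYZ. Words Y^a Z^b have the same mean in all three
models: a Haar or permutation average turns a diagonal matrix into its normalised trace, and in the
chain this happens one local term at a time (`FactorizingPair`). Hence the moments of order 1, 2, 3
coincide, and the fourth moments differ only through θ = E Tr YZYZ.

With n = d^N, θ is found as follows. For a permutation the matrices commute and θ = Tr Y² Tr Z² / n.
For a Haar rotation it follows from the second moments of the entries of Uᴴ diag(v) U
(`conjMoment₂_eq`), which invariance under signs, permutations, phases and one plane reflection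
determines. In the chain it is a sum over pairs of one odd and one even bond
(`integral_trace_bondPair`): bonds without a common site commute and contribute as in the classical
case, while adjacent bonds contribute κ = `adjacentFactor` times that, by two successive Haar
integrations (`integral_trace_adjacent`).

Averaging over the eigenvalues, both differences "classical minus quantum" and "classical minus
isotropic" are a constant times the same product of the mean centred square sums of an odd and an
even local term (`fourth_classical_sub_quantum`, `fourth_classical_sub_iso`). This product cancels
in the quotient, which is 1 - p = `isoWeight`: the fraction of odd-even pairs that are adjacent,
times (1 - κ), times a factor close to 1. That fraction is O(1/N), so p → 1. Polynomial inequalities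
give 0 ≤ p ≤ 1, and both kurtoses inherit everything because they are affine in the fourth moment
with a nonnegative slope fixed by the lower moments. -/

noncomputable section

/-! ### Invariance of the Haar measure -/

section HaarInvariance

variable {n : Type*} [Fintype n] [DecidableEq n] {𝕜 : Type*} [RCLike 𝕜]

instance instSecondCountableTopologyUnitaryGroup : SecondCountableTopology (unitaryGroup n 𝕜) :=
  haveI : SecondCountableTopology (Matrix n n 𝕜) :=
    inferInstanceAs (SecondCountableTopology (n → n → 𝕜))
  inferInstanceAs (SecondCountableTopology (unitaryGroup n 𝕜 : Set (Matrix n n 𝕜)))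

instance instIsHaarMeasureHaarUnitary : (haarUnitary n 𝕜).IsHaarMeasure :=
  inferInstanceAs (Measure.haarMeasure ⊤).IsHaarMeasure

/-- A right translate of Haar measure is again a left-invariant probability measure, so uniqueness
makes the two equal: compact groups are unimodular. -/
instance instIsMulRightInvariantHaarUnitary : (haarUnitary n 𝕜).IsMulRightInvariant := by
  refine ⟨fun W => ?_⟩
  have hm : Measurable fun U : unitaryGroup n 𝕜 => U * W := (continuous_mul_const W).measurable
  have : IsProbabilityMeasure (Measure.map (fun U => U * W) (haarUnitary n 𝕜)) :=
    Measure.isProbabilityMeasure_map hm.aemeasurable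
  have : (Measure.map (fun U => U * W) (haarUnitary n 𝕜)).IsMulLeftInvariant := by
    refine ⟨fun V => ?_⟩
    have hV : Measurable fun U : unitaryGroup n 𝕜 => V * U := (continuous_const_mul V).measurable
    rw [Measure.map_map hV hm]
    have : ((fun U => V * U) ∘ fun U => U * W) = ((fun U => U * W) ∘ fun U : unitaryGroup n 𝕜 =>
        V * U) := by
      funext U; simp [mul_assoc]
    rw [this, ← Measure.map_map hm hV, map_mul_left_eq_self]
  have : (Measure.map (fun U => U * W) (haarUnitary n 𝕜)).IsHaarMeasure :=
    Measure.isHaarMeasure_of_isCompact_nonempty_interior _ Set.univ isCompact_univ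
      (by simp) (by simp) (by simp)
  exact Measure.isHaarMeasure_eq_of_isProbabilityMeasure _ _

theorem Continuous.integrable_of_compact {X E : Type*} [TopologicalSpace X] [CompactSpace X]
    [MeasurableSpace X] [OpensMeasurableSpace X] [NormedAddCommGroup E] {μ : Measure X}
    [IsFiniteMeasure μ] {f : X → E} (hf : Continuous f) : Integrable f μ :=
  hf.integrable_of_hasCompactSupport (HasCompactSupport.of_compactSpace f)

/-- The Hermitian matrix `Uᴴ diag(v) U`. -/
def conjDiag (v : n → ℝ) (U : Matrix n n 𝕜) : Matrix n n 𝕜 :=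
  Uᴴ * diagonal (fun i => (v i : 𝕜)) * U

theorem continuous_conjDiag (v : n → ℝ) :
    Continuous fun U : unitaryGroup n 𝕜 => conjDiag v U.1 := by
  unfold conjDiag
  fun_prop

theorem conjDiag_conjTranspose (v : n → ℝ) (U : Matrix n n 𝕜) :
    (conjDiag v U)ᴴ = conjDiag v U := by
  simp only [conjDiag, conjTranspose_mul, conjTranspose_conjTranspose, diagonal_conjTranspose,
    Matrix.mul_assoc]
  congr 3
  ext i; simp

theorem conjDiag_mul_right (v : n → ℝ) (U W : Matrix n n 𝕜) :
    conjDiag v (U * W) = Wᴴ * conjDiag v U * W := by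
  simp only [conjDiag, conjTranspose_mul, Matrix.mul_assoc]

theorem unitaryGroup.mul_conjTranspose (U : unitaryGroup n 𝕜) : U.1 * U.1ᴴ = 1 :=
  mem_unitaryGroup_iff.mp U.2

theorem unitaryGroup.conjTranspose_mul (U : unitaryGroup n 𝕜) : U.1ᴴ * U.1 = 1 :=
  mem_unitaryGroup_iff'.mp U.2

theorem conjDiag_mul_conjDiag (v w : n → ℝ) (U : unitaryGroup n 𝕜) :
    conjDiag v U.1 * conjDiag w U.1 = conjDiag (fun i => v i * w i) U.1 := by
  have h := unitaryGroup.mul_conjTranspose U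
  calc conjDiag v U.1 * conjDiag w U.1
      = U.1ᴴ * diagonal (fun i => (v i : 𝕜)) * (U.1 * U.1ᴴ) * diagonal (fun i => (w i : 𝕜))
          * U.1 := by simp only [conjDiag, Matrix.mul_assoc]
    _ = _ := by
        rw [h]; simp [conjDiag, Matrix.mul_assoc]

theorem trace_conjDiag (v : n → ℝ) (U : unitaryGroup n 𝕜) :
    trace (conjDiag v U.1) = ((∑ i, v i : ℝ) : 𝕜) := by
  rw [conjDiag, trace_mul_comm, ← Matrix.mul_assoc, unitaryGroup.mul_conjTranspose, Matrix.one_mul,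
    trace_diagonal]
  push_cast; rfl

/-- Right invariance, since U ↦ UW conjugates Uᴴ diag(v) U by W. All the symmetries of the moments
below are instances with a suitable W. -/
theorem integral_conjDiag_conj (v : n → ℝ) (W : Matrix n n 𝕜) (hW : Wᴴ * W = 1)
    (F : Matrix n n 𝕜 → 𝕜) :
    ∫ U : unitaryGroup n 𝕜, F (Wᴴ * conjDiag v U.1 * W) ∂haarUnitary n 𝕜
      = ∫ U : unitaryGroup n 𝕜, F (conjDiag v U.1) ∂haarUnitary n 𝕜 := by
  let W' : unitaryGroup n 𝕜 := ⟨W, mem_unitaryGroup_iff'.mpr hW⟩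
  rw [← integral_mul_right_eq_self (fun U : unitaryGroup n 𝕜 => F (conjDiag v U.1)) W']
  exact integral_congr_ae (ae_of_all _ fun U => by
    change _ = F (conjDiag v (U.1 * W))
    rw [conjDiag_mul_right])

/-- Diagonal unitary with a phase `z` at the site `s`. -/
theorem diagonal_update_unitary (s : n) (z : 𝕜) (hz : star z * z = 1) :
    (diagonal (Function.update (1 : n → 𝕜) s z))ᴴ * diagonal (Function.update (1 : n → 𝕜) s z)
      = 1 := by
  rw [diagonal_conjTranspose, diagonal_mul_diagonal, ← diagonal_one]
  congr 1
  ext i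
  by_cases h : i = s
  · subst h; simpa using hz
  · simp [h]

/-- The first moments of the entries of `Uᴴ diag(v) U`. -/
def conjMoment₁ (𝕜 : Type*) [RCLike 𝕜] (v : n → ℝ) (i j : n) : 𝕜 :=
  ∫ U : unitaryGroup n 𝕜, conjDiag v U.1 i j ∂haarUnitary n 𝕜

/-- The second moments of the entries of `Uᴴ diag(v) U`. -/
def conjMoment₂ (𝕜 : Type*) [RCLike 𝕜] (v : n → ℝ) (i j k l : n) : 𝕜 :=
  ∫ U : unitaryGroup n 𝕜, conjDiag v U.1 i j * conjDiag v U.1 k l ∂haarUnitary n 𝕜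

theorem integrable_conjDiag_apply (v : n → ℝ) (i j : n) :
    Integrable (fun U : unitaryGroup n 𝕜 => conjDiag v U.1 i j) (haarUnitary n 𝕜) :=
  ((continuous_conjDiag v).matrix_elem i j).integrable_of_compact

theorem integrable_conjDiag_apply_mul (v : n → ℝ) (i j k l : n) :
    Integrable (fun U : unitaryGroup n 𝕜 => conjDiag v U.1 i j * conjDiag v U.1 k l)
      (haarUnitary n 𝕜) :=
  (((continuous_conjDiag v).matrix_elem i j).mul
    ((continuous_conjDiag v).matrix_elem k l)).integrable_of_compact

theorem conj_diagonal_apply (z : n → 𝕜) (G : Matrix n n 𝕜) (i j : n) :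
    ((diagonal z)ᴴ * G * diagonal z) i j = star (z i) * z j * G i j := by
  rw [mul_diagonal, diagonal_conjTranspose, diagonal_mul, Pi.star_apply]
  ring

theorem conj_permMatrix_apply (σ : Equiv.Perm n) (G : Matrix n n 𝕜) (i j : n) :
    ((σ.permMatrix 𝕜)ᴴ * G * σ.permMatrix 𝕜) i j = G (σ⁻¹ i) (σ⁻¹ j) := by
  rw [conjTranspose_permMatrix, Equiv.Perm.permMatrix, PEquiv.toMatrix_toPEquiv_mul,
    Equiv.Perm.permMatrix, PEquiv.mul_toMatrix_toPEquiv]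
  rfl

theorem permMatrix_unitary (σ : Equiv.Perm n) :
    (σ.permMatrix 𝕜)ᴴ * σ.permMatrix 𝕜 = 1 := by
  rw [conjTranspose_permMatrix, ← permMatrix_mul]; simp

theorem conjMoment₁_perm (v : n → ℝ) (σ : Equiv.Perm n) (i j : n) :
    conjMoment₁ 𝕜 v (σ i) (σ j) = conjMoment₁ 𝕜 v i j := by
  have h := integral_conjDiag_conj v _ (permMatrix_unitary (𝕜 := 𝕜) σ⁻¹) fun G => G i j
  simpa only [conj_permMatrix_apply, inv_inv, conjMoment₁, conjMoment₂] using h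

theorem conjMoment₂_perm (v : n → ℝ) (σ : Equiv.Perm n) (i j k l : n) :
    conjMoment₂ 𝕜 v (σ i) (σ j) (σ k) (σ l) = conjMoment₂ 𝕜 v i j k l := by
  have h := integral_conjDiag_conj v _ (permMatrix_unitary (𝕜 := 𝕜) σ⁻¹) fun G => G i j * G k l
  simpa only [conj_permMatrix_apply, inv_inv, conjMoment₁, conjMoment₂] using h

/-- Taken at z = -1, this kills moments in which an index occurs an odd number of times; its
second-moment analogue is also used at z = i in the complex case. -/
theorem conjMoment₁_phase (v : n → ℝ) (s : n) (z : 𝕜) (hz : star z * z = 1) (i j : n) :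
    star (Function.update (1 : n → 𝕜) s z i) * Function.update (1 : n → 𝕜) s z j
      * conjMoment₁ 𝕜 v i j = conjMoment₁ 𝕜 v i j := by
  have h := integral_conjDiag_conj v _ (diagonal_update_unitary s z hz) fun G => G i j
  simp only [conj_diagonal_apply] at h
  rwa [integral_const_mul] at h

theorem conjMoment₂_phase (v : n → ℝ) (s : n) (z : 𝕜) (hz : star z * z = 1) (i j k l : n) :
    (star (Function.update (1 : n → 𝕜) s z i) * Function.update (1 : n → 𝕜) s z j) *
      (star (Function.update (1 : n → 𝕜) s z k) * Function.update (1 : n → 𝕜) s z l)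
      * conjMoment₂ 𝕜 v i j k l = conjMoment₂ 𝕜 v i j k l := by
  have h := integral_conjDiag_conj v _ (diagonal_update_unitary s z hz) fun G => G i j * G k l
  simp only [conj_diagonal_apply] at h
  rw [conjMoment₂, ← integral_const_mul]
  refine Eq.trans (integral_congr_ae (ae_of_all _ fun U => ?_)) h
  simp only
  ring

/-- Permutation symmetry makes the diagonal means equal and the trace fixes their sum; a sign flip
kills the off-diagonal ones. -/
theorem conjMoment₁_eq (v : n → ℝ) (i j : n) :
    conjMoment₁ 𝕜 v i j = if i = j then (((∑ k, v k) / Fintype.card n : ℝ) : 𝕜) else 0 := by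
  split_ifs with h
  · subst h
    have hc : ∀ k, conjMoment₁ 𝕜 v k k = conjMoment₁ 𝕜 v i i := fun k => by
      simpa using (conjMoment₁_perm (𝕜 := 𝕜) v (Equiv.swap k i) k k).symm
    have ht : ∑ k, conjMoment₁ 𝕜 v k k = ((∑ k, v k : ℝ) : 𝕜) := by
      simp only [conjMoment₁]
      rw [← integral_finsetSum _ fun k _ => integrable_conjDiag_apply v k k]
      have hU : ∀ U : unitaryGroup n 𝕜, ∑ k, conjDiag v U.1 k k = ((∑ k, v k : ℝ) : 𝕜) :=
        trace_conjDiag v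
      simp [hU]
    simp only [hc, Finset.sum_const, Finset.card_univ, nsmul_eq_mul] at ht
    have hn : (Fintype.card n : 𝕜) ≠ 0 := by
      have : Nonempty n := ⟨i⟩
      simp
    rw [RCLike.ofReal_div, ← ht, RCLike.ofReal_natCast]
    field_simp
  · have := conjMoment₁_phase (𝕜 := 𝕜) v i (-1) (by simp) i j
    rw [Function.update_self, Function.update_of_ne (Ne.symm h)] at this
    simp only [star_neg, star_one, Pi.one_apply, mul_one, neg_mul, one_mul] at this
    exact CharZero.neg_eq_self_iff.mp this

end HaarInvariance

/-! ### Second moments of Haar-conjugated diagonal matrices -/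

section HaarSecondMoments

variable {n : Type*} [Fintype n] [DecidableEq n] {𝕜 : Type*} [RCLike 𝕜]

/-- The Dyson index `β`: `1` for `ℝ` and `2` for `ℂ`. -/
def dysonIndex (𝕜 : Type*) [RCLike 𝕜] : ℝ := Module.finrank ℝ 𝕜

theorem dysonIndex_of_I_eq_zero (h : (RCLike.I : 𝕜) = 0) : dysonIndex 𝕜 = 1 := by
  rw [dysonIndex, LinearEquiv.finrank_eq (RCLike.realLinearIsometryEquiv h).toLinearEquiv]
  simp

theorem dysonIndex_of_im_I (h : RCLike.im (RCLike.I : 𝕜) = 1) : dysonIndex 𝕜 = 2 := by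
  rw [dysonIndex, LinearEquiv.finrank_eq (RCLike.complexLinearIsometryEquiv h).toLinearEquiv]
  simp

theorem dysonIndex_eq (𝕜 : Type*) [RCLike 𝕜] : dysonIndex 𝕜 = 1 ∨ dysonIndex 𝕜 = 2 :=
  RCLike.I_eq_zero_or_im_I_eq_one.imp dysonIndex_of_I_eq_zero dysonIndex_of_im_I

theorem conjMoment₁_def (v : n → ℝ) (i j : n) : conjMoment₁ 𝕜 v i j =
    ∫ U : unitaryGroup n 𝕜, conjDiag v U.1 i j ∂haarUnitary n 𝕜 := rfl

theorem conjMoment₂_def (v : n → ℝ) (i j k l : n) : conjMoment₂ 𝕜 v i j k l =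
    ∫ U : unitaryGroup n 𝕜, conjDiag v U.1 i j * conjDiag v U.1 k l ∂haarUnitary n 𝕜 := rfl

/-- If some index occurs exactly once or exactly three times, the second moment vanishes. -/
theorem conjMoment₂_eq_zero (v : n → ℝ) {i j k l : n} (s : n)
    (h : (if s = i then (-1 : 𝕜) else 1) * (if s = j then -1 else 1) *
      ((if s = k then -1 else 1) * (if s = l then -1 else 1)) = -1) :
    conjMoment₂ 𝕜 v i j k l = 0 := by
  have := conjMoment₂_phase (𝕜 := 𝕜) v s (-1) (by simp) i j k l
  have hu : ∀ i, Function.update (1 : n → 𝕜) s (-1) i = if s = i then -1 else 1 := fun i => by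
    simp [Function.update_apply, eq_comm]
  have hs : ∀ i, star (if s = i then (-1 : 𝕜) else 1) = if s = i then -1 else 1 := fun i => by
    split_ifs <;> simp
  simp only [hu, hs, h] at this
  exact CharZero.neg_eq_self_iff.mp (by simpa using this)

-- Double transitivity: a second moment involving two distinct indices depends only on the pattern
-- in which they occur.
omit [Fintype n] in
theorem exists_perm_pair {i k i' k' : n} (h : i ≠ k) (h' : i' ≠ k') :
    ∃ σ : Equiv.Perm n, σ i = i' ∧ σ k = k' := by
  refine ⟨Equiv.swap (Equiv.swap i i' k) k' * Equiv.swap i i', ?_, ?_⟩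
  · simp only [Equiv.Perm.mul_apply, Equiv.swap_apply_left]
    refine Equiv.swap_apply_of_ne_of_ne (fun hh => h ?_) h'
    have := congrArg (Equiv.swap i i') hh
    simpa using this
  · simp

/-- A reflection mixing the indices `i` and `k`. -/
def planeReflection (𝕜 : Type*) [RCLike 𝕜] (i k : n) : Matrix n n 𝕜 :=
  -- The block on i, k is (3/5, 4/5; 4/5, -3/5): a rational Pythagorean triple gives an orthogonal
  -- matrix without square roots.
  1 - single i i (2 / 5) + single i k (4 / 5) + single k i (4 / 5) - single k k (8 / 5)

theorem planeReflection_unitary {i k : n} (h : i ≠ k) :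
    (planeReflection 𝕜 i k)ᴴ * planeReflection 𝕜 i k = 1 := by
  have hs : (planeReflection 𝕜 i k)ᴴ = planeReflection 𝕜 i k := by
    simp only [planeReflection, conjTranspose_add, conjTranspose_sub, conjTranspose_one,
      conjTranspose_single, star_div₀, star_ofNat]
    abel
  rw [hs, planeReflection]
  simp only [Matrix.mul_add, Matrix.add_mul, Matrix.sub_mul, Matrix.mul_sub, Matrix.one_mul,
    Matrix.mul_one, single_mul_single_same, single_mul_single_of_ne, h, h.symm, ne_eq,
    not_false_eq_true, add_zero, sub_zero]
  ext a b
  simp only [Matrix.add_apply, Matrix.sub_apply, single_apply, one_apply]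
  split_ifs <;> norm_num

theorem planeReflection_conj_apply {i k : n} (h : i ≠ k) (G : Matrix n n 𝕜) :
    ((planeReflection 𝕜 i k)ᴴ * G * planeReflection 𝕜 i k) i i =
      9 / 25 * G i i + 12 / 25 * (G i k + G k i) + 16 / 25 * G k k := by
  have hr : ∀ j, planeReflection 𝕜 i k j i =
      if j = i then 3 / 5 else if j = k then 4 / 5 else 0 := fun j => by
    simp only [planeReflection, Matrix.add_apply, Matrix.sub_apply, single_apply, one_apply]
    by_cases h1 : j = i
    · subst h1; simp [h.symm]; norm_num
    · by_cases h2 : j = k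
      · subst h2; simp [h, h.symm]
      · simp [h1, h2, Ne.symm h1, Ne.symm h2]
  have hs : ∀ f : n → 𝕜, ∑ j, f j * planeReflection 𝕜 i k j i = f i * (3 / 5) + f k * (4 / 5) :=
    fun f => by
      rw [Fintype.sum_eq_add i k h]
      · simp [hr, h.symm]
      · rintro x ⟨h1, h2⟩; simp [hr, h1, h2]
  have hs' : ∀ f : n → 𝕜, ∑ j, star (planeReflection 𝕜 i k j i) * f j
      = (3 / 5) * f i + (4 / 5) * f k := fun f => by
      rw [Fintype.sum_eq_add i k h]
      · simp [hr, h.symm]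
      · rintro x ⟨h1, h2⟩; simp [hr, h1, h2]
  rw [mul_apply, hs]
  simp only [mul_apply, conjTranspose_apply, hs']
  ring

/-- Signs and permutations cannot relate E G_ii² to the mixed moments; invariance of E G_ii² under a
reflection that mixes i and k does. -/
theorem conjMoment₂_reflection (v : n → ℝ) {i k : n} (h : i ≠ k) :
    conjMoment₂ 𝕜 v i i i i = conjMoment₂ 𝕜 v i i k k + conjMoment₂ 𝕜 v i k k i
      + conjMoment₂ 𝕜 v i k i k := by
  have key := integral_conjDiag_conj v _ (planeReflection_unitary (𝕜 := 𝕜) h)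
    fun G => G i i * G i i
  simp only [planeReflection_conj_apply h] at key
  have e : ∀ U : unitaryGroup n 𝕜,
      (9 / 25 * conjDiag v U.1 i i + 12 / 25 * (conjDiag v U.1 i k + conjDiag v U.1 k i)
        + 16 / 25 * conjDiag v U.1 k k) *
      (9 / 25 * conjDiag v U.1 i i + 12 / 25 * (conjDiag v U.1 i k + conjDiag v U.1 k i)
        + 16 / 25 * conjDiag v U.1 k k) =
      81 / 625 * (conjDiag v U.1 i i * conjDiag v U.1 i i) +
      256 / 625 * (conjDiag v U.1 k k * conjDiag v U.1 k k) +
      288 / 625 * (conjDiag v U.1 i i * conjDiag v U.1 k k) +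
      144 / 625 * (conjDiag v U.1 i k * conjDiag v U.1 i k) +
      144 / 625 * (conjDiag v U.1 k i * conjDiag v U.1 k i) +
      288 / 625 * (conjDiag v U.1 i k * conjDiag v U.1 k i) +
      216 / 625 * (conjDiag v U.1 i i * conjDiag v U.1 i k) +
      216 / 625 * (conjDiag v U.1 i i * conjDiag v U.1 k i) +
      384 / 625 * (conjDiag v U.1 k k * conjDiag v U.1 i k) +
      384 / 625 * (conjDiag v U.1 k k * conjDiag v U.1 k i) := fun U => by ring
  simp only [e] at key
  have hi := fun a b c d => integrable_conjDiag_apply_mul (𝕜 := 𝕜) v a b c d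
  have hi' := fun (x : 𝕜) a b c d => (hi a b c d).const_mul x
  repeat rw [integral_add (by fun_prop) (by fun_prop)] at key
  simp only [integral_const_mul, ← conjMoment₂_def] at key
  -- These four moments contain one of the two indices exactly once, so they vanish by a sign flip.
  rw [conjMoment₂_eq_zero v (i := i) (j := i) (k := i) (l := k) k (by simp [h.symm]),
    conjMoment₂_eq_zero v (i := i) (j := i) (k := k) (l := i) k (by simp [h.symm]),
    conjMoment₂_eq_zero v (i := k) (j := k) (k := i) (l := k) i (by simp [h]),
    conjMoment₂_eq_zero v (i := k) (j := k) (k := k) (l := i) i (by simp [h])] at key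
  have h1 : conjMoment₂ 𝕜 v k k k k = conjMoment₂ 𝕜 v i i i i := by
    simpa using conjMoment₂_perm (𝕜 := 𝕜) v (Equiv.swap i k) i i i i
  have h2 : conjMoment₂ 𝕜 v k i k i = conjMoment₂ 𝕜 v i k i k := by
    simpa using conjMoment₂_perm (𝕜 := 𝕜) v (Equiv.swap i k) i k i k
  rw [h1, h2] at key
  -- The two fourth-order diagonal moments carry weight 81/625 + 256/625 = 1 - 288/625, so 288/625
  -- is the common coefficient that remains.
  linear_combination (-625 / 288 : 𝕜) * key

/-- Over ℝ the matrix is symmetric, so the two moments agree and the factor is 1; over ℂ a phase i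
at k changes the sign of E G_ik², so the factor is 0. Both read 2/β - 1. -/
theorem conjMoment₂_same (v : n → ℝ) {i k : n} (h : i ≠ k) :
    conjMoment₂ 𝕜 v i k i k = ((2 / dysonIndex 𝕜 - 1 : ℝ) : 𝕜) * conjMoment₂ 𝕜 v i k k i := by
  rcases RCLike.I_eq_zero_or_im_I_eq_one (K := 𝕜) with hI | hI
  · rw [dysonIndex_of_I_eq_zero hI]
    have : ∀ z : 𝕜, star z = z := fun z => by
      rw [← RCLike.re_add_im z, hI]; simp
    have hG : ∀ U : unitaryGroup n 𝕜, conjDiag v U.1 k i = conjDiag v U.1 i k := fun U => by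
      conv_lhs => rw [← conjDiag_conjTranspose]
      rw [conjTranspose_apply, this]
    norm_num [conjMoment₂, hG]
  · rw [dysonIndex_of_im_I hI]
    have hII : (RCLike.I : 𝕜) * RCLike.I = -1 := by
      rcases RCLike.I_mul_I (K := 𝕜) with h0 | h0
      · rw [h0] at hI; simp at hI
      · exact h0
    have := conjMoment₂_phase (𝕜 := 𝕜) v k RCLike.I (by simp [hII]) i k i k
    rw [Function.update_self, Function.update_of_ne h] at this
    simp only [Pi.one_apply, star_one, one_mul, hII] at this
    have h0 := CharZero.neg_eq_self_iff.mp (by simpa using this)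
    rw [h0]; norm_num

/-- The scale of the fluctuations of the entries of `Uᴴ diag(v) U` for traceless `v`. -/
def fluctuation (n 𝕜 : Type*) [Fintype n] [RCLike 𝕜] (v : n → ℝ) : ℝ :=
  (∑ i, v i ^ 2) / (((Fintype.card n : ℝ) - 1) * (Fintype.card n + 2 / dysonIndex 𝕜))

theorem dysonIndex_pos (𝕜 : Type*) [RCLike 𝕜] : 0 < dysonIndex 𝕜 := by
  rcases dysonIndex_eq 𝕜 with h | h <;> rw [h] <;> norm_num

/-- Three linear equations determine the three unknowns e = E G_ii², a = E G_ii G_kk and b = E G_ik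
G_ki: Tr G = 0 (`h1`), Tr G² = ∑ v² (`h2`), and the reflection identity e = a + (2/β) b (`h3`). -/
theorem conjMoment₂_of_ne (v : n → ℝ) (hv : ∑ i, v i = 0) {i k : n} (h : i ≠ k) :
    conjMoment₂ 𝕜 v i k k i = (fluctuation n 𝕜 v : 𝕜) ∧
    conjMoment₂ 𝕜 v i i k k =
      ((-2 / (dysonIndex 𝕜 * Fintype.card n) * fluctuation n 𝕜 v : ℝ) : 𝕜) := by
  set D : 𝕜 := (Fintype.card n : 𝕜) with hD
  set b := conjMoment₂ 𝕜 v i k k i with hb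
  set a := conjMoment₂ 𝕜 v i i k k with ha
  set e := conjMoment₂ 𝕜 v i i i i with he
  have hbc : ∀ x y, x ≠ y → conjMoment₂ 𝕜 v x y y x = b := fun x y hxy => by
    obtain ⟨σ, rfl, rfl⟩ := exists_perm_pair h hxy
    exact conjMoment₂_perm v σ i k k i
  have hac : ∀ x y, x ≠ y → conjMoment₂ 𝕜 v x x y y = a := fun x y hxy => by
    obtain ⟨σ, rfl, rfl⟩ := exists_perm_pair h hxy
    exact conjMoment₂_perm v σ i i k k
  have hec : ∀ x, conjMoment₂ 𝕜 v x x x x = e := fun x => by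
    simpa using conjMoment₂_perm (𝕜 := 𝕜) v (Equiv.swap i x) i i i i
  have hsum : ∀ (x : n) (f : n → 𝕜) (c : 𝕜), f x = e → (∀ y, x ≠ y → f y = c) →
      ∑ y, f y = e + (D - 1) * c := fun x f c h1 h2 => by
    rw [Fintype.sum_eq_add_sum_compl x, h1, Finset.sum_congr rfl (g := fun _ => c)]
    · rw [Finset.sum_const, Finset.card_compl, Finset.card_singleton, nsmul_eq_mul,
        Nat.cast_sub (Fintype.card_pos_iff.mpr ⟨x⟩)]
      simp [hD]
    · intro y hy; exact h2 y (by simpa [eq_comm] using hy)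
  have h1 : e + (D - 1) * a = 0 := by
    rw [← hsum i (fun y => conjMoment₂ 𝕜 v i i y y) a rfl (hac i)]
    simp only [conjMoment₂]
    rw [← integral_finsetSum _ fun y _ => integrable_conjDiag_apply_mul v i i y y]
    have hU : ∀ U : unitaryGroup n 𝕜, ∑ k, conjDiag v U.1 k k = 0 := fun U =>
      (trace_conjDiag v U).trans (by simp [hv])
    simp [← Finset.mul_sum, hU]
  have h2 : D * (e + (D - 1) * b) = ((∑ i, v i ^ 2 : ℝ) : 𝕜) := by
    have : ∑ x, ∑ y, conjMoment₂ 𝕜 v x y y x = D * (e + (D - 1) * b) := by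
      rw [Finset.sum_congr rfl fun x _ => hsum x (fun y => conjMoment₂ 𝕜 v x y y x) b (hec x)
        (hbc x), Finset.sum_const, Finset.card_univ, nsmul_eq_mul]
    rw [← this]
    simp only [conjMoment₂]
    rw [Finset.sum_congr rfl fun x _ => (integral_finsetSum _ fun y _ =>
      integrable_conjDiag_apply_mul v x y y x).symm,
      ← integral_finsetSum _ fun x _ => integrable_finsetSum _ fun y _ =>
      integrable_conjDiag_apply_mul v x y y x]
    have hU : ∀ U : unitaryGroup n 𝕜, ∑ x, ∑ y, conjDiag v U.1 x y * conjDiag v U.1 y x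
        = ((∑ i, v i ^ 2 : ℝ) : 𝕜) := fun U => by
      have := trace_conjDiag (𝕜 := 𝕜) (fun i => v i * v i) U
      rw [← conjDiag_mul_conjDiag] at this
      simpa [Matrix.trace, mul_apply, sq] using this
    simp [hU]
  have h3 : e = a + b + ((2 / dysonIndex 𝕜 - 1 : ℝ) : 𝕜) * b := by
    rw [← conjMoment₂_same v h]; exact conjMoment₂_reflection v h
  have hβ : (dysonIndex 𝕜 : 𝕜) ≠ 0 := by exact_mod_cast (dysonIndex_pos 𝕜).ne'
  have hc2 : 2 ≤ Fintype.card n := by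
    have := Fintype.one_lt_card_iff.mpr ⟨i, k, h⟩
    omega
  have hc2r : (2 : ℝ) ≤ Fintype.card n := by exact_mod_cast hc2
  have hβr := dysonIndex_pos 𝕜
  have hD0 : D ≠ 0 := by
    rw [hD]; exact_mod_cast (by omega : Fintype.card n ≠ 0)
  have hX : ((((Fintype.card n : ℝ) - 1) * (Fintype.card n + 2 / dysonIndex 𝕜) : ℝ) : 𝕜) ≠ 0 := by
    have : 0 < ((Fintype.card n : ℝ) - 1) * (Fintype.card n + 2 / dysonIndex 𝕜) :=
      mul_pos (by linarith) (by positivity)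
    exact_mod_cast this.ne'
  push_cast at h3 hX
  rw [← hD] at hX
  have h4 : a = -2 / (dysonIndex 𝕜 * D) * b := by
    field_simp at h3 ⊢
    linear_combination (dysonIndex 𝕜 : 𝕜) * h1 - h3
  have h5 : b = (fluctuation n 𝕜 v : 𝕜) := by
    rw [fluctuation, RCLike.ofReal_div, ← h2]
    push_cast
    rw [← hD, eq_div_iff hX]
    rw [h4] at h3
    rw [h3]
    field_simp
    ring
  refine ⟨h5, ?_⟩
  rw [h4, h5]; push_cast; rfl

/-- Second moments of the entries of a Haar conjugate of a traceless real diagonal matrix. -/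
theorem conjMoment₂_eq (v : n → ℝ) (hv : ∑ i, v i = 0) (hn : 2 ≤ Fintype.card n) (i j k l : n) :
    conjMoment₂ 𝕜 v i j k l = (fluctuation n 𝕜 v : 𝕜) *
      ((if i = l ∧ j = k then 1 else 0)
        + ((2 / dysonIndex 𝕜 - 1 : ℝ) : 𝕜) * (if i = k ∧ j = l then 1 else 0)
        - ((2 / (dysonIndex 𝕜 * Fintype.card n) : ℝ) : 𝕜) * (if i = j ∧ k = l then 1 else 0)) := by
  by_cases hij : i = j
  · subst hij
    by_cases hkl : k = l
    · subst hkl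
      by_cases hik : i = k
      · subst hik
        obtain ⟨k, hk⟩ := Fintype.exists_ne_of_one_lt_card (by omega) i
        rw [conjMoment₂_reflection v hk.symm, conjMoment₂_same v hk.symm,
          (conjMoment₂_of_ne v hv hk.symm).1, (conjMoment₂_of_ne v hv hk.symm).2]
        simp only [and_self, if_true]
        push_cast
        ring
      · rw [(conjMoment₂_of_ne v hv hik).2]
        simp only [hik, and_self, if_true, if_false]
        push_cast
        ring
    · have h1 : ¬ (i = l ∧ i = k) := by rintro ⟨rfl, rfl⟩; exact hkl rfl
      have h2 : ¬ (i = k ∧ i = l) := by rintro ⟨rfl, rfl⟩; exact hkl rfl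
      rw [conjMoment₂_eq_zero v k (by split_ifs <;> simp_all)]
      simp [h1, h2, hkl]
  · by_cases hkl : k = l
    · subst hkl
      have h1 : ¬ (i = k ∧ j = k) := by rintro ⟨rfl, rfl⟩; exact hij rfl
      rw [conjMoment₂_eq_zero v i (by split_ifs <;> simp_all)]
      simp [h1, hij]
    · by_cases h1 : i = l ∧ j = k
      · obtain ⟨rfl, rfl⟩ := h1
        rw [(conjMoment₂_of_ne v hv hij).1]
        simp [hij]
      · by_cases h2 : i = k ∧ j = l
        · obtain ⟨rfl, rfl⟩ := h2
          rw [conjMoment₂_same v hij, (conjMoment₂_of_ne v hv hij).1]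
          simp [hij, mul_comm]
        · simp only [h1, h2, hij, if_false, false_and]
          have : conjMoment₂ 𝕜 v i j k l = 0 := by
            by_cases hik : i = k
            · subst hik
              have hjl : j ≠ l := fun h => h2 ⟨rfl, h⟩
              exact conjMoment₂_eq_zero v j (by simp [Ne.symm hij, hjl])
            · by_cases hil : i = l
              · subst hil
                have hjk : j ≠ k := fun h => h1 ⟨rfl, h⟩
                exact conjMoment₂_eq_zero v j (by simp [Ne.symm hij, hjk])
              · exact conjMoment₂_eq_zero v i (by simp [hij, hik, hil])
          rw [this]; simp

theorem map_eq_sum_single {E : Type*} [AddCommGroup E] [Module 𝕜 E] (L : Matrix n n 𝕜 →ₗ[𝕜] E)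
    (G : Matrix n n 𝕜) : L G = ∑ i, ∑ j, G i j • L (single i j 1) := by
  conv_lhs => rw [matrix_eq_sum_single G]
  simp only [map_sum]
  refine Finset.sum_congr rfl fun i _ => Finset.sum_congr rfl fun j _ => ?_
  rw [← map_smul, smul_single, smul_eq_mul, mul_one]

/-- A linear functional of a Haar conjugate. -/
theorem integral_linear_conjDiag (v : n → ℝ) (L : Matrix n n 𝕜 →ₗ[𝕜] 𝕜) :
    ∫ U : unitaryGroup n 𝕜, L (conjDiag v U.1) ∂haarUnitary n 𝕜
      = (((∑ k, v k) / Fintype.card n : ℝ) : 𝕜) * L 1 := by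
  simp_rw [map_eq_sum_single L (conjDiag v _), smul_eq_mul]
  have hi := fun i j => (integrable_conjDiag_apply (𝕜 := 𝕜) v i j).mul_const (L (single i j 1))
  rw [integral_finsetSum _ fun i _ => integrable_finsetSum _ fun j _ => hi i j]
  have h : ∀ i, ∫ U : unitaryGroup n 𝕜, ∑ j, conjDiag v U.1 i j * L (single i j 1)
      ∂haarUnitary n 𝕜 = (((∑ k, v k) / Fintype.card n : ℝ) : 𝕜) * L (single i i 1) := fun i => by
    rw [integral_finsetSum _ fun j _ => hi i j]
    simp only [integral_mul_const, ← conjMoment₁_def, conjMoment₁_eq, ite_mul, zero_mul,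
      Finset.sum_ite_eq, Finset.mem_univ, if_true]
  simp only [h, ← Finset.mul_sum, ← map_sum, sum_single_one]

/-- A bilinear functional of a Haar conjugate of a traceless diagonal matrix. -/
theorem integral_bilinear_conjDiag (v : n → ℝ) (hv : ∑ i, v i = 0) (hn : 2 ≤ Fintype.card n)
    (L : Matrix n n 𝕜 →ₗ[𝕜] Matrix n n 𝕜 →ₗ[𝕜] 𝕜) :
    ∫ U : unitaryGroup n 𝕜, L (conjDiag v U.1) (conjDiag v U.1) ∂haarUnitary n 𝕜
      = (fluctuation n 𝕜 v : 𝕜) * (∑ i, ∑ j, L (single i j 1) (single j i 1)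
        + ((2 / dysonIndex 𝕜 - 1 : ℝ) : 𝕜) * ∑ i, ∑ j, L (single i j 1) (single i j 1)
        - ((2 / (dysonIndex 𝕜 * Fintype.card n) : ℝ) : 𝕜) * L 1 1) := by
  have hL : ∀ G : Matrix n n 𝕜, L G G = ∑ i, ∑ j, ∑ k, ∑ l, G i j * G k l *
      L (single i j 1) (single k l 1) := fun G => by
    rw [map_eq_sum_single L G]
    simp only [LinearMap.sum_apply, LinearMap.smul_apply, map_eq_sum_single (L _) G,
      smul_eq_mul, mul_assoc, Finset.mul_sum]
  have h1 : L 1 1 = ∑ i, ∑ k, L (single i i 1) (single k k 1) := by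
    conv_lhs => rw [← sum_single_one (m := n) (α := 𝕜)]
    simp only [map_sum, LinearMap.sum_apply]
    exact Finset.sum_comm
  have hi := fun i j k l => (integrable_conjDiag_apply_mul (𝕜 := 𝕜) v i j k l).mul_const
    (L (single i j 1) (single k l 1))
  have hi1 := fun i j k => integrable_finsetSum Finset.univ fun l _ => hi i j k l
  have hi2 := fun i j => integrable_finsetSum Finset.univ fun k _ => hi1 i j k
  have hi3 := fun i => integrable_finsetSum Finset.univ fun j _ => hi2 i j
  calc ∫ U : unitaryGroup n 𝕜, L (conjDiag v U.1) (conjDiag v U.1) ∂haarUnitary n 𝕜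
      = ∑ i, ∑ j, ∑ k, ∑ l, conjMoment₂ 𝕜 v i j k l * L (single i j 1) (single k l 1) := by
        simp_rw [hL (conjDiag v _)]
        rw [integral_finsetSum _ fun i _ => hi3 i]
        refine Finset.sum_congr rfl fun i _ => ?_
        rw [integral_finsetSum _ fun j _ => hi2 i j]
        refine Finset.sum_congr rfl fun j _ => ?_
        rw [integral_finsetSum _ fun k _ => hi1 i j k]
        refine Finset.sum_congr rfl fun k _ => ?_
        rw [integral_finsetSum _ fun l _ => hi i j k l]
        simp only [integral_mul_const, conjMoment₂_def]
    _ = _ := by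
        simp only [conjMoment₂_eq v hv hn, mul_assoc, ← Finset.mul_sum, h1]
        congr 1
        simp only [add_mul, sub_mul, Finset.sum_add_distrib, Finset.sum_sub_distrib, mul_assoc,
          ← Finset.mul_sum]
        congr 2
        · simp [ite_and]
        · simp [ite_and]
        · simp [ite_and]

/-- The variance of the Haar-conjugated alternating product `Tr (A G A G)` for traceless `A`. -/
theorem integral_trace_alternating (a v : n → ℝ) (ha : ∑ i, a i = 0) (hv : ∑ i, v i = 0)
    (hn : 2 ≤ Fintype.card n) :
    ∫ U : unitaryGroup n 𝕜, trace (diagonal (fun i => (a i : 𝕜)) * conjDiag v U.1 *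
        diagonal (fun i => (a i : 𝕜)) * conjDiag v U.1) ∂haarUnitary n 𝕜
      = ((fluctuation n 𝕜 v * (∑ i, a i ^ 2) *
        (2 / dysonIndex 𝕜 - 1 - 2 / (dysonIndex 𝕜 * Fintype.card n)) : ℝ) : 𝕜) := by
  set A : Matrix n n 𝕜 := diagonal fun i => (a i : 𝕜) with hA
  let L : Matrix n n 𝕜 →ₗ[𝕜] Matrix n n 𝕜 →ₗ[𝕜] 𝕜 :=
    LinearMap.mk₂ 𝕜 (fun X Y => trace (A * X * A * Y))
      (fun X Y Z => by simp [Matrix.mul_add, Matrix.add_mul])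
      (fun c X Z => by simp)
      (fun X Y Z => by simp [Matrix.mul_add])
      (fun c X Z => by simp)
  have hLs : ∀ i j k l, L (single i j 1) (single k l 1) =
      if j = k ∧ l = i then (a i * a j : 𝕜) else 0 := fun i j k l => by
    have h1 : A * single i j 1 * A = single i j (a i * a j : 𝕜) := by
      ext x y
      rw [hA, mul_diagonal, diagonal_mul, single_apply, single_apply]
      by_cases h : i = x ∧ j = y
      · obtain ⟨rfl, rfl⟩ := h; simp
      · simp [h]
    change trace (A * single i j 1 * A * single k l 1) = _
    rw [h1]
    by_cases h : j = k
    · subst h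
      rw [single_mul_single_same]
      by_cases h' : l = i
      · subst h'; simp
      · simp [h', trace_single_eq_of_ne _ _ _ (Ne.symm h')]
    · simp [h, single_mul_single_of_ne]
  have h11 : L 1 1 = ((∑ i, a i ^ 2 : ℝ) : 𝕜) := by
    change trace (A * 1 * A * 1) = _
    simp [hA, diagonal_mul_diagonal, sq]
  have hsq : (∑ i, (a i : 𝕜)) = 0 := by exact_mod_cast congrArg (fun x : ℝ => (x : 𝕜)) ha
  have := integral_bilinear_conjDiag v hv hn L
  refine Eq.trans this ?_
  rw [h11]
  simp only [hLs, and_self, if_true]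
  -- The pairing that would dominate is (Tr A)², which vanishes for traceless A; the other two
  -- pairings both give Tr A².
  have e1 : ∑ i, ∑ j, (a i * a j : 𝕜) = 0 := by
    simp only [← Finset.mul_sum, hsq, mul_zero, Finset.sum_const_zero]
  have e2 : ∑ i, ∑ j, (if j = i then (a i * a j : 𝕜) else 0)
      = ((∑ i, a i ^ 2 : ℝ) : 𝕜) := by
    simp [sq]
  rw [e1, e2]
  push_cast
  ring

end HaarSecondMoments

/-! ### Operators on the chain -/

section PureTensors

variable {S : Type*} [Fintype S] [DecidableEq S] {d : ℕ} {𝕜 : Type*} [RCLike 𝕜]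

/-- The tensor product of one-site matrices. -/
def pureTensor (f : S → Matrix (Fin d) (Fin d) 𝕜) : Matrix (S → Fin d) (S → Fin d) 𝕜 :=
  fun x y => ∏ s, f s (x s) (y s)

theorem pureTensor_mul (f g : S → Matrix (Fin d) (Fin d) 𝕜) :
    pureTensor f * pureTensor g = pureTensor (f * g) := by
  ext x y
  simp only [pureTensor, mul_apply, Pi.mul_apply, Finset.prod_univ_sum, Fintype.piFinset_univ,
    Finset.prod_mul_distrib]

theorem trace_pureTensor (f : S → Matrix (Fin d) (Fin d) 𝕜) :
    trace (pureTensor f) = ∏ s, trace (f s) := by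
  simp only [pureTensor, trace, diag_apply, Finset.prod_univ_sum, Fintype.piFinset_univ]

end PureTensors

/-! ### Two-site operators placed on a bond -/

section EmbedBond

variable {d M : ℕ} {𝕜 : Type*} [RCLike 𝕜]

/-- The one-site factors of `P ⊗ R` placed on the bond `l`. -/
def bondFactors (l : Fin M) (P R : Matrix (Fin d) (Fin d) 𝕜) (s : Fin (M + 1)) :
    Matrix (Fin d) (Fin d) 𝕜 :=
  if s = l.castSucc then P else if s = l.succ then R else 1

/-- On product operators everything factorizes over sites; products, commutators and traces of
embedded operators are reduced to this case by linearity. -/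
theorem embedBond_kronecker (l : Fin M) (P R : Matrix (Fin d) (Fin d) 𝕜) :
    embedBond l (kroneckerMap (· * ·) P R) = pureTensor (bondFactors l P R) := by
  ext x y
  have hne : l.succ ≠ l.castSucc := (Fin.castSucc_lt_succ).ne'
  rw [embedBond, pureTensor, Finset.prod_eq_mul_prod_sdiff_singleton_of_mem (Finset.mem_univ l.castSucc),
    Finset.prod_eq_mul_prod_sdiff_singleton_of_mem (i := l.succ) (by simp [hne])]
  split_ifs with h
  · rw [Finset.prod_eq_one, mul_one]
    · simp [bondFactors, hne]
    · intro s hs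
      simp only [Finset.mem_sdiff, Finset.mem_univ, Finset.mem_singleton, true_and] at hs
      rw [bondFactors, if_neg hs.1, if_neg hs.2, h s hs.1 hs.2, one_apply_eq]
  · push Not at h
    obtain ⟨s, h1, h2, h3⟩ := h
    rw [Finset.prod_eq_zero (i := s) (by simp [h1, h2]) (by simp [bondFactors, h1, h2, h3])]
    simp

/-- `embedBond l` as a linear map. -/
def embedBondₗ (l : Fin M) : Matrix (Fin d × Fin d) (Fin d × Fin d) 𝕜 →ₗ[𝕜]
    Matrix (Fin (M + 1) → Fin d) (Fin (M + 1) → Fin d) 𝕜 where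
  toFun := embedBond l
  map_add' X Y := by ext x y; simp only [embedBond, Matrix.add_apply]; split_ifs <;> simp
  map_smul' c X := by ext x y; simp [embedBond]

theorem embedBondₗ_apply (l : Fin M) (X : Matrix (Fin d × Fin d) (Fin d × Fin d) 𝕜) :
    embedBondₗ l X = embedBond l X := rfl

theorem embedBond_add (l : Fin M) (X Y : Matrix (Fin d × Fin d) (Fin d × Fin d) 𝕜) :
    embedBond l (X + Y) = embedBond l X + embedBond l Y := map_add (embedBondₗ l) X Y

theorem embedBond_smul (l : Fin M) (c : 𝕜) (X : Matrix (Fin d × Fin d) (Fin d × Fin d) 𝕜) :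
    embedBond l (c • X) = c • embedBond l X := map_smul (embedBondₗ l) c X

/-- Matrix units of the two-site space are Kronecker products of one-site matrix units, so linear
statements need checking only on P ⊗ R. -/
theorem bond_induction {p : Matrix (Fin d × Fin d) (Fin d × Fin d) 𝕜 → Prop}
    (add : ∀ X Y, p X → p Y → p (X + Y)) (smul : ∀ (c : 𝕜) X, p X → p (c • X))
    (kron : ∀ P R : Matrix (Fin d) (Fin d) 𝕜, p (kroneckerMap (· * ·) P R))
    (X : Matrix (Fin d × Fin d) (Fin d × Fin d) 𝕜) : p X := by
  have h0 : p 0 := by simpa using smul 0 _ (kron 0 0)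
  rw [matrix_eq_sum_single X]
  refine Finset.sum_induction _ p add h0 fun i _ => Finset.sum_induction _ p add h0 fun j _ => ?_
  have := smul (X i j) _ (kron (single i.1 j.1 1) (single i.2 j.2 1))
  rwa [single_kronecker_single, mul_one, smul_single, smul_eq_mul, mul_one] at this

theorem bondFactors_mul (l : Fin M) (P R P' R' : Matrix (Fin d) (Fin d) 𝕜) :
    bondFactors l P R * bondFactors l P' R' = bondFactors l (P * P') (R * R') := by
  ext1 s
  simp only [bondFactors, Pi.mul_apply]
  split_ifs <;> simp

theorem embedBond_mul (l : Fin M) (X Y : Matrix (Fin d × Fin d) (Fin d × Fin d) 𝕜) :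
    embedBond l (X * Y) = embedBond l X * embedBond l Y := by
  induction X using bond_induction with
  | add X X' h h' => simp only [embedBond_add, Matrix.add_mul, h, h']
  | smul c X h => simp only [embedBond_smul, Matrix.smul_mul, h]
  | kron P R =>
    induction Y using bond_induction with
    | add X X' h h' => simp only [embedBond_add, Matrix.mul_add, h, h']
    | smul c X h => simp only [embedBond_smul, Matrix.mul_smul, h]
    | kron P' R' =>
      rw [embedBond_kronecker, embedBond_kronecker, pureTensor_mul, bondFactors_mul,
        ← embedBond_kronecker]
      exact congrArg _ (mul_kronecker_mul P P' R R').symm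

theorem embedBond_one (l : Fin M) :
    embedBond l (1 : Matrix (Fin d × Fin d) (Fin d × Fin d) 𝕜) = 1 := by
  ext x y
  rw [embedBond, one_apply, one_apply]
  by_cases h : x = y
  · subst h; simp
  · rw [if_neg h]
    split_ifs with h1 h2
    · refine absurd (funext fun s => ?_) h
      rw [Prod.mk.injEq] at h2
      by_cases hs : s = l.castSucc
      · rw [hs, h2.1]
      · by_cases hs' : s = l.succ
        · rw [hs', h2.2]
        · exact h1 s hs hs'
    · rfl
    · rfl

theorem embedBond_conjTranspose (l : Fin M) (X : Matrix (Fin d × Fin d) (Fin d × Fin d) 𝕜) :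
    embedBond l Xᴴ = (embedBond l X)ᴴ := by
  ext x y
  simp only [embedBond, conjTranspose_apply]
  by_cases h : ∀ s, s ≠ l.castSucc → s ≠ l.succ → x s = y s
  · rw [if_pos h, if_pos fun s h1 h2 => (h s h1 h2).symm]
  · rw [if_neg h, if_neg fun h' => h fun s h1 h2 => (h' s h1 h2).symm, star_zero]

/-- Two bonds without a common site. -/
def DisjointBonds (l m : Fin M) : Prop := (l : ℕ) + 1 < m ∨ (m : ℕ) + 1 < l

/-- At each site at least one of the two operators acts as the identity. -/
theorem embedBond_commute {l m : Fin M} (hlm : DisjointBonds l m)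
    (X Y : Matrix (Fin d × Fin d) (Fin d × Fin d) 𝕜) :
    embedBond l X * embedBond m Y = embedBond m Y * embedBond l X := by
  induction X using bond_induction with
  | add X X' h h' => simp only [embedBond_add, Matrix.add_mul, Matrix.mul_add, h, h']
  | smul c X h => simp only [embedBond_smul, Matrix.smul_mul, Matrix.mul_smul, h]
  | kron P R =>
    induction Y using bond_induction with
    | add X X' h h' => simp only [embedBond_add, Matrix.mul_add, Matrix.add_mul, h, h']
    | smul c X h => simp only [embedBond_smul, Matrix.mul_smul, Matrix.smul_mul, h]
    | kron P' R' =>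
      rw [embedBond_kronecker, embedBond_kronecker, pureTensor_mul, pureTensor_mul]
      congr 1
      ext1 s
      have : (s = l.castSucc ∨ s = l.succ) → ¬ (s = m.castSucc ∨ s = m.succ) := by
        simp only [Fin.ext_iff, Fin.val_castSucc, Fin.val_succ]
        rcases hlm with h | h <;> omega
      simp only [bondFactors, Pi.mul_apply]
      by_cases hs : s = l.castSucc ∨ s = l.succ
      · have h' := this hs
        rw [not_or] at h'
        rw [if_neg h'.1, if_neg h'.2, mul_one, one_mul]
      · rw [not_or] at hs
        rw [if_neg hs.1, if_neg hs.2, mul_one, one_mul]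

theorem embedBond_diagonal (l : Fin M) (f : Fin d × Fin d → 𝕜) :
    embedBond l (diagonal f) = diagonal fun x => f (x l.castSucc, x l.succ) := by
  ext x y
  rw [embedBond, diagonal_apply, diagonal_apply]
  by_cases h : x = y
  · subst h; simp
  · rw [if_neg h]
    split_ifs with h1 h2
    · refine absurd (funext fun s => ?_) h
      rw [Prod.mk.injEq] at h2
      by_cases hs : s = l.castSucc
      · rw [hs, h2.1]
      · by_cases hs' : s = l.succ
        · rw [hs', h2.2]
        · exact h1 s hs hs'
    · rfl
    · rfl

theorem continuous_embedBond (l : Fin M) :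
    Continuous (embedBond l : Matrix (Fin d × Fin d) (Fin d × Fin d) 𝕜 → _) := by
  refine continuous_matrix fun x y => ?_
  simp only [embedBond]
  split_ifs
  · exact continuous_id.matrix_elem _ _
  · exact continuous_const

end EmbedBond

/-! ### Conjugation by a layer of disjoint bonds -/

section Layers

variable {d M : ℕ} {𝕜 : Type*} [RCLike 𝕜]

/-- A product of unitaries on pairwise disjoint bonds conjugates each local term separately. -/
theorem layer_conj (U : Fin M → unitaryGroup (Fin d × Fin d) 𝕜) (L : List (Fin M))
    (hL : L.Pairwise DisjointBonds) :
    ((L.map fun l => embedBond l (U l).1).prod)ᴴ * (L.map fun l => embedBond l (U l).1).prod = 1 ∧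
    ∀ l ∈ L, ∀ X : Matrix (Fin d × Fin d) (Fin d × Fin d) 𝕜,
      ((L.map fun l => embedBond l (U l).1).prod)ᴴ * embedBond l X *
        (L.map fun l => embedBond l (U l).1).prod = embedBond l ((U l).1ᴴ * X * (U l).1) := by
  induction L with
  | nil => simp
  | cons a L ih =>
    rw [List.pairwise_cons] at hL
    obtain ⟨ih1, ih2⟩ := ih hL.2
    simp only [List.map_cons, List.prod_cons, conjTranspose_mul]
    set P := (L.map fun l => embedBond l (U l).1).prod with hP
    have hU : (embedBond a (U a).1)ᴴ * embedBond a (U a).1 = 1 := by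
      rw [← embedBond_conjTranspose, ← embedBond_mul, unitaryGroup.conjTranspose_mul, embedBond_one]
    -- The other factors of the layer live on bonds disjoint from a, so they pass through and cancel
    -- against their adjoints.
    have hcomm : ∀ X, embedBond a X * P = P * embedBond a X := fun X => by
      have : Commute (embedBond a X) P := by
        rw [hP]
        refine Commute.list_prod_right _ _ fun Y hY => ?_
        obtain ⟨b, hb, rfl⟩ := List.mem_map.mp hY
        exact embedBond_commute (hL.1 b hb) _ _
      exact this
    refine ⟨?_, fun l hl X => ?_⟩
    · calc Pᴴ * (embedBond a (U a).1)ᴴ * (embedBond a (U a).1 * P)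
          = Pᴴ * ((embedBond a (U a).1)ᴴ * embedBond a (U a).1) * P := by
            simp only [Matrix.mul_assoc]
        _ = 1 := by rw [hU, Matrix.mul_one, ih1]
    · have e : Pᴴ * (embedBond a (U a).1)ᴴ * embedBond l X * (embedBond a (U a).1 * P)
          = Pᴴ * ((embedBond a (U a).1)ᴴ * embedBond l X * embedBond a (U a).1) * P := by
        simp only [Matrix.mul_assoc]
      rw [e]
      rcases List.mem_cons.mp hl with rfl | hl
      · rw [← embedBond_conjTranspose, ← embedBond_mul, ← embedBond_mul, Matrix.mul_assoc, hcomm,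
          ← Matrix.mul_assoc, ih1, Matrix.one_mul]
      · rw [Matrix.mul_assoc _ (embedBond l X), ← embedBond_commute (hL.1 l hl),
          ← Matrix.mul_assoc _ _ (embedBond l X), hU, Matrix.one_mul]
        exact ih2 l hl X

theorem disjointBonds_of_same_parity {l m : Fin M} (h : l ≠ m)
    (hp : IsOddBond l ↔ IsOddBond m) : DisjointBonds l m := by
  simp only [IsOddBond, Nat.odd_iff] at hp
  rw [ne_eq, Fin.ext_iff] at h
  rw [DisjointBonds]
  omega

theorem pairwise_oddBonds :
    ((List.finRange M).filter fun l => IsOddBond l).Pairwise DisjointBonds := by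
  refine (((List.nodup_finRange M).filter _).pairwise_of_forall_ne fun l hl m hm h => ?_)
  simp only [List.mem_filter, decide_eq_true_eq] at hl hm
  exact disjointBonds_of_same_parity h (iff_of_true hl.2 hm.2)

theorem pairwise_evenBonds :
    ((List.finRange M).filter fun l => ¬ IsOddBond l).Pairwise DisjointBonds := by
  refine (((List.nodup_finRange M).filter _).pairwise_of_forall_ne fun l hl m hm h => ?_)
  simp only [List.mem_filter, decide_eq_true_eq] at hl hm
  exact disjointBonds_of_same_parity h (iff_of_false hl.2 hm.2)

theorem layerA_unitary (U : Fin M → unitaryGroup (Fin d × Fin d) 𝕜) :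
    (layerA U)ᴴ * layerA U = 1 :=
  (layer_conj U _ pairwise_oddBonds).1

theorem layerB_unitary (U : Fin M → unitaryGroup (Fin d × Fin d) 𝕜) :
    (layerB U)ᴴ * layerB U = 1 :=
  (layer_conj U _ pairwise_evenBonds).1

/-- The local term `I ⊗ U_lᴴ diag(v_l) U_l ⊗ I`. -/
def localTerm (v : Fin M → Fin d × Fin d → ℝ) (U : Fin M → unitaryGroup (Fin d × Fin d) 𝕜)
    (l : Fin M) : Matrix (Fin (M + 1) → Fin d) (Fin (M + 1) → Fin d) 𝕜 :=
  embedBond l (conjDiag (v l) (U l).1)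

theorem layerA_conj (v : Fin M → Fin d × Fin d → ℝ)
    (U : Fin M → unitaryGroup (Fin d × Fin d) 𝕜) :
    (layerA U)ᴴ * diagA 𝕜 v * layerA U = ∑ l with IsOddBond l, localTerm v U l := by
  rw [diagA, Finset.mul_sum, Finset.sum_mul]
  refine Finset.sum_congr rfl fun l hl => (layer_conj U _ pairwise_oddBonds).2 l ?_ _
  simpa using hl

theorem layerB_conj (v : Fin M → Fin d × Fin d → ℝ)
    (U : Fin M → unitaryGroup (Fin d × Fin d) 𝕜) :
    (layerB U)ᴴ * diagB 𝕜 v * layerB U = ∑ l with ¬ IsOddBond l, localTerm v U l := by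
  rw [diagB, Finset.mul_sum, Finset.sum_mul]
  refine Finset.sum_congr rfl fun l hl => (layer_conj U _ pairwise_evenBonds).2 l ?_ _
  simpa using hl

end Layers

/-! ### Averages over the local eigenvectors -/

section Resampling

/-- Replacing one coordinate of a product-distributed point by an independent copy preserves the
law. -/
theorem measurePreserving_update {ι X : Type*} [Fintype ι] [DecidableEq ι] [MeasurableSpace X]
    (μ : ι → Measure X) [∀ i, IsProbabilityMeasure (μ i)] (l : ι) :
    MeasurePreserving (fun p : (ι → X) × X => Function.update p.1 l p.2)
      ((Measure.pi μ).prod (μ l)) (Measure.pi μ) := by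
  have hm : Measurable fun p : (ι → X) × X => Function.update p.1 l p.2 := measurable_update'
  refine ⟨hm, (Measure.pi_eq fun s hs => ?_).symm⟩
  rw [Measure.map_apply hm (MeasurableSet.univ_pi hs)]
  have : (fun p : (ι → X) × X => Function.update p.1 l p.2) ⁻¹' Set.univ.pi s
      = (Set.univ.pi (Function.update s l Set.univ)) ×ˢ s l := by
    ext p
    simp only [Set.mem_preimage, Set.mem_pi, Set.mem_univ, true_imp_iff, Set.mem_prod]
    refine ⟨fun h => ⟨fun i => ?_, by simpa using h l⟩, fun h i => ?_⟩
    · by_cases hi : i = l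
      · subst hi; simp
      · simpa [hi] using h i
    · by_cases hi : i = l
      · subst hi; simpa using h.2
      · simpa [hi] using h.1 i
  rw [this, Measure.prod_prod, Measure.pi_pi, Fintype.prod_eq_mul_prod_compl l,
    Fintype.prod_eq_mul_prod_compl l (fun i => μ i (s i))]
  rw [Function.update_self, measure_univ, one_mul, mul_comm]
  congr 1
  refine Finset.prod_congr rfl fun i hi => ?_
  rw [Function.update_of_ne (by simpa using hi)]

/-- Fubini in the form used throughout: one bond is integrated while all the others are frozen. -/
theorem integral_pi_update {ι X : Type*} [Fintype ι] [DecidableEq ι] [MeasurableSpace X]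
    (μ : ι → Measure X) [∀ i, IsProbabilityMeasure (μ i)] (l : ι) {E : Type*}
    [NormedAddCommGroup E] [NormedSpace ℝ E] {f : (ι → X) → E} (hf : Integrable f (Measure.pi μ)) :
    ∫ x, f x ∂Measure.pi μ = ∫ x, ∫ y, f (Function.update x l y) ∂μ l ∂Measure.pi μ := by
  have hp := measurePreserving_update μ l
  rw [← integral_prod (fun p : (ι → X) × X => f (Function.update p.1 l p.2))
    (hp.integrable_comp_of_integrable hf)]
  conv_lhs => rw [← hp.map_eq]
  refine integral_map hp.measurable.aemeasurable ?_
  rw [hp.map_eq]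
  exact hf.aestronglyMeasurable

end Resampling

section LocalAverages

variable {d M : ℕ} {𝕜 : Type*} [RCLike 𝕜]

variable (d M 𝕜) in
/-- The law of independent Haar local eigenvectors. -/
def eigenvectorLaw : Measure (Fin M → unitaryGroup (Fin d × Fin d) 𝕜) :=
  Measure.pi fun _ => haarUnitary (Fin d × Fin d) 𝕜

instance instIsProbabilityMeasureEigenvectorLaw : IsProbabilityMeasure (eigenvectorLaw d M 𝕜) :=
  inferInstanceAs (IsProbabilityMeasure (Measure.pi _))

/-- The function `F` does not depend on the eigenvectors of the bond `l`. -/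
def IndepOfBond {E : Type*} (l : Fin M) (F : (Fin M → unitaryGroup (Fin d × Fin d) 𝕜) → E) : Prop :=
  ∀ U W, F (Function.update U l W) = F U

/-- The functional may depend on the eigenvectors of all other bonds: with those frozen, the
single-matrix Haar formula applies. -/
theorem integral_linear_local (w : Fin d × Fin d → ℝ) (l : Fin M)
    (L : (Fin M → unitaryGroup (Fin d × Fin d) 𝕜) →
      Matrix (Fin d × Fin d) (Fin d × Fin d) 𝕜 →ₗ[𝕜] 𝕜)
    (hL : IndepOfBond l L) (hc : Continuous fun U => L U (conjDiag w (U l).1)) :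
    ∫ U, L U (conjDiag w (U l).1) ∂eigenvectorLaw d M 𝕜
      = (((∑ k, w k) / Fintype.card (Fin d × Fin d) : ℝ) : 𝕜) *
        ∫ U, L U 1 ∂eigenvectorLaw d M 𝕜 := by
  rw [eigenvectorLaw, integral_pi_update _ l hc.integrable_of_compact, ← integral_const_mul]
  refine integral_congr_ae (ae_of_all _ fun U => ?_)
  simp only [hL U, Function.update_self]
  exact integral_linear_conjDiag w (L U)

theorem integral_bilinear_local (w : Fin d × Fin d → ℝ) (hw : ∑ i, w i = 0) (hd : 2 ≤ d)
    (l : Fin M) (L : (Fin M → unitaryGroup (Fin d × Fin d) 𝕜) →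
      Matrix (Fin d × Fin d) (Fin d × Fin d) 𝕜 →ₗ[𝕜]
      Matrix (Fin d × Fin d) (Fin d × Fin d) 𝕜 →ₗ[𝕜] 𝕜)
    (hL : IndepOfBond l L)
    (hc : Continuous fun U => L U (conjDiag w (U l).1) (conjDiag w (U l).1)) :
    ∫ U, L U (conjDiag w (U l).1) (conjDiag w (U l).1) ∂eigenvectorLaw d M 𝕜
      = (fluctuation (Fin d × Fin d) 𝕜 w : 𝕜) * ∫ U,
        (∑ i, ∑ j, L U (single i j 1) (single j i 1)
        + ((2 / dysonIndex 𝕜 - 1 : ℝ) : 𝕜) * ∑ i, ∑ j, L U (single i j 1) (single i j 1)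
        - ((2 / (dysonIndex 𝕜 * Fintype.card (Fin d × Fin d)) : ℝ) : 𝕜) * L U 1 1)
        ∂eigenvectorLaw d M 𝕜 := by
  rw [eigenvectorLaw, integral_pi_update _ l hc.integrable_of_compact, ← integral_const_mul]
  refine integral_congr_ae (ae_of_all _ fun U => ?_)
  simp only [hL U, Function.update_self]
  refine integral_bilinear_conjDiag w hw ?_ (L U)
  simp only [Fintype.card_prod, Fintype.card_fin]
  nlinarith

theorem continuous_localTerm (v : Fin M → Fin d × Fin d → ℝ) (l : Fin M) :
    Continuous fun U : Fin M → unitaryGroup (Fin d × Fin d) 𝕜 => localTerm v U l :=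
  (continuous_embedBond l).comp ((continuous_conjDiag (v l)).comp (continuous_apply l))

/-- The linear functional `X ↦ Tr ((I ⊗ X ⊗ I) P)`. -/
def traceBond (l : Fin M) (P : Matrix (Fin (M + 1) → Fin d) (Fin (M + 1) → Fin d) 𝕜) :
    Matrix (Fin d × Fin d) (Fin d × Fin d) 𝕜 →ₗ[𝕜] 𝕜 :=
  (traceLinearMap _ 𝕜 𝕜).comp ((LinearMap.mulRight 𝕜 P).comp (embedBondₗ l))

theorem traceBond_apply (l : Fin M) (P : Matrix (Fin (M + 1) → Fin d) (Fin (M + 1) → Fin d) 𝕜)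
    (X : Matrix (Fin d × Fin d) (Fin d × Fin d) 𝕜) :
    traceBond l P X = trace (embedBond l X * P) := rfl

/-- A local term independent of the rest of the word may be replaced by its normalised trace; for
centred eigenvalues the word averages to zero. -/
theorem integral_trace_localTerm_mul (v : Fin M → Fin d × Fin d → ℝ) (l : Fin M)
    {P : (Fin M → unitaryGroup (Fin d × Fin d) 𝕜) →
      Matrix (Fin (M + 1) → Fin d) (Fin (M + 1) → Fin d) 𝕜}
    (hP : IndepOfBond l P) (hc : Continuous P) :
    ∫ U, trace (localTerm v U l * P U) ∂eigenvectorLaw d M 𝕜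
      = (((∑ k, v l k) / (d : ℝ) ^ 2 : ℝ) : 𝕜) * ∫ U, trace (P U) ∂eigenvectorLaw d M 𝕜 := by
  have := integral_linear_local (v l) l (fun U => traceBond l (P U))
    (fun U W => by simp only [hP U W])
    (by
      change Continuous fun U => trace (localTerm v U l * P U)
      exact ((continuous_localTerm v l).matrix_mul hc).matrix_trace)
  simp only [traceBond_apply, embedBond_one, Matrix.one_mul] at this
  refine Eq.trans this ?_
  simp [sq]

/-- The sum of the local terms over a set of bonds. -/
def layerSum (v : Fin M → Fin d × Fin d → ℝ) (s : Finset (Fin M))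
    (U : Fin M → unitaryGroup (Fin d × Fin d) 𝕜) :
    Matrix (Fin (M + 1) → Fin d) (Fin (M + 1) → Fin d) 𝕜 := ∑ l ∈ s, localTerm v U l

theorem continuous_layerSum (v : Fin M → Fin d × Fin d → ℝ) (s : Finset (Fin M)) :
    Continuous (layerSum (𝕜 := 𝕜) v s) :=
  continuous_finsetSum _ fun l _ => continuous_localTerm v l

theorem indepOfBond_localTerm (v : Fin M → Fin d × Fin d → ℝ) {l m : Fin M} (h : m ≠ l) :
    IndepOfBond l fun U : Fin M → unitaryGroup (Fin d × Fin d) 𝕜 => localTerm v U m := fun U W => by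
  simp only [localTerm, Function.update_of_ne h]

theorem indepOfBond_layerSum (v : Fin M → Fin d × Fin d → ℝ) {s : Finset (Fin M)} {l : Fin M}
    (h : l ∉ s) : IndepOfBond l (layerSum (𝕜 := 𝕜) v s) := fun U W => by
  refine Finset.sum_congr rfl fun m hm => indepOfBond_localTerm v ?_ U W
  rintro rfl; exact h hm

theorem IndepOfBond.mul {l : Fin M} {P R : (Fin M → unitaryGroup (Fin d × Fin d) 𝕜) →
      Matrix (Fin (M + 1) → Fin d) (Fin (M + 1) → Fin d) 𝕜}
    (hP : IndepOfBond l P) (hR : IndepOfBond l R) : IndepOfBond l fun U => P U * R U :=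
  fun U W => by simp only [hP U W, hR U W]

theorem integrable_trace {P : (Fin M → unitaryGroup (Fin d × Fin d) 𝕜) →
      Matrix (Fin (M + 1) → Fin d) (Fin (M + 1) → Fin d) 𝕜} (hc : Continuous P) :
    Integrable (fun U => trace (P U)) (eigenvectorLaw d M 𝕜) :=
  hc.matrix_trace.integrable_of_compact

theorem integral_trace_layerSum_mul (v : Fin M → Fin d × Fin d → ℝ) (hv : ∀ l, ∑ k, v l k = 0)
    (s : Finset (Fin M)) {P : (Fin M → unitaryGroup (Fin d × Fin d) 𝕜) →
      Matrix (Fin (M + 1) → Fin d) (Fin (M + 1) → Fin d) 𝕜}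
    (hP : ∀ l ∈ s, IndepOfBond l P) (hc : Continuous P) :
    ∫ U, trace (layerSum v s U * P U) ∂eigenvectorLaw d M 𝕜 = 0 := by
  simp only [layerSum, Finset.sum_mul, trace_sum]
  rw [integral_finsetSum _ fun l _ => integrable_trace ((continuous_localTerm v l).matrix_mul hc)]
  refine Finset.sum_eq_zero fun l hl => ?_
  rw [integral_trace_localTerm_mul v l (hP l hl) hc, hv]
  simp

theorem localTerm_mul_self (v : Fin M → Fin d × Fin d → ℝ)
    (U : Fin M → unitaryGroup (Fin d × Fin d) 𝕜) (l : Fin M) :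
    localTerm v U l * localTerm v U l = localTerm (fun l i => v l i * v l i) U l := by
  rw [localTerm, ← embedBond_mul, conjDiag_mul_conjDiag]; rfl

/-- The variance `∑ v²` of traceless local eigenvalues. -/
def localSq (w : Fin d × Fin d → ℝ) : ℝ := ∑ k, w k ^ 2

theorem integral_trace_localTerm_sq_mul (v : Fin M → Fin d × Fin d → ℝ) (l : Fin M)
    {P : (Fin M → unitaryGroup (Fin d × Fin d) 𝕜) →
      Matrix (Fin (M + 1) → Fin d) (Fin (M + 1) → Fin d) 𝕜}
    (hP : IndepOfBond l P) (hc : Continuous P) :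
    ∫ U, trace (localTerm v U l * localTerm v U l * P U) ∂eigenvectorLaw d M 𝕜
      = ((localSq (v l) / (d : ℝ) ^ 2 : ℝ) : 𝕜) * ∫ U, trace (P U) ∂eigenvectorLaw d M 𝕜 := by
  simp only [localTerm_mul_self, localSq, sq (v _ _)]
  exact integral_trace_localTerm_mul _ l hP hc

/-- Distinct bonds in the same layer give mean zero, because either term can be averaged alone; on
equal bonds the square is again a local term, with squared eigenvalues. -/
theorem integral_trace_layerSum_sq_mul (v : Fin M → Fin d × Fin d → ℝ)
    (hv : ∀ l, ∑ k, v l k = 0)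
    (s : Finset (Fin M)) {P : (Fin M → unitaryGroup (Fin d × Fin d) 𝕜) →
      Matrix (Fin (M + 1) → Fin d) (Fin (M + 1) → Fin d) 𝕜}
    (hP : ∀ l ∈ s, IndepOfBond l P) (hc : Continuous P) :
    ∫ U, trace (layerSum v s U * layerSum v s U * P U) ∂eigenvectorLaw d M 𝕜 =
      (((∑ l ∈ s, localSq (v l)) / (d : ℝ) ^ 2 : ℝ) : 𝕜) *
        ∫ U, trace (P U) ∂eigenvectorLaw d M 𝕜 := by
  have hterm := fun l => continuous_localTerm (𝕜 := 𝕜) v l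
  simp only [layerSum, Finset.sum_mul, Finset.mul_sum, trace_sum]
  rw [integral_finsetSum _ fun l _ => integrable_finsetSum _ fun m _ =>
    integrable_trace (((hterm m).matrix_mul (hterm l)).matrix_mul hc)]
  rw [Finset.sum_div, RCLike.ofReal_sum, Finset.sum_mul]
  refine Finset.sum_congr rfl fun l hl => ?_
  rw [integral_finsetSum _ fun m _ =>
    integrable_trace (((hterm m).matrix_mul (hterm l)).matrix_mul hc),
    Finset.sum_eq_single_of_mem l hl]
  · exact integral_trace_localTerm_sq_mul v l (hP l hl) hc
  · intro m hm hml
    have := integral_trace_localTerm_mul v m (P := fun U => localTerm v U l * P U)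
      ((indepOfBond_localTerm v hml.symm).mul (hP m hm)) ((hterm l).matrix_mul hc)
    rw [hv] at this
    simpa [Matrix.mul_assoc] using this

end LocalAverages

/-! ### The alternating trace of two adjacent local terms -/

section Alternating

variable {d M : ℕ} {𝕜 : Type*} [RCLike 𝕜]

/-- The factor `κ` of the alternating product of two adjacent traceless local terms. -/
def adjacentFactor (d : ℕ) (β : ℝ) : ℝ :=
  -- The bracket collects the nine contractions of the three-term second-moment formula for each
  -- bond, with ε = 2/β - 1 and η = 2/(βd²). The denominator comes from the two factors
  -- `fluctuation` in dimension d². The leading d compares d^(M-2) with the commuting value's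
  -- d^(M+1)/d⁴.
  d * (d ^ 5 + 2 * (2 / β - 1) * d ^ 4 - 2 * (2 / (β * d ^ 2)) * d ^ 5 + (2 / β - 1) ^ 2 * d ^ 4
    - 2 * (2 / β - 1) * (2 / (β * d ^ 2)) * d ^ 3 + (2 / (β * d ^ 2)) ^ 2 * d ^ 3) /
    (((d : ℝ) ^ 2 - 1) * (d ^ 2 + 2 / β)) ^ 2

/-- Only the shared site carries all four letters. The two outer sites see two letters each, and
each of the remaining M - 2 sites contributes the trace d of an identity. -/
theorem trace_adjacent_kronecker {l m : Fin M} (hlm : (m : ℕ) = l + 1)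
    (P₁ R₁ P₂ R₂ P₃ R₃ P₄ R₄ : Matrix (Fin d) (Fin d) 𝕜) :
    trace (embedBond l (kroneckerMap (· * ·) P₁ R₁) * embedBond m (kroneckerMap (· * ·) P₂ R₂) *
      embedBond l (kroneckerMap (· * ·) P₃ R₃) * embedBond m (kroneckerMap (· * ·) P₄ R₄)) =
    (d : 𝕜) ^ (M - 2) *
      (trace (P₁ * P₃) * trace (R₁ * P₂ * R₃ * P₄) * trace (R₂ * R₄)) := by
  have h1 : l.succ ≠ l.castSucc := (Fin.castSucc_lt_succ).ne'
  have h2 : m.castSucc = l.succ := by ext; simp [hlm]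
  have h3 : m.succ ≠ l.castSucc := by
    simp only [ne_eq, Fin.ext_iff, Fin.val_succ, Fin.val_castSucc]; omega
  have h4 : m.succ ≠ l.succ := by simp [Fin.ext_iff, hlm]
  simp only [embedBond_kronecker, pureTensor_mul, trace_pureTensor]
  have hf : ∀ s, trace ((bondFactors l P₁ R₁ * bondFactors m P₂ R₂ * bondFactors l P₃ R₃ *
      bondFactors m P₄ R₄) s) = if s = l.castSucc then trace (P₁ * P₃) else if s = l.succ then
        trace (R₁ * P₂ * R₃ * P₄) else if s = m.succ then trace (R₂ * R₄) else (d : 𝕜) := by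
    intro s
    simp only [bondFactors, Pi.mul_apply, h2]
    by_cases c1 : s = l.castSucc
    · subst c1; simp [h1.symm, h3.symm]
    · by_cases c2 : s = l.succ
      · subst c2; simp [h1]
      · by_cases c3 : s = m.succ
        · subst c3; simp [h3, h4]
        · simp [c1, c2, c3]
  simp only [hf]
  rw [Finset.prod_eq_mul_prod_sdiff_singleton_of_mem (Finset.mem_univ l.castSucc),
    Finset.prod_eq_mul_prod_sdiff_singleton_of_mem (i := l.succ) (by simp [h1]),
    Finset.prod_eq_mul_prod_sdiff_singleton_of_mem (i := m.succ) (by simp [h3, h4]),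
    Finset.prod_congr rfl (g := fun _ => (d : 𝕜))]
  · simp only [if_true, h1, h3, h4, if_false, Finset.prod_const]
    have : (((Finset.univ \ {l.castSucc}) \ {l.succ}) \ {m.succ}).card = M - 2 := by
      rw [Finset.card_sdiff_of_subset (by simp [h3, h4]), Finset.card_sdiff_of_subset (by simp [h1]),
        Finset.card_sdiff_of_subset (by simp)]
      simp only [Finset.card_univ, Fintype.card_fin, Finset.card_singleton]
      omega
    rw [this]; ring
  · intro s hs
    simp only [Finset.mem_sdiff, Finset.mem_univ, Finset.mem_singleton, true_and] at hs
    simp [hs.1.1, hs.1.2, hs.2]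

theorem trace_adjacent_single {l m : Fin M} (hlm : (m : ℕ) = l + 1)
    (i j i' j' k q k' q' : Fin d × Fin d) :
    trace (embedBond l (single i j (1 : 𝕜)) * embedBond m (single k q 1) *
      embedBond l (single i' j' 1) * embedBond m (single k' q' 1)) =
    (d : 𝕜) ^ (M - 2) * ((if j.1 = i'.1 ∧ j'.1 = i.1 then 1 else 0) *
      (if j.2 = k.1 ∧ q.1 = i'.2 ∧ j'.2 = k'.1 ∧ q'.1 = i.2 then 1 else 0) *
      (if q.2 = k'.2 ∧ q'.2 = k.2 then 1 else 0)) := by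
  have hs : ∀ i j : Fin d × Fin d, single i j (1 : 𝕜) =
      kroneckerMap (· * ·) (single i.1 j.1 1) (single i.2 j.2 1) := fun i j => by
    rw [single_kronecker_single, mul_one]
  have h2 : ∀ a b c e : Fin d, trace (single a b (1 : 𝕜) * single c e 1) =
      if b = c ∧ e = a then 1 else 0 := fun a b c e => by
    by_cases h : b = c
    · subst h
      rw [single_mul_single_same]
      by_cases h' : e = a
      · subst h'; simp
      · simp [h', trace_single_eq_of_ne _ _ _ (Ne.symm h')]
    · simp [h, single_mul_single_of_ne]
  have hm : ∀ a b c e : Fin d, single a b (1 : 𝕜) * single c e 1 =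
      if b = c then single a e 1 else 0 := fun a b c e => by
    split_ifs with h
    · subst h; rw [single_mul_single_same, mul_one]
    · rw [single_mul_single_of_ne _ _ _ _ h]
  rw [hs i j, hs i' j', hs k q, hs k' q', trace_adjacent_kronecker hlm, h2, h2, hm]
  congr 3
  by_cases h : j.2 = k.1
  · rw [if_pos h, hm]
    by_cases h' : q.1 = i'.2
    · rw [if_pos h', h2]; simp [h, h']
    · simp [h, h']
  · simp [h]

/-- The bilinear functional `(G, G') ↦ Tr (X G Y G')` for adjacent bonds. -/
def adjacentForm (l m : Fin M) (X Y : Matrix (Fin d × Fin d) (Fin d × Fin d) 𝕜) :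
    Matrix (Fin d × Fin d) (Fin d × Fin d) 𝕜 →ₗ[𝕜]
      Matrix (Fin d × Fin d) (Fin d × Fin d) 𝕜 →ₗ[𝕜] 𝕜 :=
  LinearMap.mk₂ 𝕜
    (fun G G' => trace (embedBond l X * embedBond m G * embedBond l Y * embedBond m G'))
    (fun _ _ _ => by simp only [embedBond_add, Matrix.mul_add, Matrix.add_mul, trace_add])
    (fun _ _ _ => by simp only [embedBond_smul, Matrix.mul_smul, Matrix.smul_mul, trace_smul])
    (fun _ _ _ => by simp only [embedBond_add, Matrix.mul_add, trace_add])
    (fun _ _ _ => by simp only [embedBond_smul, Matrix.mul_smul, trace_smul])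

theorem adjacentForm_apply (l m : Fin M) (X Y G G' : Matrix (Fin d × Fin d) (Fin d × Fin d) 𝕜) :
    adjacentForm l m X Y G G' =
      trace (embedBond l X * embedBond m G * embedBond l Y * embedBond m G') := rfl

theorem sum_single_mul_single_swap :
    ∑ i : Fin d × Fin d, ∑ j : Fin d × Fin d, single i j (1 : 𝕜) * single j i 1
      = ((d : 𝕜) ^ 2) • 1 := by
  simp only [single_mul_single_same, mul_one, Finset.sum_const, Finset.card_univ,
    Fintype.card_prod, Fintype.card_fin, ← Finset.smul_sum, sum_single_one]
  rw [← Nat.cast_smul_eq_nsmul 𝕜, sq]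
  push_cast; rfl

theorem sum_single_mul_single_self :
    ∑ i : Fin d × Fin d, ∑ j : Fin d × Fin d, single i j (1 : 𝕜) * single i j 1 = 1 := by
  rw [← sum_single_one]
  refine Finset.sum_congr rfl fun i _ => ?_
  rw [Finset.sum_eq_single i]
  · simp
  · intro j _ h; exact single_mul_single_of_ne _ _ _ _ h _
  · simp

/-- Here and in the next three lemmas the exponent counts the free one-site indices left by the
delta constraints of `trace_adjacent_single`: five when both pairs are swapped, four in the other
cases. -/
theorem sum_trace_adjacent_swap_swap {l m : Fin M} (hlm : (m : ℕ) = l + 1) :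
    ∑ i : Fin d × Fin d, ∑ j, ∑ k, ∑ q, adjacentForm l m (single i j (1 : 𝕜)) (single j i 1) (single k q 1)
      (single q k 1) = (d : 𝕜) ^ (M - 2) * d ^ 5 := by
  simp only [adjacentForm_apply, trace_adjacent_single hlm, ← Finset.mul_sum,
    Fintype.sum_prod_type]
  congr 1
  simp [ite_and]
  ring

theorem sum_trace_adjacent_swap_self {l m : Fin M} (hlm : (m : ℕ) = l + 1) :
    ∑ i : Fin d × Fin d, ∑ j, ∑ k, ∑ q, adjacentForm l m (single i j (1 : 𝕜)) (single j i 1) (single k q 1)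
      (single k q 1) = (d : 𝕜) ^ (M - 2) * d ^ 4 := by
  simp only [adjacentForm_apply, trace_adjacent_single hlm, ← Finset.mul_sum,
    Fintype.sum_prod_type]
  congr 1
  simp [ite_and]
  ring

theorem sum_trace_adjacent_self_swap {l m : Fin M} (hlm : (m : ℕ) = l + 1) :
    ∑ i : Fin d × Fin d, ∑ j, ∑ k, ∑ q, adjacentForm l m (single i j (1 : 𝕜)) (single i j 1) (single k q 1)
      (single q k 1) = (d : 𝕜) ^ (M - 2) * d ^ 4 := by
  simp only [adjacentForm_apply, trace_adjacent_single hlm, ← Finset.mul_sum,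
    Fintype.sum_prod_type]
  congr 1
  simp [ite_and]
  ring

theorem sum_trace_adjacent_self_self {l m : Fin M} (hlm : (m : ℕ) = l + 1) :
    ∑ i : Fin d × Fin d, ∑ j, ∑ k, ∑ q, adjacentForm l m (single i j (1 : 𝕜)) (single i j 1) (single k q 1)
      (single k q 1) = (d : 𝕜) ^ (M - 2) * d ^ 4 := by
  simp only [adjacentForm_apply, trace_adjacent_single hlm, ← Finset.mul_sum,
    Fintype.sum_prod_type]
  congr 1
  simp [ite_and]
  ring

/-- The contraction of `adjacentForm` with the second moments of the first local term. -/
def adjacentContraction (l m : Fin M) (ε η : 𝕜) :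
    Matrix (Fin d × Fin d) (Fin d × Fin d) 𝕜 →ₗ[𝕜]
      Matrix (Fin d × Fin d) (Fin d × Fin d) 𝕜 →ₗ[𝕜] 𝕜 :=
  ∑ i, ∑ j, adjacentForm l m (single i j 1) (single j i 1)
    + ε • ∑ i, ∑ j, adjacentForm l m (single i j 1) (single i j 1) - η • adjacentForm l m 1 1

theorem adjacentContraction_apply (l m : Fin M) (ε η : 𝕜)
    (G G' : Matrix (Fin d × Fin d) (Fin d × Fin d) 𝕜) :
    adjacentContraction l m ε η G G' =
      ∑ i, ∑ j, adjacentForm l m (single i j 1) (single j i 1) G G'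
      + ε * ∑ i, ∑ j, adjacentForm l m (single i j 1) (single i j 1) G G'
      - η * adjacentForm l m 1 1 G G' := by
  simp only [adjacentContraction, LinearMap.sub_apply, LinearMap.add_apply, LinearMap.smul_apply,
      LinearMap.sum_apply, smul_eq_mul]

theorem continuous_adjacentContraction (l m : Fin M) (ε η : 𝕜)
    (v : Fin M → Fin d × Fin d → ℝ) :
    Continuous fun U : Fin M → unitaryGroup (Fin d × Fin d) 𝕜 =>
      adjacentContraction l m ε η (conjDiag (v m) (U m).1) (conjDiag (v m) (U m).1) := by
  simp only [adjacentContraction_apply, adjacentForm_apply]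
  have hm := continuous_localTerm (𝕜 := 𝕜) v m
  have hc : ∀ X Y, Continuous fun U : Fin M → unitaryGroup (Fin d × Fin d) 𝕜 =>
      trace (embedBond l X * localTerm v U m * embedBond l Y * localTerm v U m) := fun X Y =>
    (((continuous_const.matrix_mul hm).matrix_mul continuous_const).matrix_mul hm).matrix_trace
  exact ((continuous_finsetSum _ fun i _ => continuous_finsetSum _ fun j _ => hc _ _).add
    (continuous_const.mul (continuous_finsetSum _ fun i _ => continuous_finsetSum _ fun j _ =>
      hc _ _))).sub (continuous_const.mul (hc _ _))

theorem sum_comm_pairs {ι E : Type*} [Fintype ι] [AddCommMonoid E] (F : ι → ι → ι → ι → E) :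
    ∑ k, ∑ q, ∑ i, ∑ j, F i j k q = ∑ i, ∑ j, ∑ k, ∑ q, F i j k q := by
  calc ∑ k, ∑ q, ∑ i, ∑ j, F i j k q = ∑ k, ∑ i, ∑ q, ∑ j, F i j k q :=
        Finset.sum_congr rfl fun k _ => Finset.sum_comm
    _ = ∑ i, ∑ k, ∑ j, ∑ q, F i j k q := by
        rw [Finset.sum_comm]
        exact Finset.sum_congr rfl fun i _ => Finset.sum_congr rfl fun k _ => Finset.sum_comm
    _ = _ := Finset.sum_congr rfl fun i _ => Finset.sum_comm

theorem sum_adjacentForm_left (l m : Fin M)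
    (F : Fin d × Fin d → Fin d × Fin d → Matrix (Fin d × Fin d) (Fin d × Fin d) 𝕜) :
    ∑ i, ∑ j, adjacentForm l m (single i j (1 : 𝕜)) (F i j) 1 1 =
      trace (embedBond l (∑ i, ∑ j, single i j (1 : 𝕜) * F i j)) := by
  simp only [adjacentForm_apply, embedBond_one, Matrix.mul_one, ← embedBond_mul]
  simp only [← embedBondₗ_apply, map_sum, trace_sum]

theorem sum_adjacentForm_right (l m : Fin M)
    (F : Fin d × Fin d → Fin d × Fin d → Matrix (Fin d × Fin d) (Fin d × Fin d) 𝕜) :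
    ∑ i, ∑ j, adjacentForm l m 1 1 (single i j (1 : 𝕜)) (F i j) =
      trace (embedBond m (∑ i, ∑ j, single i j (1 : 𝕜) * F i j)) := by
  simp only [adjacentForm_apply, embedBond_one, Matrix.mul_one, Matrix.one_mul, ← embedBond_mul]
  simp only [← embedBondₗ_apply, map_sum, trace_sum]

/-- Expanding both second-moment tensors gives nine terms. Four are the index counts above; in the
five with η one pair of slots, or both, holds the identity, and the trace collapses to that of ∑
E_ij E_ji = d² or ∑ E_ij E_ij = 1, or of the identity. -/
theorem contract_adjacentContraction {l m : Fin M} (hlm : (m : ℕ) = l + 1) (ε η : 𝕜) :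
    ∑ k : Fin d × Fin d, ∑ q, adjacentContraction l m ε η (single k q 1) (single q k 1)
      + ε * ∑ k : Fin d × Fin d, ∑ q, adjacentContraction l m ε η (single k q 1) (single k q 1)
      - η * adjacentContraction (d := d) l m ε η 1 1 =
    (d : 𝕜) ^ (M - 2) * (d ^ 5 + 2 * ε * d ^ 4 - 2 * η * d ^ 5 + ε ^ 2 * d ^ 4
      - 2 * ε * η * d ^ 3 + η ^ 2 * d ^ 3) := by
  -- Two adjacent bonds force M ≥ 2, so the natural subtraction is exact.
  have hM : M + 1 = (M - 2) + 3 := by have := m.2; omega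
  have tr1 : trace (1 : Matrix (Fin (M + 1) → Fin d) (Fin (M + 1) → Fin d) 𝕜)
      = (d : 𝕜) ^ (M - 2) * d ^ 3 := by
    rw [trace_one, ← pow_add, ← hM]; simp
  have h11 : adjacentForm (𝕜 := 𝕜) (d := d) l m 1 1 1 1 = (d : 𝕜) ^ (M - 2) * d ^ 3 := by
    simp only [adjacentForm_apply, embedBond_one, Matrix.mul_one, tr1]
  have e1 : ∀ k : Fin M, trace (embedBond k (((d : 𝕜) ^ 2) •
      (1 : Matrix (Fin d × Fin d) (Fin d × Fin d) 𝕜))) = (d : 𝕜) ^ (M - 2) * d ^ 5 := fun k => by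
    rw [embedBond_smul, embedBond_one, trace_smul, tr1, smul_eq_mul]; ring
  have e2 : ∀ k : Fin M, trace (embedBond k
      (1 : Matrix (Fin d × Fin d) (Fin d × Fin d) 𝕜)) = (d : 𝕜) ^ (M - 2) * d ^ 3 := fun k => by
    rw [embedBond_one, tr1]
  have hss : ∑ k : Fin d × Fin d, ∑ q, ∑ i, ∑ j, adjacentForm l m (single i j (1 : 𝕜))
      (single j i 1) (single k q 1) (single q k 1) = (d : 𝕜) ^ (M - 2) * d ^ 5 :=
    (sum_comm_pairs fun i j k q => adjacentForm l m (single i j (1 : 𝕜)) (single j i 1)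
      (single k q 1) (single q k 1)).trans (sum_trace_adjacent_swap_swap hlm)
  have hsp : ∑ k : Fin d × Fin d, ∑ q, ∑ i, ∑ j, adjacentForm l m (single i j (1 : 𝕜))
      (single j i 1) (single k q 1) (single k q 1) = (d : 𝕜) ^ (M - 2) * d ^ 4 :=
    (sum_comm_pairs fun i j k q => adjacentForm l m (single i j (1 : 𝕜)) (single j i 1)
      (single k q 1) (single k q 1)).trans (sum_trace_adjacent_swap_self hlm)
  have hps : ∑ k : Fin d × Fin d, ∑ q, ∑ i, ∑ j, adjacentForm l m (single i j (1 : 𝕜))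
      (single i j 1) (single k q 1) (single q k 1) = (d : 𝕜) ^ (M - 2) * d ^ 4 :=
    (sum_comm_pairs fun i j k q => adjacentForm l m (single i j (1 : 𝕜)) (single i j 1)
      (single k q 1) (single q k 1)).trans (sum_trace_adjacent_self_swap hlm)
  have hpp : ∑ k : Fin d × Fin d, ∑ q, ∑ i, ∑ j, adjacentForm l m (single i j (1 : 𝕜))
      (single i j 1) (single k q 1) (single k q 1) = (d : 𝕜) ^ (M - 2) * d ^ 4 :=
    (sum_comm_pairs fun i j k q => adjacentForm l m (single i j (1 : 𝕜)) (single i j 1)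
      (single k q 1) (single k q 1)).trans (sum_trace_adjacent_self_self hlm)
  simp only [adjacentContraction_apply, Finset.sum_add_distrib, Finset.sum_sub_distrib,
    ← Finset.mul_sum]
  simp only [hss, hsp, hps, hpp, sum_adjacentForm_left, sum_adjacentForm_right, h11, sum_single_mul_single_swap,
    sum_single_mul_single_self, e1, e2]
  ring

/-- Normalises the contraction by d^(M+1)/d⁴ times the two square sums, which is the value a
commuting pair would give. -/
theorem adjacentFactor_mul (hd : 2 ≤ d) (hM : 2 ≤ M) (v w : Fin d × Fin d → ℝ) :
    fluctuation (Fin d × Fin d) 𝕜 v * (fluctuation (Fin d × Fin d) 𝕜 w *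
      ((d : ℝ) ^ (M - 2) * (d ^ 5 + 2 * (2 / dysonIndex 𝕜 - 1) * d ^ 4
      - 2 * (2 / (dysonIndex 𝕜 * d ^ 2)) * d ^ 5 + (2 / dysonIndex 𝕜 - 1) ^ 2 * d ^ 4
      - 2 * (2 / dysonIndex 𝕜 - 1) * (2 / (dysonIndex 𝕜 * d ^ 2)) * d ^ 3
      + (2 / (dysonIndex 𝕜 * d ^ 2)) ^ 2 * d ^ 3))) =
    adjacentFactor d (dysonIndex 𝕜) * ((d : ℝ) ^ (M + 1) / d ^ 4) * (localSq v * localSq w) := by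
  have hM : M + 1 = (M - 2) + 3 := by omega
  have hd0 : (d : ℝ) ≠ 0 := by positivity
  have hd2 : (2 : ℝ) ≤ d := by exact_mod_cast hd
  have hβ := dysonIndex_pos 𝕜
  have hX : ((d : ℝ) ^ 2 - 1) * (d ^ 2 + 2 / dysonIndex 𝕜) ≠ 0 := by
    have : 0 < ((d : ℝ) ^ 2 - 1) * (d ^ 2 + 2 / dysonIndex 𝕜) :=
      mul_pos (by nlinarith) (by positivity)
    exact this.ne'
  have hpow : (d : ℝ) ^ (M + 1) = d ^ (M - 2) * d ^ 3 := by rw [hM, pow_add]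
  simp only [fluctuation, adjacentFactor, Fintype.card_prod, Fintype.card_fin, Nat.cast_mul,
    localSq, hpow]
  simp only [← sq (d : ℝ)]
  generalize (d : ℝ) ^ 5 + 2 * (2 / dysonIndex 𝕜 - 1) * d ^ 4
    - 2 * (2 / (dysonIndex 𝕜 * d ^ 2)) * d ^ 5 + (2 / dysonIndex 𝕜 - 1) ^ 2 * d ^ 4
    - 2 * (2 / dysonIndex 𝕜 - 1) * (2 / (dysonIndex 𝕜 * d ^ 2)) * d ^ 3
    + (2 / (dysonIndex 𝕜 * d ^ 2)) ^ 2 * d ^ 3 = E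
  generalize ((d : ℝ) ^ 2 - 1) * (d ^ 2 + 2 / dysonIndex 𝕜) = X at hX
  field_simp

/-- The bilinear functional `(X, Y) ↦ Tr (X G Y G)` with the second of two adjacent terms fixed. -/
def adjacentFirstForm (v : Fin M → Fin d × Fin d → ℝ) (l m : Fin M)
    (U : Fin M → unitaryGroup (Fin d × Fin d) 𝕜) :
    Matrix (Fin d × Fin d) (Fin d × Fin d) 𝕜 →ₗ[𝕜]
      Matrix (Fin d × Fin d) (Fin d × Fin d) 𝕜 →ₗ[𝕜] 𝕜 := LinearMap.mk₂ 𝕜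
    (fun X Y => trace (embedBond l X * localTerm v U m * embedBond l Y * localTerm v U m))
    (fun _ _ _ => by simp only [embedBond_add, Matrix.add_mul, trace_add])
    (fun _ _ _ => by simp only [embedBond_smul, Matrix.smul_mul, trace_smul])
    (fun _ _ _ => by simp only [embedBond_add, Matrix.mul_add, Matrix.add_mul, trace_add])
    (fun _ _ _ => by simp only [embedBond_smul, Matrix.mul_smul, Matrix.smul_mul, trace_smul])

theorem adjacentFirstForm_apply (v : Fin M → Fin d × Fin d → ℝ) (l m : Fin M)
    (U : Fin M → unitaryGroup (Fin d × Fin d) 𝕜)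
    (X Y : Matrix (Fin d × Fin d) (Fin d × Fin d) 𝕜) :
    adjacentFirstForm v l m U X Y =
      adjacentForm l m X Y (conjDiag (v m) (U m).1) (conjDiag (v m) (U m).1) := rfl

/-- The expected alternating trace of adjacent traceless local terms. -/
theorem integral_trace_adjacent (hd : 2 ≤ d) (v : Fin M → Fin d × Fin d → ℝ)
    (hv : ∀ l, ∑ k, v l k = 0) {l m : Fin M} (hlm : (m : ℕ) = l + 1) :
    ∫ U, trace (localTerm v U l * localTerm v U m * localTerm v U l * localTerm v U m)
      ∂eigenvectorLaw d M 𝕜 = ((adjacentFactor d (dysonIndex 𝕜) * ((d : ℝ) ^ (M + 1) / d ^ 4) *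
        (localSq (v l) * localSq (v m)) : ℝ) : 𝕜) := by
  have hml : m ≠ l := by rw [ne_eq, Fin.ext_iff]; omega
  have ht := fun k => continuous_localTerm (𝕜 := 𝕜) v k
  -- Bond l is integrated first, with bond m frozen; the result is again bilinear in the local term
  -- on m, which is integrated next.
  have h1 := integral_bilinear_local (v l) (hv l) hd l (adjacentFirstForm (𝕜 := 𝕜) v l m)
    (fun U W => by simp only [adjacentFirstForm, indepOfBond_localTerm v hml U W])
    (((((ht l).matrix_mul (ht m)).matrix_mul (ht l)).matrix_mul (ht m)).matrix_trace)
  refine Eq.trans h1 ?_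
  simp only [adjacentFirstForm_apply, ← adjacentContraction_apply]
  rw [integral_bilinear_local (v m) (hv m) hd m (fun _ => adjacentContraction l m _ _)
    (fun U W => rfl) (continuous_adjacentContraction l m _ _ v),
    contract_adjacentContraction hlm, integral_const, probReal_univ, one_smul,
    ← adjacentFactor_mul hd (by have := m.2; omega)]
  simp only [Fintype.card_prod, Fintype.card_fin, Nat.cast_mul]
  simp only [← sq (d : ℝ)]
  push_cast
  rfl

end Alternating

/-! ### Moments of a sum of two matrices -/

section SumMoments

variable {n : Type*} [Fintype n] [DecidableEq n] {𝕜 : Type*} [RCLike 𝕜]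

theorem trace_add_pow_two (Y Z : Matrix n n 𝕜) :
    trace ((Y + Z) ^ 2) = trace (Y ^ 2) + 2 * trace (Y * Z) + trace (Z ^ 2) := by
  have e : (Y + Z) ^ 2 = Y ^ 2 + Y * Z + Z * Y + Z ^ 2 := by noncomm_ring
  rw [e]
  simp only [trace_add]
  rw [trace_mul_comm Z Y]
  ring

theorem trace_add_pow_three (Y Z : Matrix n n 𝕜) :
    trace ((Y + Z) ^ 3) = trace (Y ^ 3) + 3 * trace (Y ^ 2 * Z) + 3 * trace (Y * Z ^ 2)
      + trace (Z ^ 3) := by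
  have e : (Y + Z) ^ 3 = Y ^ 3 + Y ^ 2 * Z + Y * (Z * Y) + Z * Y ^ 2 + Y * Z ^ 2 + Z * (Y * Z)
      + Z ^ 2 * Y + Z ^ 3 := by noncomm_ring
  rw [e]
  simp only [trace_add]
  rw [trace_mul_comm Z (Y ^ 2), trace_mul_comm (Z ^ 2) Y, trace_mul_comm Y (Z * Y),
    trace_mul_comm Z (Y * Z), Matrix.mul_assoc Z, Matrix.mul_assoc Y, ← sq, ← sq,
    trace_mul_comm Z (Y ^ 2)]
  ring

/-- The sixteen words fall into cyclic classes of sizes 1, 4, 4, 2, 4, 1. The class of size 2, that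
of YZYZ, is the only one without a representative Y^a Z^b. -/
theorem trace_add_pow_four (Y Z : Matrix n n 𝕜) :
    trace ((Y + Z) ^ 4) = trace (Y ^ 4) + 4 * trace (Y ^ 3 * Z) + 4 * trace (Y ^ 2 * Z ^ 2)
      + 2 * trace (Y * Z * Y * Z) + 4 * trace (Y * Z ^ 3) + trace (Z ^ 4) := by
  have e : (Y + Z) ^ 4 = Y ^ 4 + (Y ^ 3 * Z + Y ^ 2 * (Z * Y) + Y * (Z * Y ^ 2) + Z * Y ^ 3)
      + (Y ^ 2 * Z ^ 2 + Y * (Z ^ 2 * Y) + Z ^ 2 * Y ^ 2 + (Z * Y ^ 2) * Z)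
      + (Y * Z * Y * Z + Z * (Y * Z * Y))
      + (Y * Z ^ 3 + Z * (Y * Z ^ 2) + Z ^ 2 * (Y * Z) + Z ^ 3 * Y) + Z ^ 4 := by noncomm_ring
  have h1 : trace (Y ^ 2 * (Z * Y)) = trace (Y ^ 3 * Z) := by
    rw [← Matrix.mul_assoc, trace_mul_comm, ← Matrix.mul_assoc, ← pow_succ']
  have h2 : trace (Y * (Z * Y ^ 2)) = trace (Y ^ 3 * Z) := by
    rw [← Matrix.mul_assoc, trace_mul_comm, ← Matrix.mul_assoc, ← pow_succ]
  have h3 : trace (Z * Y ^ 3) = trace (Y ^ 3 * Z) := trace_mul_comm _ _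
  have h4 : trace (Y * (Z ^ 2 * Y)) = trace (Y ^ 2 * Z ^ 2) := by
    rw [← Matrix.mul_assoc, trace_mul_comm, ← Matrix.mul_assoc, ← sq]
  have h5 : trace (Z ^ 2 * Y ^ 2) = trace (Y ^ 2 * Z ^ 2) := trace_mul_comm _ _
  have h6 : trace ((Z * Y ^ 2) * Z) = trace (Y ^ 2 * Z ^ 2) := by
    rw [trace_mul_comm, ← Matrix.mul_assoc, ← sq, trace_mul_comm]
  have h7 : trace (Z * (Y * Z * Y)) = trace (Y * Z * Y * Z) := trace_mul_comm _ _
  have h8 : trace (Z * (Y * Z ^ 2)) = trace (Y * Z ^ 3) := by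
    rw [trace_mul_comm, Matrix.mul_assoc, ← pow_succ]
  have h9 : trace (Z ^ 2 * (Y * Z)) = trace (Y * Z ^ 3) := by
    rw [trace_mul_comm, Matrix.mul_assoc, ← pow_succ']
  have h10 : trace (Z ^ 3 * Y) = trace (Y * Z ^ 3) := trace_mul_comm _ _
  rw [e]
  simp only [trace_add, h1, h2, h3, h4, h5, h6, h7, h8, h9, h10]
  ring

theorem trace_scalar_add_pow (c : 𝕜) (S : Matrix n n 𝕜) (r : ℕ) :
    trace ((c • 1 + S) ^ r) = ∑ j ∈ Finset.range (r + 1),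
      c ^ j * (r.choose j : 𝕜) * trace (S ^ (r - j)) := by
  have hc : Commute (c • (1 : Matrix n n 𝕜)) S := (Commute.one_left S).smul_left c
  rw [hc.add_pow, trace_sum]
  refine Finset.sum_congr rfl fun j _ => ?_
  rw [smul_pow, one_pow, smul_mul_assoc, smul_mul_assoc, trace_smul, Matrix.one_mul,
    ← nsmul_eq_mul', trace_smul, nsmul_eq_mul, smul_eq_mul]
  ring

/-- The mixed moments of a pair of random matrices in which all words of length at most four,
other than `YZYZ`, factorize. -/
structure FactorizingPair {Ω : Type*} [MeasurableSpace Ω] (μ : Measure Ω) (Y Z : Ω → Matrix n n 𝕜)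
    (α δ : ℕ → ℝ) (θ : ℝ) : Prop where
  integrable : ∀ F : Matrix n n 𝕜 × Matrix n n 𝕜 → 𝕜, Continuous F →
    Integrable (fun ω => F (Y ω, Z ω)) μ
  left : ∀ j ω, trace (Y ω ^ j) = (α j : 𝕜)
  right : ∀ j ω, trace (Z ω ^ j) = (δ j : 𝕜)
  left_one : α 1 = 0
  right_one : δ 1 = 0
  one_one : ∫ ω, trace (Y ω * Z ω) ∂μ = 0
  two_one : ∫ ω, trace (Y ω ^ 2 * Z ω) ∂μ = 0
  one_two : ∫ ω, trace (Y ω * Z ω ^ 2) ∂μ = 0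
  three_one : ∫ ω, trace (Y ω ^ 3 * Z ω) ∂μ = 0
  one_three : ∫ ω, trace (Y ω * Z ω ^ 3) ∂μ = 0
  two_two : ∫ ω, trace (Y ω ^ 2 * Z ω ^ 2) ∂μ = ((α 2 * δ 2 / Fintype.card n : ℝ) : 𝕜)
  alternating : ∫ ω, trace (Y ω * Z ω * Y ω * Z ω) ∂μ = (θ : 𝕜)

/-- The moments of `c + Y + Z` for a factorizing pair. -/
def sumMoment (N c : ℝ) (α δ : ℕ → ℝ) (θ : ℝ) : ℕ → ℝ
  | 1 => c
  | 2 => c ^ 2 + N⁻¹ * (α 2 + δ 2)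
  | 3 => c ^ 3 + 3 * c * (N⁻¹ * (α 2 + δ 2)) + N⁻¹ * (α 3 + δ 3)
  -- The only moment in which θ appears.
  | 4 => c ^ 4 + 6 * c ^ 2 * (N⁻¹ * (α 2 + δ 2)) + 4 * c * (N⁻¹ * (α 3 + δ 3)) +
      N⁻¹ * (α 4 + δ 4 + 4 * (α 2 * δ 2 / N)) + 2 * N⁻¹ * θ
  | _ => 0

/-- `f` is integrable with integral `v`. -/
def HasMean {Ω : Type*} [MeasurableSpace Ω] (μ : Measure Ω) (f : Ω → 𝕜) (v : 𝕜) : Prop :=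
  Integrable f μ ∧ ∫ ω, f ω ∂μ = v

theorem HasMean.add {Ω : Type*} [MeasurableSpace Ω] {μ : Measure Ω} {f g : Ω → 𝕜} {v w : 𝕜}
    (hf : HasMean μ f v) (hg : HasMean μ g w) : HasMean μ (fun ω => f ω + g ω) (v + w) :=
  ⟨hf.1.add hg.1, by rw [integral_add hf.1 hg.1, hf.2, hg.2]⟩

theorem HasMean.const_mul {Ω : Type*} [MeasurableSpace Ω] {μ : Measure Ω} {f : Ω → 𝕜} {v : 𝕜}
    (hf : HasMean μ f v) (c : 𝕜) : HasMean μ (fun ω => c * f ω) (c * v) :=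
  ⟨hf.1.const_mul c, by rw [integral_const_mul, hf.2]⟩

theorem hasMean_const {Ω : Type*} [MeasurableSpace Ω] {μ : Measure Ω} [IsProbabilityMeasure μ]
    {f : Ω → 𝕜} {c : 𝕜} (h : ∀ ω, f ω = c) : HasMean μ f c := by
  obtain rfl : f = fun _ => c := funext h
  exact ⟨integrable_const c, by simp⟩

theorem FactorizingPair.hasMean_pow {Ω : Type*} [MeasurableSpace Ω]
    {μ : Measure Ω} [IsProbabilityMeasure μ] {Y Z : Ω → Matrix n n 𝕜} {α δ : ℕ → ℝ} {θ : ℝ}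
    (h : FactorizingPair μ Y Z α δ θ) :
    HasMean μ (fun ω => trace ((Y ω + Z ω) ^ 2)) ((α 2 : 𝕜) + 2 * 0 + (δ 2 : 𝕜)) ∧
    HasMean μ (fun ω => trace ((Y ω + Z ω) ^ 3)) ((α 3 : 𝕜) + 3 * 0 + 3 * 0 + (δ 3 : 𝕜)) ∧
    HasMean μ (fun ω => trace ((Y ω + Z ω) ^ 4)) ((α 4 : 𝕜) + 4 * 0 +
      4 * ((α 2 * δ 2 / Fintype.card n : ℝ) : 𝕜) + 2 * (θ : 𝕜) + 4 * 0 +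
      (δ 4 : 𝕜)) := by
  have hl : ∀ j, HasMean μ (fun ω => trace (Y ω ^ j)) (α j : 𝕜) := fun j =>
    hasMean_const (h.left j)
  have hr : ∀ j, HasMean μ (fun ω => trace (Z ω ^ j)) (δ j : 𝕜) := fun j =>
    hasMean_const (h.right j)
  have h11 : HasMean μ (fun ω => trace (Y ω * Z ω)) 0 :=
    ⟨h.integrable (fun p => trace (p.1 * p.2)) (by fun_prop), h.one_one⟩
  have h21 : HasMean μ (fun ω => trace (Y ω ^ 2 * Z ω)) 0 :=
    ⟨h.integrable (fun p => trace (p.1 ^ 2 * p.2)) (by fun_prop), h.two_one⟩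
  have h12 : HasMean μ (fun ω => trace (Y ω * Z ω ^ 2)) 0 :=
    ⟨h.integrable (fun p => trace (p.1 * p.2 ^ 2)) (by fun_prop), h.one_two⟩
  have h31 : HasMean μ (fun ω => trace (Y ω ^ 3 * Z ω)) 0 :=
    ⟨h.integrable (fun p => trace (p.1 ^ 3 * p.2)) (by fun_prop), h.three_one⟩
  have h13 : HasMean μ (fun ω => trace (Y ω * Z ω ^ 3)) 0 :=
    ⟨h.integrable (fun p => trace (p.1 * p.2 ^ 3)) (by fun_prop), h.one_three⟩
  have h22 : HasMean μ (fun ω => trace (Y ω ^ 2 * Z ω ^ 2)) _ :=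
    ⟨h.integrable (fun p => trace (p.1 ^ 2 * p.2 ^ 2)) (by fun_prop), h.two_two⟩
  have hal : HasMean μ (fun ω => trace (Y ω * Z ω * Y ω * Z ω)) _ :=
    ⟨h.integrable (fun p => trace (p.1 * p.2 * p.1 * p.2)) (by fun_prop), h.alternating⟩
  simp only [trace_add_pow_two, trace_add_pow_three, trace_add_pow_four]
  exact ⟨((hl 2).add (h11.const_mul 2)).add (hr 2),
    (((hl 3).add (h21.const_mul 3)).add (h12.const_mul 3)).add (hr 3),
    (((((hl 4).add (h31.const_mul 4)).add (h22.const_mul 4)).add (hal.const_mul 2)).add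
      (h13.const_mul 4)).add (hr 4)⟩

theorem FactorizingPair.hasMean_trace_pow [Nonempty n] {Ω : Type*} [MeasurableSpace Ω]
    {μ : Measure Ω} [IsProbabilityMeasure μ] {Y Z : Ω → Matrix n n 𝕜} {α δ : ℕ → ℝ} {θ : ℝ}
    (h : FactorizingPair μ Y Z α δ θ) (c : ℝ) {r : ℕ} (hr : r ∈ ({1, 2, 3, 4} : Set ℕ)) :
    HasMean μ (fun ω => trace (((c : 𝕜) • 1 + (Y ω + Z ω)) ^ r))
      ((Fintype.card n * sumMoment (Fintype.card n) c α δ θ r : ℝ) : 𝕜) := by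
  have hN : (Fintype.card n : 𝕜) ≠ 0 := by simp
  have t0 : HasMean μ (fun ω => trace ((Y ω + Z ω) ^ 0)) (Fintype.card n : 𝕜) :=
    hasMean_const fun ω => by simp
  have t1 : HasMean μ (fun ω => trace ((Y ω + Z ω) ^ 1)) (0 : 𝕜) :=
    hasMean_const fun ω => by
      have h1 := h.left 1 ω
      have h2 := h.right 1 ω
      rw [pow_one, h.left_one] at h1
      rw [pow_one, h.right_one] at h2
      rw [pow_one, trace_add, h1, h2]; simp
  obtain ⟨t2, t3, t4⟩ := h.hasMean_pow
  have z : HasMean μ (fun _ => (0 : 𝕜)) 0 := hasMean_const fun _ => rfl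
  have conv : ∀ {f : Ω → 𝕜} {v w : 𝕜}, HasMean μ f v → v = w → HasMean μ f w :=
    fun hf e => e ▸ hf
  simp only [trace_scalar_add_pow]
  rcases hr with rfl | rfl | rfl | rfl
  · simp only [Finset.sum_range_succ, Finset.sum_range_zero]
    refine conv ((z.add (t1.const_mul _)).add (t0.const_mul _)) ?_
    simp only [sumMoment]
    push_cast
    norm_num
    ring
  · simp only [Finset.sum_range_succ, Finset.sum_range_zero]
    refine conv (((z.add (t2.const_mul _)).add (t1.const_mul _)).add (t0.const_mul _)) ?_
    simp only [sumMoment]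
    push_cast
    field_simp
    norm_num
    ring
  · simp only [Finset.sum_range_succ, Finset.sum_range_zero]
    refine conv ((((z.add (t3.const_mul _)).add (t2.const_mul _)).add (t1.const_mul _)).add
      (t0.const_mul _)) ?_
    simp only [sumMoment]
    push_cast
    field_simp
    norm_num [Nat.choose]
    ring
  · simp only [Finset.sum_range_succ, Finset.sum_range_zero]
    refine conv (((((z.add (t4.const_mul _)).add (t3.const_mul _)).add (t2.const_mul _)).add
      (t1.const_mul _)).add (t0.const_mul _)) ?_
    simp only [sumMoment]
    push_cast
    field_simp
    norm_num [Nat.choose]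
    ring

theorem conj_pow_of_unitary {W : Matrix n n 𝕜} (hW : Wᴴ * W = 1) (X : Matrix n n 𝕜) (r : ℕ) :
    (Wᴴ * X * W) ^ r = Wᴴ * X ^ r * W := by
  have hW' : W * Wᴴ = 1 := mul_eq_one_comm.mp hW
  induction r with
  | zero => simp [hW]
  | succ r ih =>
    rw [pow_succ, ih, pow_succ]
    calc Wᴴ * X ^ r * W * (Wᴴ * X * W) = Wᴴ * X ^ r * (W * Wᴴ) * X * W := by
          simp only [Matrix.mul_assoc]
      _ = _ := by rw [hW', Matrix.mul_one]; simp only [Matrix.mul_assoc]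

theorem trace_conj_pow {W : Matrix n n 𝕜} (hW : Wᴴ * W = 1) (X : Matrix n n 𝕜) (r : ℕ) :
    trace ((Wᴴ * X * W) ^ r) = trace (X ^ r) := by
  have hW' : W * Wᴴ = 1 := mul_eq_one_comm.mp hW
  rw [conj_pow_of_unitary hW, trace_mul_comm, ← Matrix.mul_assoc, hW', Matrix.one_mul]

theorem trace_diagonal_pow (a : n → ℝ) (j : ℕ) :
    trace (diagonal (fun x => (a x : 𝕜)) ^ j) = ((∑ x, a x ^ j : ℝ) : 𝕜) := by
  rw [diagonal_pow, trace_diagonal]; simp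

/-- A diagonal matrix and a randomly rotated diagonal matrix, when the rotation averages diagonal
matrices to scalars. -/
theorem factorizingPair_of_average {Ω : Type*} [MeasurableSpace Ω] {μ : Measure Ω}
    {Q : Ω → Matrix n n 𝕜} (hQ : ∀ ω, (Q ω)ᴴ * Q ω = 1)
    (hint : ∀ F : Matrix n n 𝕜 → 𝕜, Continuous F → Integrable (fun ω => F (Q ω)) μ)
    (havg : ∀ (P : Matrix n n 𝕜) (w : n → ℝ),
      ∫ ω, trace (P * conjDiag w (Q ω)) ∂μ = (((∑ x, w x) / Fintype.card n : ℝ) : 𝕜) * trace P)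
    {a b : n → ℝ} (ha : ∑ x, a x = 0) (hb : ∑ x, b x = 0) {θ : ℝ}
    (hθ : ∫ ω, trace (diagonal (fun x => (a x : 𝕜)) * conjDiag b (Q ω) *
      diagonal (fun x => (a x : 𝕜)) * conjDiag b (Q ω)) ∂μ = (θ : 𝕜)) :
    FactorizingPair μ (fun _ => diagonal fun x => (a x : 𝕜)) (fun ω => conjDiag b (Q ω))
      (fun j => ∑ x, a x ^ j) (fun j => ∑ x, b x ^ j) θ := by
  -- A power of a rotated diagonal matrix is a rotated diagonal matrix, so the first-moment
  -- hypothesis `havg` alone evaluates every word Y^a Z^b.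
  have hpow : ∀ ω j, conjDiag b (Q ω) ^ j = conjDiag (fun x => b x ^ j) (Q ω) := fun ω j => by
    rw [conjDiag, conj_pow_of_unitary (hQ ω), conjDiag, diagonal_pow]
    congr 3
    ext x; simp
  have hA1 : trace (diagonal fun x => (a x : 𝕜)) = 0 := by
    have := trace_diagonal_pow (𝕜 := 𝕜) a 1
    simp only [pow_one, ha] at this
    simpa using this
  refine ⟨fun F hF => ?_, fun j ω => trace_diagonal_pow a j, fun j ω => ?_, by simpa using ha,
    by simpa using hb, ?_, ?_, ?_, ?_, ?_, ?_, hθ⟩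
  · refine hint (fun X => F (diagonal (fun x => (a x : 𝕜)), conjDiag b X)) (hF.comp ?_)
    unfold conjDiag
    fun_prop
  · rw [conjDiag, trace_conj_pow (hQ ω), trace_diagonal_pow]
  · rw [havg, hb]; simp
  · rw [havg, hb]; simp
  · simp only [hpow, havg, hA1, mul_zero]
  · rw [havg, hb]; simp
  · simp only [hpow, havg, hA1, mul_zero]
  · simp only [hpow, havg, trace_diagonal_pow]
    push_cast
    ring

end SumMoments

/-! ### The three models of the chain -/

section Chains

variable {d M : ℕ} {𝕜 : Type*} [RCLike 𝕜]

/-- The bonds `1, 3, 5, …`. -/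
def oddBonds (M : ℕ) : Finset (Fin M) := Finset.univ.filter IsOddBond

/-- The bonds `2, 4, 6, …`. -/
def evenBonds (M : ℕ) : Finset (Fin M) := Finset.univ.filter fun l => ¬ IsOddBond l

theorem mem_oddBonds {l : Fin M} : l ∈ oddBonds M ↔ IsOddBond l := by simp [oddBonds]

theorem mem_evenBonds {l : Fin M} : l ∈ evenBonds M ↔ ¬ IsOddBond l := by simp [evenBonds]

/-- The diagonal entries of `∑_{l ∈ s} I ⊗ diag(v_l) ⊗ I`. -/
def bondEnergy (s : Finset (Fin M)) (v : Fin M → Fin d × Fin d → ℝ) (x : Fin (M + 1) → Fin d) : ℝ :=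
  ∑ l ∈ s, v l (x l.castSucc, x l.succ)

theorem sum_embedBond_localDiag (s : Finset (Fin M)) (v : Fin M → Fin d × Fin d → ℝ) :
    ∑ l ∈ s, embedBond l (localDiag 𝕜 (v l)) = diagonal fun x => (bondEnergy s v x : 𝕜) := by
  simp only [localDiag, embedBond_diagonal, bondEnergy]
  ext x y
  rw [Matrix.sum_apply]
  by_cases h : x = y
  · subst h; simp
  · simp [h]

theorem diagA_eq (v : Fin M → Fin d × Fin d → ℝ) :
    diagA 𝕜 v = diagonal fun x => (bondEnergy (oddBonds M) v x : 𝕜) :=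
  sum_embedBond_localDiag _ v

theorem diagB_eq (v : Fin M → Fin d × Fin d → ℝ) :
    diagB 𝕜 v = diagonal fun x => (bondEnergy (evenBonds M) v x : 𝕜) :=
  sum_embedBond_localDiag _ v

/-- The mean of the local eigenvalues. -/
def localMean (w : Fin d × Fin d → ℝ) : ℝ := (∑ k, w k) / (d : ℝ) ^ 2

/-- The local eigenvalues with their means removed. -/
def centred (v : Fin M → Fin d × Fin d → ℝ) (l : Fin M) (i : Fin d × Fin d) : ℝ :=
  v l i - localMean (v l)

theorem sum_centred (hd : 2 ≤ d) (v : Fin M → Fin d × Fin d → ℝ) (l : Fin M) :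
    ∑ k, centred v l k = 0 := by
  have : (d : ℝ) ≠ 0 := by positivity
  simp only [centred, Finset.sum_sub_distrib, Finset.sum_const, Finset.card_univ,
    Fintype.card_prod, Fintype.card_fin, nsmul_eq_mul, localMean]
  push_cast
  field_simp
  ring

theorem diagonal_bondEnergy (s : Finset (Fin M)) (v : Fin M → Fin d × Fin d → ℝ) :
    (diagonal fun x => (bondEnergy s v x : 𝕜)) =
      ((∑ l ∈ s, localMean (v l) : ℝ) : 𝕜) • 1 +
        diagonal fun x => (bondEnergy s (centred v) x : 𝕜) := by
  rw [smul_one_eq_diagonal, diagonal_add]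
  congr 1
  ext x
  rw [← RCLike.ofReal_add]
  congr 1
  simp only [bondEnergy, centred, Finset.sum_sub_distrib]
  ring

/-- The mean energy `(Tr A + Tr B) / d^N`. -/
def meanEnergy (v : Fin M → Fin d × Fin d → ℝ) : ℝ := ∑ l, localMean (v l)

theorem meanEnergy_eq (v : Fin M → Fin d × Fin d → ℝ) :
    meanEnergy v = ∑ l ∈ oddBonds M, localMean (v l) + ∑ l ∈ evenBonds M, localMean (v l) :=
  (Finset.sum_filter_add_sum_filter_not _ _ _).symm

/-- The means are scalar matrices, unaffected by conjugation; they combine into one constant and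
leave traceless layers. -/
theorem diagA_add_conj (v : Fin M → Fin d × Fin d → ℝ)
    {Q : Matrix (Fin (M + 1) → Fin d) (Fin (M + 1) → Fin d) 𝕜} (hQ : Qᴴ * Q = 1) :
    diagA 𝕜 v + Qᴴ * diagB 𝕜 v * Q = ((meanEnergy v : ℝ) : 𝕜) • 1 +
      ((diagonal fun x => (bondEnergy (oddBonds M) (centred v) x : 𝕜)) +
        conjDiag (bondEnergy (evenBonds M) (centred v)) Q) := by
  rw [diagA_eq, diagB_eq, diagonal_bondEnergy, diagonal_bondEnergy (evenBonds M), meanEnergy_eq,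
    Matrix.mul_add, Matrix.add_mul, Matrix.mul_smul, Matrix.smul_mul, Matrix.mul_one, hQ,
    RCLike.ofReal_add, add_smul, conjDiag]
  abel

/-- `Tr A₀^j` for the centred odd layer `A₀`. -/
def oddPowerSum (v : Fin M → Fin d × Fin d → ℝ) (j : ℕ) : ℝ :=
  ∑ x, bondEnergy (oddBonds M) (centred v) x ^ j

/-- `Tr B₀^j` for the centred even layer `B₀`. -/
def evenPowerSum (v : Fin M → Fin d × Fin d → ℝ) (j : ℕ) : ℝ :=
  ∑ x, bondEnergy (evenBonds M) (centred v) x ^ j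

/-- The layer is unitarily equivalent to its diagonal matrix of eigenvalues, so the trace does not
depend on the eigenvectors. -/
theorem trace_layerSum_odd_pow (v : Fin M → Fin d × Fin d → ℝ)
    (U : Fin M → unitaryGroup (Fin d × Fin d) 𝕜) (j : ℕ) :
    trace (layerSum (centred v) (oddBonds M) U ^ j) = (oddPowerSum v j : 𝕜) := by
  have h : layerSum (centred v) (oddBonds M) U = _ := (layerA_conj (centred v) U).symm
  rw [h, trace_conj_pow (layerA_unitary U), diagA_eq, trace_diagonal_pow, oddPowerSum]

theorem trace_layerSum_even_pow (v : Fin M → Fin d × Fin d → ℝ)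
    (U : Fin M → unitaryGroup (Fin d × Fin d) 𝕜) (j : ℕ) :
    trace (layerSum (centred v) (evenBonds M) U ^ j) = (evenPowerSum v j : 𝕜) := by
  have h : layerSum (centred v) (evenBonds M) U = _ := (layerB_conj (centred v) U).symm
  rw [h, trace_conj_pow (layerB_unitary U), diagB_eq, trace_diagonal_pow, evenPowerSum]

theorem integral_trace_layerSum (v : Fin M → Fin d × Fin d → ℝ) (hv : ∀ l, ∑ k, v l k = 0)
    (s : Finset (Fin M)) :
    ∫ U, trace (layerSum v s U ^ 1) ∂eigenvectorLaw d M 𝕜 = 0 := by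
  have := integral_trace_layerSum_mul (𝕜 := 𝕜) v hv s (P := fun _ => 1) (fun _ _ _ _ => rfl)
    continuous_const
  simpa using this

theorem integral_trace_layerSum_sq (v : Fin M → Fin d × Fin d → ℝ) (hv : ∀ l, ∑ k, v l k = 0)
    (s : Finset (Fin M)) :
    ∫ U, trace (layerSum v s U ^ 2) ∂eigenvectorLaw d M 𝕜 =
      (((∑ l ∈ s, localSq (v l)) / (d : ℝ) ^ 2 * (d : ℝ) ^ (M + 1) : ℝ) : 𝕜) := by
  have := integral_trace_layerSum_sq_mul (𝕜 := 𝕜) v hv s (P := fun _ => 1) (fun _ _ _ _ => rfl)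
    continuous_const
  simp only [Matrix.mul_one, trace_one, integral_const, probReal_univ, one_smul] at this
  simp only [sq (layerSum v s _), this]
  simp

/-- The power sums are deterministic traces, so averaging them over Haar eigenvectors evaluates
them; the choice 𝕜 = ℝ is immaterial. The same device gives the second power sums. -/
theorem oddPowerSum_one (hd : 2 ≤ d) (v : Fin M → Fin d × Fin d → ℝ) : oddPowerSum v 1 = 0 := by
  have := integral_trace_layerSum (𝕜 := ℝ) (centred v) (sum_centred hd v) (oddBonds M)
  simpa only [trace_layerSum_odd_pow, integral_const, probReal_univ, one_smul,
    RCLike.ofReal_real_eq_id, id] using this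

theorem evenPowerSum_one (hd : 2 ≤ d) (v : Fin M → Fin d × Fin d → ℝ) : evenPowerSum v 1 = 0 := by
  have := integral_trace_layerSum (𝕜 := ℝ) (centred v) (sum_centred hd v) (evenBonds M)
  simpa only [trace_layerSum_even_pow, integral_const, probReal_univ, one_smul,
    RCLike.ofReal_real_eq_id, id] using this

theorem oddPowerSum_two (hd : 2 ≤ d) (v : Fin M → Fin d × Fin d → ℝ) : oddPowerSum v 2 =
    (∑ l ∈ oddBonds M, localSq (centred v l)) / (d : ℝ) ^ 2 * (d : ℝ) ^ (M + 1) := by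
  have := integral_trace_layerSum_sq (𝕜 := ℝ) (centred v) (sum_centred hd v) (oddBonds M)
  simpa only [trace_layerSum_odd_pow, integral_const, probReal_univ, one_smul,
    RCLike.ofReal_real_eq_id, id] using this

theorem evenPowerSum_two (hd : 2 ≤ d) (v : Fin M → Fin d × Fin d → ℝ) : evenPowerSum v 2 =
    (∑ l ∈ evenBonds M, localSq (centred v l)) / (d : ℝ) ^ 2 * (d : ℝ) ^ (M + 1) := by
  have := integral_trace_layerSum_sq (𝕜 := ℝ) (centred v) (sum_centred hd v) (evenBonds M)
  simpa only [trace_layerSum_even_pow, integral_const, probReal_univ, one_smul,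
    RCLike.ofReal_real_eq_id, id] using this

/-- Two different bonds of the layer give mean zero, even with P and R in between, since each local
term can be averaged alone. This reduces Tr YZYZ to one bond of each layer. -/
theorem integral_trace_layerSum_alternating (v : Fin M → Fin d × Fin d → ℝ)
    (hv : ∀ l, ∑ k, v l k = 0) (s : Finset (Fin M))
    {P R : (Fin M → unitaryGroup (Fin d × Fin d) 𝕜) →
      Matrix (Fin (M + 1) → Fin d) (Fin (M + 1) → Fin d) 𝕜}
    (hP : ∀ l ∈ s, IndepOfBond l P) (hR : ∀ l ∈ s, IndepOfBond l R) (hc : Continuous P)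
    (hc' : Continuous R) :
    ∫ U, trace (layerSum v s U * P U * layerSum v s U * R U) ∂eigenvectorLaw d M 𝕜 =
      ∑ l ∈ s, ∫ U, trace (localTerm v U l * P U * localTerm v U l * R U)
        ∂eigenvectorLaw d M 𝕜 := by
  have ht := fun l => continuous_localTerm (𝕜 := 𝕜) v l
  have hcont : ∀ l m, Continuous fun U : Fin M → unitaryGroup (Fin d × Fin d) 𝕜 =>
      localTerm v U l * P U * localTerm v U m * R U := fun l m =>
    (((ht l).matrix_mul hc).matrix_mul (ht m)).matrix_mul hc'
  have e : ∀ U : Fin M → unitaryGroup (Fin d × Fin d) 𝕜,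
      trace (layerSum v s U * P U * layerSum v s U * R U) =
      ∑ l ∈ s, ∑ m ∈ s, trace (localTerm v U l * P U * localTerm v U m * R U) := fun U => by
    simp only [layerSum, Finset.sum_mul, Finset.mul_sum, trace_sum]
    exact Finset.sum_comm
  simp only [e]
  rw [integral_finsetSum _ fun l _ => integrable_finsetSum _ fun m _ =>
    integrable_trace (hcont l m)]
  refine Finset.sum_congr rfl fun l hl => ?_
  rw [integral_finsetSum _ fun m _ => integrable_trace (hcont l m),
    Finset.sum_eq_single_of_mem l hl]
  intro m hm hml
  have := integral_trace_localTerm_mul v l (P := fun U => P U * (localTerm v U m * R U))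
    ((hP l hl).mul ((indepOfBond_localTerm v hml).mul (hR l hl)))
    (hc.matrix_mul ((ht m).matrix_mul hc'))
  rw [hv] at this
  simpa [Matrix.mul_assoc] using this

instance instDecidableRelDisjointBonds : DecidableRel (DisjointBonds (M := M)) :=
  fun l m => inferInstanceAs (Decidable ((l : ℕ) + 1 < m ∨ (m : ℕ) + 1 < l))

/-- The expected alternating trace of an odd and an even traceless local term. -/
theorem integral_trace_bondPair (hd : 2 ≤ d) (v : Fin M → Fin d × Fin d → ℝ)
    (hv : ∀ l, ∑ k, v l k = 0) {l m : Fin M} (hlm : l ≠ m) :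
    ∫ U, trace (localTerm v U l * localTerm v U m * localTerm v U l * localTerm v U m)
      ∂eigenvectorLaw d M 𝕜 =
    (((if DisjointBonds l m then 1 else adjacentFactor d (dysonIndex 𝕜)) *
      ((d : ℝ) ^ (M + 1) / d ^ 4) * (localSq (v l) * localSq (v m)) : ℝ) : 𝕜) := by
  split_ifs with h
  -- Commuting terms turn the alternating word into X²Y², which factorizes.
  · have e : ∀ U : Fin M → unitaryGroup (Fin d × Fin d) 𝕜,
        localTerm v U l * localTerm v U m * localTerm v U l * localTerm v U m =
        localTerm v U l * localTerm v U l * (localTerm v U m * localTerm v U m) := fun U => by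
      have : localTerm v U l * localTerm v U m = localTerm v U m * localTerm v U l :=
        embedBond_commute h (conjDiag (v l) (U l).1) (conjDiag (v m) (U m).1)
      rw [Matrix.mul_assoc (localTerm v U l) (localTerm v U m), ← this]
      simp only [Matrix.mul_assoc]
    simp only [e]
    have hm := indepOfBond_localTerm (𝕜 := 𝕜) v hlm.symm
    have hc := continuous_localTerm (𝕜 := 𝕜) v m
    rw [integral_trace_localTerm_sq_mul v l (hm.mul hm) (hc.matrix_mul hc)]
    have := integral_trace_localTerm_sq_mul (𝕜 := 𝕜) v m (P := fun _ => 1) (fun _ _ => rfl)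
      continuous_const
    simp only [Matrix.mul_one, trace_one, integral_const, probReal_univ, one_smul] at this
    rw [this, ← RCLike.ofReal_natCast (K := 𝕜), ← RCLike.ofReal_mul, ← RCLike.ofReal_mul]
    congr 1
    have hd0 : (d : ℝ) ≠ 0 := by positivity
    simp only [Fintype.card_pi, Fintype.card_fin, Finset.prod_const, Finset.card_univ]
    push_cast
    field_simp
  · rw [DisjointBonds] at h
    rw [ne_eq, Fin.ext_iff] at hlm
    rcases (by omega : (m : ℕ) = l + 1 ∨ (l : ℕ) = m + 1) with h' | h'
    · exact integral_trace_adjacent hd v hv h'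
    -- When the odd bond is the right one of the two, cyclicity of the trace exchanges the roles.
    · have := integral_trace_adjacent (𝕜 := 𝕜) hd v hv h'
      rw [mul_comm (localSq (v l)), ← this]
      refine integral_congr_ae (ae_of_all _ fun U => ?_)
      simp only
      rw [trace_mul_comm]
      simp only [Matrix.mul_assoc]

/-- The alternating moment `E Tr (A₀ B₀ A₀ B₀)` of the quantum chain. -/
def quantumAlternating (𝕜 : Type*) [RCLike 𝕜] (v : Fin M → Fin d × Fin d → ℝ) : ℝ :=
  ∑ l ∈ oddBonds M, ∑ m ∈ evenBonds M,
    (if DisjointBonds l m then 1 else adjacentFactor d (dysonIndex 𝕜)) *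
      ((d : ℝ) ^ (M + 1) / d ^ 4) * (localSq (centred v l) * localSq (centred v m))

theorem ne_of_odd_of_even {l m : Fin M} (hl : l ∈ oddBonds M) (hm : m ∈ evenBonds M) : l ≠ m := by
  rintro rfl
  exact mem_evenBonds.mp hm (mem_oddBonds.mp hl)

theorem IndepOfBond.pow {l : Fin M} {P : (Fin M → unitaryGroup (Fin d × Fin d) 𝕜) →
      Matrix (Fin (M + 1) → Fin d) (Fin (M + 1) → Fin d) 𝕜}
    (hP : IndepOfBond l P) (j : ℕ) : IndepOfBond l fun U => P U ^ j :=
  fun U W => by simp only [hP U W]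

/-- The two layers involve disjoint sets of independent eigenvectors, so either can be averaged with
the other fixed. Only the alternating word needs a bond-by-bond analysis, first reducing the odd
layer and then the even one. -/
theorem factorizingPair_quantum (hd : 2 ≤ d) (v : Fin M → Fin d × Fin d → ℝ) :
    FactorizingPair (eigenvectorLaw d M 𝕜) (layerSum (centred v) (oddBonds M))
      (layerSum (centred v) (evenBonds M)) (oddPowerSum v) (evenPowerSum v)
      (quantumAlternating 𝕜 v) := by
  set w := centred v with hw
  have hw0 := sum_centred hd v
  have hO := continuous_layerSum (𝕜 := 𝕜) w (oddBonds M)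
  have hE := continuous_layerSum (𝕜 := 𝕜) w (evenBonds M)
  have iO : ∀ m ∈ evenBonds M, IndepOfBond m (layerSum (𝕜 := 𝕜) w (oddBonds M)) := fun m hm =>
    indepOfBond_layerSum w fun h => ne_of_odd_of_even h hm rfl
  have iE : ∀ l ∈ oddBonds M, IndepOfBond l (layerSum (𝕜 := 𝕜) w (evenBonds M)) := fun l hl =>
    indepOfBond_layerSum w fun h => ne_of_odd_of_even hl h rfl
  have hright : ∀ j, ∫ U, trace (layerSum w (oddBonds M) U ^ j * layerSum w (evenBonds M) U)
      ∂eigenvectorLaw d M 𝕜 = 0 := fun j => by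
    simp only [trace_mul_comm (layerSum w (oddBonds M) _ ^ j)]
    exact integral_trace_layerSum_mul w hw0 _ (P := fun U => layerSum w (oddBonds M) U ^ j)
      (fun m hm => (iO m hm).pow j) (hO.pow j)
  have hleft : ∀ j, ∫ U, trace (layerSum w (oddBonds M) U * layerSum w (evenBonds M) U ^ j)
      ∂eigenvectorLaw d M 𝕜 = 0 := fun j =>
    integral_trace_layerSum_mul w hw0 _ (P := fun U => layerSum w (evenBonds M) U ^ j)
      (fun m hm => (iE m hm).pow j) (hE.pow j)
  refine ⟨fun F hF => (hF.comp (hO.prodMk hE)).integrable_of_compact,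
    fun j U => trace_layerSum_odd_pow v U j, fun j U => trace_layerSum_even_pow v U j,
    oddPowerSum_one hd v, evenPowerSum_one hd v, by simpa using hleft 1, hright 2, hleft 2,
    hright 3, hleft 3, ?_, ?_⟩
  · have := integral_trace_layerSum_sq_mul w hw0 (oddBonds M)
      (P := fun U : Fin M → unitaryGroup (Fin d × Fin d) 𝕜 => layerSum w (evenBonds M) U ^ 2)
      (fun m hm => (iE m hm).pow 2) (hE.pow 2)
    simp only [hw, trace_layerSum_even_pow, integral_const, probReal_univ, one_smul] at this
    refine Eq.trans (integral_congr_ae (ae_of_all _ fun U => ?_)) (this.trans ?_)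
    · simp only [hw, sq (layerSum (centred v) (oddBonds M) U)]
    rw [oddPowerSum_two hd, ← RCLike.ofReal_mul]
    congr 1
    have hd0 : (d : ℝ) ≠ 0 := by positivity
    simp only [Fintype.card_pi, Fintype.card_fin, Finset.prod_const, Finset.card_univ]
    push_cast
    field_simp
  · rw [integral_trace_layerSum_alternating w hw0 _ iE iE hE hE, quantumAlternating,
      RCLike.ofReal_sum]
    refine Finset.sum_congr rfl fun l hl => ?_
    have ht := continuous_localTerm (𝕜 := 𝕜) w l
    have hi : ∀ m ∈ evenBonds M, IndepOfBond m fun U : Fin M → unitaryGroup (Fin d × Fin d) 𝕜 =>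
        localTerm w U l := fun m hm => indepOfBond_localTerm w (ne_of_odd_of_even hl hm)
    have e : ∀ U : Fin M → unitaryGroup (Fin d × Fin d) 𝕜,
        trace (localTerm w U l * layerSum w (evenBonds M) U * localTerm w U l *
          layerSum w (evenBonds M) U) = trace (layerSum w (evenBonds M) U * localTerm w U l *
          layerSum w (evenBonds M) U * localTerm w U l) := fun U => by
      rw [trace_mul_comm]
      simp only [Matrix.mul_assoc]
    simp only [e]
    rw [integral_trace_layerSum_alternating w hw0 _ hi hi ht ht, RCLike.ofReal_sum]
    refine Finset.sum_congr rfl fun m hm => ?_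
    rw [← integral_trace_bondPair hd w hw0 (ne_of_odd_of_even hl hm)]
    refine integral_congr_ae (ae_of_all _ fun U => ?_)
    simp only
    rw [trace_mul_comm]
    simp only [Matrix.mul_assoc]

theorem HasMean.integral_traceMoment {Ω : Type*} [MeasurableSpace Ω] {μ : Measure Ω}
    {f : Ω → 𝕜} {g : Ω → ℝ} {m : ℝ} (hd : 2 ≤ d)
    (h : HasMean μ f ((Fintype.card (Fin (M + 1) → Fin d) * m : ℝ) : 𝕜))
    (hg : ∀ ω, g ω = ((d : ℝ) ^ (M + 1))⁻¹ * RCLike.re (f ω)) : ∫ ω, g ω ∂μ = m := by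
  simp only [hg, integral_const_mul]
  rw [integral_re h.1, h.2, RCLike.ofReal_re]
  have hd0 : (d : ℝ) ≠ 0 := by positivity
  simp only [Fintype.card_pi, Fintype.card_fin, Finset.prod_const, Finset.card_univ]
  push_cast
  field_simp

theorem nonempty_config (hd : 2 ≤ d) : Nonempty (Fin (M + 1) → Fin d) :=
  ⟨fun _ => ⟨0, by omega⟩⟩

theorem integral_traceMoment_quantum (hd : 2 ≤ d) (v : Fin M → Fin d × Fin d → ℝ) {r : ℕ}
    (hr : r ∈ ({1, 2, 3, 4} : Set ℕ)) :
    ∫ U, traceMoment v (quantumQ U) r ∂eigenvectorLaw d M 𝕜 =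
      sumMoment (Fintype.card (Fin (M + 1) → Fin d)) (meanEnergy v) (oddPowerSum v)
        (evenPowerSum v) (quantumAlternating 𝕜 v) r := by
  have := nonempty_config (M := M) hd
  refine ((factorizingPair_quantum (𝕜 := 𝕜) hd v).hasMean_trace_pow (meanEnergy v)
    hr).integral_traceMoment hd fun U => ?_
  have hA := layerA_unitary U
  have hA' : layerA U * (layerA U)ᴴ = 1 := mul_eq_one_comm.mp hA
  have hQ : (quantumQ U)ᴴ * quantumQ U = 1 := by
    rw [quantumQ, conjTranspose_mul, conjTranspose_conjTranspose]
    calc layerA U * (layerB U)ᴴ * (layerB U * (layerA U)ᴴ)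
        = layerA U * ((layerB U)ᴴ * layerB U) * (layerA U)ᴴ := by simp only [Matrix.mul_assoc]
      _ = 1 := by rw [layerB_unitary, Matrix.mul_one, hA']
  -- Conjugation by Q^(A) returns from the eigenbasis of the odd layer to the original basis, where
  -- the matrix is the sum of the two layers of local terms.
  rw [traceMoment, ← trace_conj_pow hA, diagA_add_conj v hQ]
  congr 4
  rw [Matrix.mul_add, Matrix.add_mul, Matrix.mul_add, Matrix.add_mul, Matrix.mul_smul,
    Matrix.smul_mul, Matrix.mul_one, hA, ← diagA_eq, layerA_conj]
  congr 2
  rw [← conjDiag_mul_right, quantumQ, Matrix.mul_assoc, hA, Matrix.mul_one, conjDiag, ← diagB_eq,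
    layerB_conj]
  rfl

/-- The alternating moment `E Tr (A₀ B₀ A₀ B₀)` for a Haar rotation. -/
def isoAlternating (𝕜 : Type*) [RCLike 𝕜] (v : Fin M → Fin d × Fin d → ℝ) : ℝ :=
  fluctuation (Fin (M + 1) → Fin d) 𝕜 (bondEnergy (evenBonds M) (centred v)) * oddPowerSum v 2 *
    (2 / dysonIndex 𝕜 - 1 - 2 / (dysonIndex 𝕜 * Fintype.card (Fin (M + 1) → Fin d)))

theorem two_le_card_config (hd : 2 ≤ d) : 2 ≤ Fintype.card (Fin (M + 1) → Fin d) := by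
  simp only [Fintype.card_pi, Fintype.card_fin, Finset.prod_const, Finset.card_univ]
  calc 2 ≤ d := hd
    _ ≤ d ^ (M + 1) := Nat.le_self_pow (by omega) d

theorem integral_traceMoment_iso (hd : 2 ≤ d) (v : Fin M → Fin d × Fin d → ℝ) {r : ℕ}
    (hr : r ∈ ({1, 2, 3, 4} : Set ℕ)) :
    ∫ Q : unitaryGroup (Fin (M + 1) → Fin d) 𝕜, traceMoment v Q.1 r
        ∂haarUnitary (Fin (M + 1) → Fin d) 𝕜 =
      sumMoment (Fintype.card (Fin (M + 1) → Fin d)) (meanEnergy v) (oddPowerSum v)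
        (evenPowerSum v) (isoAlternating 𝕜 v) r := by
  have := nonempty_config (M := M) hd
  have ha : ∑ x, bondEnergy (oddBonds M) (centred v) x = 0 := by
    simpa [oddPowerSum] using oddPowerSum_one hd v
  have hb : ∑ x, bondEnergy (evenBonds M) (centred v) x = 0 := by
    simpa [evenPowerSum] using evenPowerSum_one hd v
  have hpair := factorizingPair_of_average (μ := haarUnitary (Fin (M + 1) → Fin d) 𝕜)
    (Q := fun Q => Q.1) unitaryGroup.conjTranspose_mul
    (fun F hF => (hF.comp continuous_subtype_val).integrable_of_compact)
    (fun P w => by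
      have := integral_linear_conjDiag w ((traceLinearMap _ 𝕜 𝕜).comp (LinearMap.mulLeft 𝕜 P))
      simpa using this) ha hb
    (integral_trace_alternating _ _ ha hb (two_le_card_config hd))
  refine (hpair.hasMean_trace_pow (meanEnergy v) hr).integral_traceMoment hd fun Q => ?_
  rw [traceMoment, diagA_add_conj v (unitaryGroup.conjTranspose_mul Q)]

/-- The uniform law on permutations. -/
def uniformPerm (n : Type*) [Fintype n] [DecidableEq n] : @Measure (Equiv.Perm n) ⊤ :=
  letI : MeasurableSpace (Equiv.Perm n) := ⊤
  (Fintype.card (Equiv.Perm n) : ENNReal)⁻¹ • Measure.count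

theorem isProbabilityMeasure_uniformPerm (n : Type*) [Fintype n] [DecidableEq n] :
    @IsProbabilityMeasure _ ⊤ (uniformPerm n) := by
  let _ : MeasurableSpace (Equiv.Perm n) := ⊤
  refine ⟨?_⟩
  rw [uniformPerm, Measure.smul_apply, Measure.count_univ, smul_eq_mul, ENat.card_eq_coe_fintype_card]
  exact ENNReal.inv_mul_cancel (by simp [Fintype.card_ne_zero]) (by simp)

theorem integral_uniformPerm {n E : Type*} [Fintype n] [DecidableEq n] [NormedAddCommGroup E]
    [NormedSpace ℝ E] [CompleteSpace E] (f : Equiv.Perm n → E) :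
    @integral _ _ _ _ ⊤ (uniformPerm n) f =
      (Fintype.card (Equiv.Perm n) : ℝ)⁻¹ • ∑ σ, f σ := by
  let _ : MeasurableSpace (Equiv.Perm n) := ⊤
  rw [uniformPerm, integral_smul_measure, integral_count]
  simp

/-- Left multiplication by a transposition shows that the sum is independent of i; summing over i
evaluates it. -/
theorem sum_perm_apply {n E : Type*} [Fintype n] [DecidableEq n] [Field E] [CharZero E]
    (w : n → E) (i : n) :
    ∑ σ : Equiv.Perm n, w (σ⁻¹ i) =
      Fintype.card (Equiv.Perm n) * ((∑ j, w j) / Fintype.card n) := by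
  have h1 : ∀ j, ∑ σ : Equiv.Perm n, w (σ⁻¹ j) = ∑ σ : Equiv.Perm n, w (σ⁻¹ i) := fun j => by
    rw [← Equiv.sum_comp (Equiv.mulLeft (Equiv.swap i j))]
    simp
  have h2 : ∑ j, ∑ σ : Equiv.Perm n, w (σ⁻¹ j) = Fintype.card (Equiv.Perm n) * ∑ j, w j := by
    rw [Finset.sum_comm]
    simp only [Equiv.sum_comp, Finset.sum_const, Finset.card_univ, nsmul_eq_mul]
  simp only [h1, Finset.sum_const, Finset.card_univ, nsmul_eq_mul] at h2
  have : (Fintype.card n : E) ≠ 0 := by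
    have : Nonempty n := ⟨i⟩
    exact_mod_cast Fintype.card_ne_zero
  field_simp
  rw [mul_comm, h2]

theorem conjDiag_permMatrix {n : Type*} [Fintype n] [DecidableEq n] (w : n → ℝ)
    (σ : Equiv.Perm n) :
    conjDiag w (σ.permMatrix 𝕜) = diagonal fun i => (w (σ⁻¹ i) : 𝕜) := by
  ext i j
  rw [conjDiag, conj_permMatrix_apply, diagonal_apply, diagonal_apply]
  simp

theorem integral_trace_mul_conjDiag_perm {n : Type*} [Fintype n] [DecidableEq n]
    (P : Matrix n n 𝕜) (w : n → ℝ) :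
    @integral _ _ _ _ ⊤ (uniformPerm n) (fun σ => trace (P * conjDiag w (σ.permMatrix 𝕜)))
      = (((∑ x, w x) / Fintype.card n : ℝ) : 𝕜) * trace P := by
  rw [integral_uniformPerm]
  simp only [conjDiag_permMatrix, trace, diag_apply, mul_diagonal]
  rw [Finset.sum_comm]
  simp only [← Finset.mul_sum, sum_perm_apply (fun i => (w i : 𝕜)), ← Finset.sum_mul]
  have : (Fintype.card (Equiv.Perm n) : 𝕜) ≠ 0 := by exact_mod_cast Fintype.card_ne_zero
  rw [RCLike.real_smul_eq_coe_mul]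
  push_cast
  field_simp

theorem average_traceMoment_classical (𝕜 : Type*) [RCLike 𝕜] (hd : 2 ≤ d)
    (v : Fin M → Fin d × Fin d → ℝ) {r : ℕ} (hr : r ∈ ({1, 2, 3, 4} : Set ℕ)) :
    (Fintype.card (Equiv.Perm (Fin (M + 1) → Fin d)) : ℝ)⁻¹ *
      ∑ σ : Equiv.Perm (Fin (M + 1) → Fin d), traceMoment v (σ.permMatrix 𝕜) r =
      sumMoment (Fintype.card (Fin (M + 1) → Fin d)) (meanEnergy v) (oddPowerSum v)
        (evenPowerSum v)
        (oddPowerSum v 2 * evenPowerSum v 2 / Fintype.card (Fin (M + 1) → Fin d)) r := by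
  have := nonempty_config (M := M) hd
  have ha : ∑ x, bondEnergy (oddBonds M) (centred v) x = 0 := by
    simpa [oddPowerSum] using oddPowerSum_one hd v
  have hb : ∑ x, bondEnergy (evenBonds M) (centred v) x = 0 := by
    simpa [evenPowerSum] using evenPowerSum_one hd v
  let _ : MeasurableSpace (Equiv.Perm (Fin (M + 1) → Fin d)) := ⊤
  have := isProbabilityMeasure_uniformPerm (Fin (M + 1) → Fin d)
  have hpair := factorizingPair_of_average (μ := uniformPerm (Fin (M + 1) → Fin d))
    (Q := fun σ => σ.permMatrix 𝕜) permMatrix_unitary (fun F hF => Integrable.of_finite)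
    integral_trace_mul_conjDiag_perm ha hb
    (θ := oddPowerSum v 2 * evenPowerSum v 2 / Fintype.card (Fin (M + 1) → Fin d)) (by
      -- A permuted diagonal matrix is still diagonal, so YZYZ = Y²Z² and the alternating word
      -- factorizes too.
      have e : ∀ σ : Equiv.Perm (Fin (M + 1) → Fin d),
          trace (diagonal (fun x => (bondEnergy (oddBonds M) (centred v) x : 𝕜)) *
            conjDiag (bondEnergy (evenBonds M) (centred v)) (σ.permMatrix 𝕜) *
            diagonal (fun x => (bondEnergy (oddBonds M) (centred v) x : 𝕜)) *
            conjDiag (bondEnergy (evenBonds M) (centred v)) (σ.permMatrix 𝕜)) =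
          trace (diagonal (fun x => (bondEnergy (oddBonds M) (centred v) x : 𝕜)) ^ 2 *
            conjDiag (fun x => bondEnergy (evenBonds M) (centred v) x ^ 2)
              (σ.permMatrix 𝕜)) := fun σ => by
        simp only [conjDiag_permMatrix, diagonal_mul_diagonal, diagonal_pow]
        congr 2
        ext x
        simp only [Pi.pow_apply]
        push_cast
        ring
      simp only [e, integral_trace_mul_conjDiag_perm, trace_diagonal_pow]
      rw [← RCLike.ofReal_mul, oddPowerSum, evenPowerSum]
      congr 1
      ring)
  have h := (hpair.hasMean_trace_pow (meanEnergy v) hr).integral_traceMoment hd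
    (g := fun σ => traceMoment v (σ.permMatrix 𝕜) r) fun σ => by
      rw [traceMoment, diagA_add_conj v (permMatrix_unitary σ)]
  rw [integral_uniformPerm, smul_eq_mul] at h
  exact h

end Chains

/-! ### Averages over the local eigenvalues -/

section Eigenvalues

variable {d M : ℕ}

instance instIsProbabilityMeasureBondLaw {X : Type*} [MeasurableSpace X] (ρo ρe : Measure X)
    [IsProbabilityMeasure ρo] [IsProbabilityMeasure ρe] (l : Fin M) :
    IsProbabilityMeasure (if IsOddBond l then ρo else ρe) := by
  split_ifs <;> infer_instance

instance instIsProbabilityMeasureEigenvalueLaw (ρo ρe : Measure (Fin d × Fin d → ℝ))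
    [IsProbabilityMeasure ρo] [IsProbabilityMeasure ρe] :
    IsProbabilityMeasure (eigenvalueLaw ρo ρe M) :=
  inferInstanceAs (IsProbabilityMeasure (Measure.pi _))

/-- `∑ (w - mean)²` for local eigenvalues `w`. -/
def centredSq (w : Fin d × Fin d → ℝ) : ℝ := ∑ k, (w k - localMean w) ^ 2

theorem localSq_centred (v : Fin M → Fin d × Fin d → ℝ) (l : Fin M) :
    localSq (centred v l) = centredSq (v l) := rfl

theorem centredSq_nonneg (w : Fin d × Fin d → ℝ) : 0 ≤ centredSq w :=
  Finset.sum_nonneg fun _ _ => sq_nonneg _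

theorem memLp_four_iff {X : Type*} [MeasurableSpace X] {μ : Measure X} {f : X → ℝ}
    (hf : Measurable f) : MemLp f 4 μ ↔ Integrable (fun x => f x ^ 4) μ := by
  rw [← integrable_norm_rpow_iff hf.aestronglyMeasurable (by norm_num) (by norm_num)]
  refine iff_of_eq (congrArg (fun g => Integrable g μ) (funext fun x => ?_))
  have : (4 : ENNReal).toReal = ((4 : ℕ) : ℝ) := by norm_num
  rw [this, Real.rpow_natCast, Real.norm_eq_abs]
  exact Even.pow_abs (by decide) _

variable {ρ : Measure (Fin d × Fin d → ℝ)}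

theorem memLp_eval (h : ∀ i, Integrable (fun v => v i ^ 4) ρ) (i : Fin d × Fin d) :
    MemLp (fun v => v i) 4 ρ := (memLp_four_iff (measurable_pi_apply i)).mpr (h i)

theorem memLp_localMean (h : ∀ i, Integrable (fun v => v i ^ 4) ρ) : MemLp localMean 4 ρ := by
  have : MemLp (fun w : Fin d × Fin d → ℝ => ((d : ℝ) ^ 2)⁻¹ * ∑ k, w k) 4 ρ :=
    (memLp_finsetSum _ fun k _ => memLp_eval h k).const_mul _
  refine this.congr_norm ?_ (ae_of_all _ fun w => ?_)
  · unfold localMean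
    exact Measurable.aestronglyMeasurable (by fun_prop)
  · rw [localMean, div_eq_inv_mul]

variable [IsProbabilityMeasure ρ]

theorem integrable_centredSq (h : ∀ i, Integrable (fun v => v i ^ 4) ρ) :
    Integrable centredSq ρ := by
  refine integrable_finsetSum _ fun k _ => MemLp.integrable_sq ?_
  exact ((memLp_eval h k).sub (memLp_localMean h)).mono_exponent (by norm_num)

/-- A vanishing mean of the nonnegative square sum would make almost every local term equal to its
mean, that is, scalar. -/
theorem integral_centredSq_pos (h : ∀ i, Integrable (fun v => v i ^ 4) ρ)
    (hs : ¬ ∀ᵐ v ∂ρ, ∀ i j, v i = v j) : 0 < ∫ w, centredSq w ∂ρ := by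
  refine lt_of_le_of_ne (integral_nonneg centredSq_nonneg) fun h0 => hs ?_
  have := (integral_eq_zero_iff_of_nonneg centredSq_nonneg (integrable_centredSq h)).mp h0.symm
  filter_upwards [this] with w hw i j
  rw [Pi.zero_apply, centredSq, Finset.sum_eq_zero_iff_of_nonneg fun _ _ => sq_nonneg _] at hw
  have hk := fun k => sub_eq_zero.mp (pow_eq_zero_iff two_ne_zero |>.mp (hw k (Finset.mem_univ k)))
  rw [hk i, hk j]

section

variable (𝕜 : Type*) [RCLike 𝕜] {ρo ρe : Measure (Fin d × Fin d → ℝ)}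

/-- The conditional moments given the local eigenvalues. -/
def conditionalMoment (v : Fin M → Fin d × Fin d → ℝ) (θ : ℝ) (r : ℕ) : ℝ :=
  sumMoment (Fintype.card (Fin (M + 1) → Fin d)) (meanEnergy v) (oddPowerSum v) (evenPowerSum v) θ r

/-- The alternating moment `E Tr (A₀ B₀ A₀ B₀)` for a uniformly random permutation. -/
def classicalAlternating (v : Fin M → Fin d × Fin d → ℝ) : ℝ :=
  oddPowerSum v 2 * evenPowerSum v 2 / Fintype.card (Fin (M + 1) → Fin d)

theorem momentQuantum_eq (hd : 2 ≤ d) {r : ℕ} (hr : r ∈ ({1, 2, 3, 4} : Set ℕ)) :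
    momentQuantum 𝕜 ρo ρe M r =
      ∫ v, conditionalMoment v (quantumAlternating 𝕜 v) r ∂eigenvalueLaw ρo ρe M :=
  integral_congr_ae (ae_of_all _ fun v => integral_traceMoment_quantum hd v hr)

theorem momentIso_eq (hd : 2 ≤ d) {r : ℕ} (hr : r ∈ ({1, 2, 3, 4} : Set ℕ)) :
    momentIso 𝕜 ρo ρe M r =
      ∫ v, conditionalMoment v (isoAlternating 𝕜 v) r ∂eigenvalueLaw ρo ρe M :=
  integral_congr_ae (ae_of_all _ fun v => integral_traceMoment_iso hd v hr)

theorem momentClassical_eq (hd : 2 ≤ d) {r : ℕ} (hr : r ∈ ({1, 2, 3, 4} : Set ℕ)) :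
    momentClassical 𝕜 ρo ρe M r =
      ∫ v, conditionalMoment v (classicalAlternating v) r ∂eigenvalueLaw ρo ρe M :=
  integral_congr_ae (ae_of_all _ fun v => average_traceMoment_classical 𝕜 hd v hr)

/-- The alternating word has length four, so it cannot enter the first three moments. -/
theorem conditionalMoment_congr (v : Fin M → Fin d × Fin d → ℝ) (θ θ' : ℝ) {r : ℕ}
    (hr : r ∈ ({1, 2, 3} : Set ℕ)) : conditionalMoment v θ r = conditionalMoment v θ' r := by
  rcases hr with rfl | rfl | rfl <;> rfl

theorem lower_moments_eq (hd : 2 ≤ d) {r : ℕ} (hr : r ∈ ({1, 2, 3} : Set ℕ)) :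
    momentQuantum 𝕜 ρo ρe M r = momentClassical 𝕜 ρo ρe M r ∧
      momentIso 𝕜 ρo ρe M r = momentClassical 𝕜 ρo ρe M r := by
  have hr' : r ∈ ({1, 2, 3, 4} : Set ℕ) := by
    rcases hr with rfl | rfl | rfl <;> simp
  rw [momentQuantum_eq 𝕜 hd hr', momentIso_eq 𝕜 hd hr', momentClassical_eq 𝕜 hd hr']
  exact ⟨integral_congr_ae (ae_of_all _ fun v => conditionalMoment_congr v _ _ hr),
    integral_congr_ae (ae_of_all _ fun v => conditionalMoment_congr v _ _ hr)⟩

end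

variable {ρo ρe : Measure (Fin d × Fin d → ℝ)} [IsProbabilityMeasure ρo] [IsProbabilityMeasure ρe]

theorem memLp_bond (ho : ∀ i, Integrable (fun v => v i ^ 4) ρo)
    (he : ∀ i, Integrable (fun v => v i ^ 4) ρe) (l : Fin M) (i : Fin d × Fin d) :
    MemLp (fun v : Fin M → Fin d × Fin d → ℝ => v l i) 4 (eigenvalueLaw ρo ρe M) := by
  have hp := measurePreserving_eval (fun l : Fin M => if IsOddBond l then ρo else ρe) l
  refine MemLp.comp_measurePreserving (g := fun w => w i) ?_ hp
  split_ifs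
  · exact memLp_eval ho i
  · exact memLp_eval he i

theorem memLp_bondEnergy (ho : ∀ i, Integrable (fun v => v i ^ 4) ρo)
    (he : ∀ i, Integrable (fun v => v i ^ 4) ρe) (s : Finset (Fin M)) (x : Fin (M + 1) → Fin d) :
    MemLp (fun v => bondEnergy s v x) 4 (eigenvalueLaw ρo ρe M) :=
  memLp_finsetSum _ fun l _ => memLp_bond ho he l _

theorem traceMoment_permMatrix {𝕜 : Type*} [RCLike 𝕜] (v : Fin M → Fin d × Fin d → ℝ)
    (σ : Equiv.Perm (Fin (M + 1) → Fin d)) (r : ℕ) :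
    traceMoment v (σ.permMatrix 𝕜) r = ((d : ℝ) ^ (M + 1))⁻¹ *
      ∑ x, (bondEnergy (oddBonds M) v x + bondEnergy (evenBonds M) v (σ⁻¹ x)) ^ r := by
  have h := conjDiag_permMatrix (𝕜 := 𝕜) (bondEnergy (evenBonds M) v) σ
  rw [conjDiag, ← diagB_eq] at h
  rw [traceMoment, h, diagA_eq, diagonal_add]
  have e : (fun x => (bondEnergy (oddBonds M) v x : 𝕜) + bondEnergy (evenBonds M) v (σ⁻¹ x)) =
      fun x => ((bondEnergy (oddBonds M) v x + bondEnergy (evenBonds M) v (σ⁻¹ x) : ℝ) : 𝕜) := by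
    ext x; push_cast; rfl
  rw [e, trace_diagonal_pow, RCLike.ofReal_re]

/-- In the classical model the fourth moment is a finite combination of fourth powers of sums of
local eigenvalues, each in L⁴. This supplies the integrability used in comparing with the other two
models. -/
theorem integrable_average_traceMoment_classical (𝕜 : Type*) [RCLike 𝕜]
    (ho : ∀ i, Integrable (fun v => v i ^ 4) ρo) (he : ∀ i, Integrable (fun v => v i ^ 4) ρe) :
    Integrable (fun v => (Fintype.card (Equiv.Perm (Fin (M + 1) → Fin d)) : ℝ)⁻¹ *
      ∑ σ : Equiv.Perm (Fin (M + 1) → Fin d), traceMoment v (σ.permMatrix 𝕜) 4)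
      (eigenvalueLaw ρo ρe M) := by
  simp only [traceMoment_permMatrix]
  refine (integrable_finsetSum _ fun σ _ => (integrable_finsetSum _ fun x _ => ?_).const_mul
    _).const_mul _
  refine (memLp_four_iff ?_).mp
    ((memLp_bondEnergy ho he (oddBonds M) x).add (memLp_bondEnergy ho he (evenBonds M) (σ⁻¹ x)))
  unfold bondEnergy
  fun_prop

/-- Averages of products of the variances of two different bonds. -/
theorem integral_centredSq_mul (ho : ∀ i, Integrable (fun v => v i ^ 4) ρo)
    (he : ∀ i, Integrable (fun v => v i ^ 4) ρe) {l m : Fin M} (hl : l ∈ oddBonds M)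
    (hm : m ∈ evenBonds M) :
    HasMean (eigenvalueLaw ρo ρe M) (fun v => centredSq (v l) * centredSq (v m))
      ((∫ w, centredSq w ∂ρo) * ∫ w, centredSq w ∂ρe) := by
  have hlm := ne_of_odd_of_even hl hm
  rw [mem_oddBonds] at hl
  rw [mem_evenBonds] at hm
  -- Padding with 1 on all other bonds makes the integrand a full product over independent
  -- coordinates.
  let f : Fin M → (Fin d × Fin d → ℝ) → ℝ := fun i => if i = l ∨ i = m then centredSq else 1
  have hf : ∀ v : Fin M → Fin d × Fin d → ℝ, centredSq (v l) * centredSq (v m) = ∏ i, f i (v i) :=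
    fun v => by
      rw [Fintype.prod_eq_mul l m hlm]
      · simp [f]
      · rintro i ⟨h1, h2⟩; simp [f, h1, h2]
  have hi : ∀ i, Integrable (f i) (if IsOddBond i then ρo else ρe) := fun i => by
    simp only [f]
    split_ifs
    · exact integrable_centredSq ho
    · exact integrable_centredSq he
    · exact integrable_const _
    · exact integrable_const _
  simp only [hf]
  refine ⟨Integrable.fintype_prod hi, ?_⟩
  rw [eigenvalueLaw, integral_fintype_prod_eq_prod, Fintype.prod_eq_mul l m hlm]
  · simp [f, hl, hm]
  · rintro i ⟨h1, h2⟩; simp [f, h1, h2]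

theorem HasMean.finsetSum {Ω ι : Type*} [MeasurableSpace Ω] {μ : Measure Ω} {f : ι → Ω → ℝ}
    {v : ι → ℝ} (s : Finset ι) (h : ∀ i ∈ s, HasMean μ (f i) (v i)) :
    HasMean μ (fun ω => ∑ i ∈ s, f i ω) (∑ i ∈ s, v i) :=
  ⟨integrable_finsetSum _ fun i hi => (h i hi).1, by
    rw [integral_finsetSum _ fun i hi => (h i hi).1]
    exact Finset.sum_congr rfl fun i hi => (h i hi).2⟩

theorem hasMean_centredSq_odd (ho : ∀ i, Integrable (fun v => v i ^ 4) ρo) {l : Fin M}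
    (hl : l ∈ oddBonds M) :
    HasMean (eigenvalueLaw ρo ρe M) (fun v => centredSq (v l)) (∫ w, centredSq w ∂ρo) := by
  have hp := measurePreserving_eval (fun l : Fin M => if IsOddBond l then ρo else ρe) l
  simp only [if_pos (mem_oddBonds.mp hl)] at hp
  have hi := integrable_centredSq ho
  exact ⟨hp.integrable_comp_of_integrable hi, by
    have := integral_map hp.measurable.aemeasurable (f := centredSq) (by
      rw [hp.map_eq]; exact hi.aestronglyMeasurable)
    rw [hp.map_eq] at this
    exact this.symm⟩

theorem hasMean_centredSq_even (he : ∀ i, Integrable (fun v => v i ^ 4) ρe) {l : Fin M}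
    (hl : l ∈ evenBonds M) :
    HasMean (eigenvalueLaw ρo ρe M) (fun v => centredSq (v l)) (∫ w, centredSq w ∂ρe) := by
  have hp := measurePreserving_eval (fun l : Fin M => if IsOddBond l then ρo else ρe) l
  simp only [if_neg (mem_evenBonds.mp hl)] at hp
  have hi := integrable_centredSq he
  exact ⟨hp.integrable_comp_of_integrable hi, by
    have := integral_map hp.measurable.aemeasurable (f := centredSq) (by
      rw [hp.map_eq]; exact hi.aestronglyMeasurable)
    rw [hp.map_eq] at this
    exact this.symm⟩

variable (𝕜 : Type*) [RCLike 𝕜]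

/-- The other model is written as the classical one minus an explicit integrable difference, so its
own integrability need not be proved separately. -/
theorem integral_fourth_sub (hd : 2 ≤ d) (ho : ∀ i, Integrable (fun v => v i ^ 4) ρo)
    (he : ∀ i, Integrable (fun v => v i ^ 4) ρe) {θ : (Fin M → Fin d × Fin d → ℝ) → ℝ} {t : ℝ}
    (hθ : HasMean (eigenvalueLaw ρo ρe M) (fun v => classicalAlternating v - θ v) t) :
    momentClassical 𝕜 ρo ρe M 4 - ∫ v, conditionalMoment v (θ v) 4 ∂eigenvalueLaw ρo ρe M =
      2 * ((d : ℝ) ^ (M + 1))⁻¹ * t := by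
  have hc : Integrable (fun v => conditionalMoment v (classicalAlternating v) 4)
      (eigenvalueLaw ρo ρe M) := by
    refine (integrable_average_traceMoment_classical 𝕜 ho he).congr (ae_of_all _ fun v => ?_)
    exact average_traceMoment_classical 𝕜 hd v (by simp)
  have h' := hθ.const_mul (2 * ((d : ℝ) ^ (M + 1))⁻¹)
  have e : ∀ v : Fin M → Fin d × Fin d → ℝ, conditionalMoment v (θ v) 4 =
      conditionalMoment v (classicalAlternating v) 4 -
        2 * ((d : ℝ) ^ (M + 1))⁻¹ * (classicalAlternating v - θ v) := fun v => by
    simp only [conditionalMoment, sumMoment, Fintype.card_pi, Fintype.card_fin, Finset.prod_const,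
      Finset.card_univ]
    push_cast
    ring
  simp only [e]
  rw [integral_sub hc h'.1, h'.2, momentClassical_eq 𝕜 hd (by simp)]
  ring

/-- The number of pairs of an odd and an even bond with a common site. -/
def adjacentPairs (M : ℕ) : ℝ :=
  ∑ l ∈ oddBonds M, ∑ m ∈ evenBonds M, if DisjointBonds l m then 0 else 1

/-- Disjoint pairs cancel exactly; each adjacent pair leaves 1 - κ times the same product of mean
square sums, by independence of different bonds. -/
theorem fourth_classical_sub_quantum (hd : 2 ≤ d) (ho : ∀ i, Integrable (fun v => v i ^ 4) ρo)
    (he : ∀ i, Integrable (fun v => v i ^ 4) ρe) :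
    momentClassical 𝕜 ρo ρe M 4 - momentQuantum 𝕜 ρo ρe M 4 =
      2 / (d : ℝ) ^ 4 * (adjacentPairs M * (1 - adjacentFactor d (dysonIndex 𝕜))) *
        ((∫ w, centredSq w ∂ρo) * ∫ w, centredSq w ∂ρe) := by
  have hd0 : (d : ℝ) ≠ 0 := by positivity
  set T := (∫ w, centredSq w ∂ρo) * ∫ w, centredSq w ∂ρe with hT
  have hθ : HasMean (eigenvalueLaw ρo ρe M)
      (fun v => classicalAlternating v - quantumAlternating 𝕜 v)
      (∑ l ∈ oddBonds M, ∑ m ∈ evenBonds M,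
        ((if DisjointBonds l m then 0 else 1) * (1 - adjacentFactor d (dysonIndex 𝕜)) *
          ((d : ℝ) ^ (M + 1) / d ^ 4)) * T) := by
    have h := HasMean.finsetSum (oddBonds M) fun l hl => HasMean.finsetSum (evenBonds M) fun m hm =>
      (integral_centredSq_mul ho he hl hm).const_mul ((if DisjointBonds l m then 0 else 1) *
        (1 - adjacentFactor d (dysonIndex 𝕜)) * ((d : ℝ) ^ (M + 1) / d ^ 4))
    convert h using 2 with v
    rw [classicalAlternating, oddPowerSum_two hd, evenPowerSum_two hd, quantumAlternating]
    simp only [Fintype.card_pi, Fintype.card_fin, Finset.prod_const, Finset.card_univ]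
    have : (∑ l ∈ oddBonds M, localSq (centred v l)) / (d : ℝ) ^ 2 * (d : ℝ) ^ (M + 1) *
        ((∑ l ∈ evenBonds M, localSq (centred v l)) / (d : ℝ) ^ 2 * (d : ℝ) ^ (M + 1)) /
        ((d ^ (M + 1) : ℕ) : ℝ) = ∑ l ∈ oddBonds M, ∑ m ∈ evenBonds M,
          ((d : ℝ) ^ (M + 1) / d ^ 4) * (localSq (centred v l) * localSq (centred v m)) := by
      simp only [← Finset.mul_sum, ← Finset.sum_mul]
      push_cast
      field_simp
    rw [this, ← Finset.sum_sub_distrib]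
    refine Finset.sum_congr rfl fun l _ => ?_
    rw [← Finset.sum_sub_distrib]
    refine Finset.sum_congr rfl fun m _ => ?_
    simp only [localSq_centred]
    split_ifs <;> ring
  rw [momentQuantum_eq 𝕜 hd (by simp), integral_fourth_sub 𝕜 hd ho he hθ, adjacentPairs]
  simp only [← Finset.sum_mul]
  field_simp

/-- A global rotation ignores locality, so every odd-even pair contributes equally. The factor
simplifies because (n - 1)(n + 2/β) = n² + (2/β - 1)n - 2/β, with n = d^(M+1). -/
theorem fourth_classical_sub_iso (hd : 2 ≤ d) (ho : ∀ i, Integrable (fun v => v i ^ 4) ρo)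
    (he : ∀ i, Integrable (fun v => v i ^ 4) ρe) :
    momentClassical 𝕜 ρo ρe M 4 - momentIso 𝕜 ρo ρe M 4 =
      2 / (d : ℝ) ^ 4 * ((oddBonds M).card * (evenBonds M).card *
        (dysonIndex 𝕜 * ((d : ℝ) ^ (M + 1)) ^ 2 /
          (((d : ℝ) ^ (M + 1) - 1) * (dysonIndex 𝕜 * (d : ℝ) ^ (M + 1) + 2)))) *
        ((∫ w, centredSq w ∂ρo) * ∫ w, centredSq w ∂ρe) := by
  have hd0 : (d : ℝ) ≠ 0 := by positivity
  have hβ := dysonIndex_pos 𝕜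
  have hn : (2 : ℝ) ≤ (d : ℝ) ^ (M + 1) := by
    have := two_le_card_config (M := M) hd
    simp only [Fintype.card_pi, Fintype.card_fin, Finset.prod_const, Finset.card_univ] at this
    exact_mod_cast this
  set T := (∫ w, centredSq w ∂ρo) * ∫ w, centredSq w ∂ρe with hT
  set n : ℝ := (d : ℝ) ^ (M + 1) with hn'
  have hθ : HasMean (eigenvalueLaw ρo ρe M)
      (fun v => classicalAlternating v - isoAlternating 𝕜 v)
      (∑ l ∈ oddBonds M, ∑ m ∈ evenBonds M,
        (dysonIndex 𝕜 * n ^ 3 / ((n - 1) * (dysonIndex 𝕜 * n + 2)) / d ^ 4) * T) := by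
    have h := HasMean.finsetSum (oddBonds M) fun l hl => HasMean.finsetSum (evenBonds M) fun m hm =>
      (integral_centredSq_mul ho he hl hm).const_mul
        (dysonIndex 𝕜 * n ^ 3 / ((n - 1) * (dysonIndex 𝕜 * n + 2)) / d ^ 4)
    convert h using 2 with v
    rw [classicalAlternating, isoAlternating, fluctuation]
    change _ - evenPowerSum v 2 / _ * _ * _ = _
    rw [oddPowerSum_two hd, evenPowerSum_two hd]
    simp only [Fintype.card_pi, Fintype.card_fin, Finset.prod_const, Finset.card_univ,
      ← Finset.mul_sum, ← Finset.sum_mul, localSq_centred]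
    push_cast
    rw [← hn']
    have h1 : n - 1 ≠ 0 := by linarith
    have h2 : n + 2 / dysonIndex 𝕜 ≠ 0 := by positivity
    have h3 : dysonIndex 𝕜 * n + 2 ≠ 0 := by positivity
    have h4 : n ≠ 0 := by positivity
    have h5 : n + 2 / dysonIndex 𝕜 = (dysonIndex 𝕜 * n + 2) / dysonIndex 𝕜 := by field_simp
    rw [h5]
    field_simp
    ring
  rw [momentIso_eq 𝕜 hd (by simp), integral_fourth_sub 𝕜 hd ho he hθ]
  simp only [Finset.sum_const, nsmul_eq_mul]
  have h1 : n - 1 ≠ 0 := by linarith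
  have h3 : dysonIndex 𝕜 * n + 2 ≠ 0 := by positivity
  have h4 : n ≠ 0 := by positivity
  field_simp
  rw [← hn']
  ring

/-- Law of total variance: the variance of the mean energy is nonnegative, and the averaged variance
given the eigenvalues is positive once the odd terms are not scalar. -/
theorem variance_pos (hd : 2 ≤ d) (hM : (oddBonds M).Nonempty)
    (ho : ∀ i, Integrable (fun v => v i ^ 4) ρo)
    (he : ∀ i, Integrable (fun v => v i ^ 4) ρe) (hs : ¬ ∀ᵐ v ∂ρo, ∀ i j, v i = v j) :
    0 < momentClassical 𝕜 ρo ρe M 2 - momentClassical 𝕜 ρo ρe M 1 ^ 2 := by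
  have hd0 : (0 : ℝ) < d := by positivity
  have hL : MemLp (meanEnergy (d := d) (M := M)) 2 (eigenvalueLaw ρo ρe M) := by
    refine memLp_finsetSum _ fun l _ => MemLp.mono_exponent (q := 4) ?_ (by norm_num)
    have hp := measurePreserving_eval (fun l : Fin M => if IsOddBond l then ρo else ρe) l
    refine MemLp.comp_measurePreserving (g := localMean) ?_ hp
    split_ifs
    · exact memLp_localMean ho
    · exact memLp_localMean he
  have hvar := ProbabilityTheory.variance_nonneg (meanEnergy (d := d) (M := M))
    (eigenvalueLaw ρo ρe M)
  rw [ProbabilityTheory.variance_eq_sub hL] at hvar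
  have hO := (HasMean.finsetSum (oddBonds M) fun l hl =>
    hasMean_centredSq_odd (ρo := ρo) (ρe := ρe) ho hl)
  have hE := (HasMean.finsetSum (evenBonds M) fun l hl =>
    hasMean_centredSq_even (ρo := ρo) (ρe := ρe) he hl)
  have hW := (hO.add hE).const_mul (((d : ℝ) ^ 2)⁻¹)
  rw [momentClassical_eq 𝕜 hd (by simp), momentClassical_eq 𝕜 hd (by simp)]
  have e2 : ∀ v : Fin M → Fin d × Fin d → ℝ, conditionalMoment v (classicalAlternating v) 2 =
      meanEnergy v ^ 2 + ((d : ℝ) ^ 2)⁻¹ * (∑ l ∈ oddBonds M, centredSq (v l) +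
        ∑ l ∈ evenBonds M, centredSq (v l)) := fun v => by
    simp only [conditionalMoment, sumMoment, oddPowerSum_two hd, evenPowerSum_two hd,
      Fintype.card_pi, Fintype.card_fin, Finset.prod_const, Finset.card_univ, localSq_centred]
    push_cast
    field_simp
  have e1 : ∀ v : Fin M → Fin d × Fin d → ℝ, conditionalMoment v (classicalAlternating v) 1 =
      meanEnergy v := fun v => rfl
  simp only [e1, e2]
  rw [integral_add hL.integrable_sq hW.1, hW.2]
  have h1 : 0 < ∑ l ∈ oddBonds M, ∫ w, centredSq w ∂ρo :=
    Finset.sum_pos (fun _ _ => integral_centredSq_pos ho hs) hM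
  have h2 : 0 ≤ ∑ l ∈ evenBonds M, ∫ w, centredSq w ∂ρe :=
    Finset.sum_nonneg fun _ _ => integral_nonneg centredSq_nonneg
  have h3 : 0 < ((d : ℝ) ^ 2)⁻¹ * (∑ l ∈ oddBonds M, ∫ w, centredSq w ∂ρo +
      ∑ l ∈ evenBonds M, ∫ w, centredSq w ∂ρe) := by positivity
  simp only [Pi.pow_apply] at hvar
  linarith

end Eigenvalues

/-! ### Counting bonds and adjacent pairs -/

theorem card_oddBonds (M : ℕ) : (oddBonds M).card = (M + 1) / 2 := by
  have h : (oddBonds M).card = ∑ i ∈ Finset.range M, if Odd (i + 1) then 1 else 0 := by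
    rw [oddBonds, Finset.card_filter, ← Fin.sum_univ_eq_sum_range]
    rfl
  rw [h]
  clear h
  induction M with
  | zero => rfl
  | succ M ih =>
    rw [Finset.sum_range_succ, ih]
    split_ifs with h <;> grind

theorem card_evenBonds (M : ℕ) : (evenBonds M).card = M / 2 := by
  have h : (evenBonds M).card = ∑ i ∈ Finset.range M, if ¬ Odd (i + 1) then 1 else 0 := by
    rw [evenBonds, Finset.card_filter, ← Fin.sum_univ_eq_sum_range]
    rfl
  rw [h]
  clear h
  induction M with
  | zero => rfl
  | succ M ih =>
    rw [Finset.sum_range_succ, ih]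
    split_ifs with h <;> grind

/-- Consecutive bonds have opposite parity, so adjacent odd-even pairs correspond to the interior
sites. -/
theorem adjacentPairs_succ (M : ℕ) : adjacentPairs (M + 1) = M := by
  -- Indexing by natural numbers permits induction on the length: the new bond forms exactly one new
  -- pair, with its predecessor (`h3`).
  set g : ℕ → ℕ → ℝ := fun i j =>
    if Odd (i + 1) ∧ ¬ Odd (j + 1) ∧ ¬ (i + 1 < j ∨ j + 1 < i) then 1 else 0 with hg
  have h : adjacentPairs (M + 1) =
      ∑ i ∈ Finset.range (M + 1), ∑ j ∈ Finset.range (M + 1), g i j := by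
    rw [adjacentPairs, oddBonds, evenBonds, Finset.sum_filter, ← Fin.sum_univ_eq_sum_range
      (fun i => ∑ j ∈ Finset.range (M + 1), g i j)]
    refine Finset.sum_congr rfl fun l _ => ?_
    rw [Finset.sum_filter, ← Fin.sum_univ_eq_sum_range (fun j => g l j)]
    simp only [hg]
    by_cases hl : IsOddBond l
    · rw [if_pos hl]
      refine Finset.sum_congr rfl fun m _ => ?_
      by_cases hm : IsOddBond m
      · rw [if_neg (not_not.mpr hm), if_neg fun h => h.2.1 hm]
      · rw [if_pos hm]
        by_cases hd : DisjointBonds l m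
        · rw [if_pos hd, if_neg fun h => h.2.2 hd]
        · rw [if_neg hd, if_pos ⟨hl, hm, hd⟩]
    · rw [if_neg hl]
      exact (Finset.sum_eq_zero fun m _ => if_neg fun h => hl h.1).symm
  rw [h]
  clear h
  induction M with
  | zero => simp [hg]
  | succ M ih =>
    have hs : ∀ i, ∑ j ∈ Finset.range (M + 1 + 1), g i j =
        ∑ j ∈ Finset.range (M + 1), g i j + g i (M + 1) := fun i => Finset.sum_range_succ _ _
    rw [Finset.sum_range_succ]
    simp only [hs]
    rw [Finset.sum_add_distrib, ih]
    have h0 : g (M + 1) (M + 1) = 0 := if_neg fun h => h.2.1 h.1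
    have h1 : ∑ i ∈ Finset.range M, g i (M + 1) = 0 :=
      Finset.sum_eq_zero fun i hi => if_neg fun h => by
        have := Finset.mem_range.mp hi
        omega
    have h2 : ∑ i ∈ Finset.range M, g (M + 1) i = 0 :=
      Finset.sum_eq_zero fun i hi => if_neg fun h => by
        have := Finset.mem_range.mp hi
        omega
    have h3 : g M (M + 1) + g (M + 1) M = 1 := by
      simp only [hg]
      split_ifs <;> grind
    rw [Finset.sum_range_succ, Finset.sum_range_succ, h0, h1, h2]
    push_cast
    linarith

/-! ### The weight 1 - p: bounds, limit and closed form -/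

section Weight

variable {d : ℕ} {β : ℝ}

/-- The closed form of `1 - κ`, where `κ` is the factor of the alternating product of two adjacent
traceless local terms. It agrees with `1 - adjacentFactor d β` for `β = 1` and `β = 2`. -/
def adjacentDefect (d : ℕ) (β : ℝ) : ℝ :=
  β * (d : ℝ) ^ 4 * (β * ((d : ℝ) ^ 3 + (d : ℝ) ^ 2 - 2 * d + 1) + 4 * d - 2) /
    ((β * (d : ℝ) ^ 2 + 2) ^ 2 * ((d : ℝ) + 1) ^ 2 * ((d : ℝ) - 1))

/-- Checked at β = 1 and β = 2 separately; there ε = 2/β - 1 satisfies ε² = ε. -/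
theorem one_sub_adjacentFactor (hd : 2 ≤ d) (hβ : β = 1 ∨ β = 2) :
    1 - adjacentFactor d β = adjacentDefect d β := by
  have hd' : (2 : ℝ) ≤ d := by exact_mod_cast hd
  have h1 : (d : ℝ) - 1 ≠ 0 := by linarith
  have h2 : (d : ℝ) + 1 ≠ 0 := by linarith
  have h4 : (d : ℝ) ^ 2 - 1 = (d - 1) * (d + 1) := by ring
  have h6 : (d : ℝ) ≠ 0 := by linarith
  rcases hβ with rfl | rfl
  · have h3 : (d : ℝ) ^ 2 + 2 ≠ 0 := by positivity
    rw [adjacentFactor, adjacentDefect, h4]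
    norm_num
    field_simp
    ring
  · have h3 : (d : ℝ) ^ 2 + 1 ≠ 0 := by positivity
    have h5 : 2 * (d : ℝ) ^ 2 + 2 = 2 * (d ^ 2 + 1) := by ring
    rw [adjacentFactor, adjacentDefect, h4, h5]
    norm_num
    field_simp
    ring

theorem adjacentDefect_nonneg (hd : 2 ≤ d) (hβ : 0 < β) : 0 ≤ adjacentDefect d β := by
  have hd' : (2 : ℝ) ≤ d := by exact_mod_cast hd
  -- In x = d - 2 ≥ 0 the polynomials to be bounded have nonnegative coefficients; the next two
  -- proofs substitute likewise.
  obtain ⟨x, hx, hdx⟩ : ∃ x : ℝ, 0 ≤ x ∧ (d : ℝ) = x + 2 := ⟨d - 2, by linarith, by ring⟩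
  rw [adjacentDefect, hdx]
  have h1 : 0 ≤ (x + 2) ^ 3 + (x + 2) ^ 2 - 2 * (x + 2) + 1 := by ring_nf; positivity
  have h2 : 0 ≤ x + 2 - 1 := by linarith
  have h3 : 0 ≤ β * ((x + 2) ^ 3 + (x + 2) ^ 2 - 2 * (x + 2) + 1) + 4 * (x + 2) - 2 := by
    nlinarith [mul_nonneg hβ.le h1]
  positivity

theorem adjacentDefect_le_one (hd : 2 ≤ d) (hβ : 0 < β) : adjacentDefect d β ≤ 1 := by
  have hd' : (2 : ℝ) ≤ d := by exact_mod_cast hd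
  obtain ⟨x, hx, hdx⟩ : ∃ x : ℝ, 0 ≤ x ∧ (d : ℝ) = x + 2 := ⟨d - 2, by linarith, by ring⟩
  have hx1 : 0 < x + 2 - 1 := by linarith
  rw [adjacentDefect, hdx, div_le_one (by positivity), ← sub_nonneg]
  have h1 : (β * (x + 2) ^ 2 + 2) ^ 2 * (x + 2 + 1) ^ 2 * (x + 2 - 1) -
      β * (x + 2) ^ 4 * (β * ((x + 2) ^ 3 + (x + 2) ^ 2 - 2 * (x + 2) + 1) + 4 * (x + 2) - 2) =
      β ^ 2 * ((x + 2) ^ 4 * x) + β * ((x + 2) ^ 2 * (6 * x ^ 2 + 20 * x + 12)) +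
        4 * ((x + 3) ^ 2 * (x + 1)) := by ring
  rw [h1]
  positivity

/-- For β < 2 the reciprocal of the isotropic factor can exceed 1, so the plain bound by 1 does not
suffice; the gap d⁻³ absorbs the excess. -/
theorem adjacentDefect_le_one_sub (hd : 2 ≤ d) (hβ : 1 ≤ β) (hβ' : β ≤ 2) :
    adjacentDefect d β ≤ 1 - ((d : ℝ) ^ 3)⁻¹ := by
  have hd' : (2 : ℝ) ≤ d := by exact_mod_cast hd
  obtain ⟨x, hx, hdx⟩ : ∃ x : ℝ, 0 ≤ x ∧ (d : ℝ) = x + 2 := ⟨d - 2, by linarith, by ring⟩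
  have hx1 : 0 < x + 2 - 1 := by linarith
  have hb1 : 0 ≤ β - 1 := by linarith
  have hb2 : 0 ≤ 2 - β := by linarith
  have h3 : 1 - ((x + 2) ^ 3)⁻¹ = ((x + 2) ^ 3 - 1) / (x + 2) ^ 3 := by
    field_simp
  rw [adjacentDefect, hdx, h3, div_le_div_iff₀ (by positivity) (by positivity), ← sub_nonneg]
  -- The difference is written with β - 1 and 2 - β, nonnegative on [1, 2], and polynomials in x
  -- with nonnegative coefficients.
  have h1 : ((x + 2) ^ 3 - 1) * ((β * (x + 2) ^ 2 + 2) ^ 2 * (x + 2 + 1) ^ 2 * (x + 2 - 1)) -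
      β * (x + 2) ^ 4 * (β * ((x + 2) ^ 3 + (x + 2) ^ 2 - 2 * (x + 2) + 1) + 4 * (x + 2) - 2) *
        (x + 2) ^ 3 =
      (β - 1) ^ 2 * ((x + 2) ^ 4 * (x ^ 4 + 5 * x ^ 3 + 5 * x ^ 2)) +
        (β - 1) * (2 - β) * ((x + 2) ^ 4 * (7 * x + 9)) +
        ((2 - β) * (x ^ 8 + 19 * x ^ 7 + 153 * x ^ 6 + 685 * x ^ 5 + 1863 * x ^ 4 + 3132 * x ^ 3 +
          3136 * x ^ 2 + 1668 * x + 348) +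
        (β - 1) * (3 * x ^ 8 + 51 * x ^ 7 + 371 * x ^ 6 + 1496 * x ^ 5 + 3616 * x ^ 4 +
          5264 * x ^ 3 + 4340 * x ^ 2 + 1684 * x + 156)) := by
    ring
  rw [h1]
  positivity

/-- The product of `1 - κ` and the reciprocal of the isotropic factor. -/
def defectRatio (d M : ℕ) (β : ℝ) : ℝ :=
  adjacentDefect d β *
    (((d : ℝ) ^ (M + 1) - 1) * (β * (d : ℝ) ^ (M + 1) + 2) / (β * ((d : ℝ) ^ (M + 1)) ^ 2))

theorem defectRatio_nonneg (hd : 2 ≤ d) (hβ : 0 < β) (M : ℕ) : 0 ≤ defectRatio d M β := by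
  have hn : (1 : ℝ) ≤ (d : ℝ) ^ (M + 1) :=
    one_le_pow₀ (by exact_mod_cast (by omega : 1 ≤ d))
  have h1 : 0 ≤ (d : ℝ) ^ (M + 1) - 1 := by linarith
  have := adjacentDefect_nonneg hd hβ
  rw [defectRatio]
  positivity

/-- With n = d^(M+1), the second factor is at most 1 for β ≥ 2 and at most 1 + 1/n for 1 ≤ β ≤ 2. In
the latter case M ≥ 2 gives n ≥ d³, so the first factor is at most 1 - 1/n, and (1 - 1/n)(1 + 1/n) ≤
1. -/
theorem defectRatio_le_one (hd : 2 ≤ d) (hβ : 1 ≤ β) {M : ℕ} (hM : 2 ≤ M) :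
    defectRatio d M β ≤ 1 := by
  have hd1 : (1 : ℝ) ≤ d := by exact_mod_cast (by omega : 1 ≤ d)
  have hb : 0 < β := by linarith
  have hn3 : (d : ℝ) ^ 3 ≤ (d : ℝ) ^ (M + 1) := pow_le_pow_right₀ hd1 (by omega)
  have hn1 : (1 : ℝ) ≤ (d : ℝ) ^ (M + 1) := one_le_pow₀ hd1
  have hd3 : (0 : ℝ) < (d : ℝ) ^ 3 := by positivity
  have hδ := adjacentDefect_nonneg hd hb
  rw [defectRatio]
  set n : ℝ := (d : ℝ) ^ (M + 1)
  have hn0 : 0 < n := by linarith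
  have hr : 0 ≤ (n - 1) * (β * n + 2) / (β * n ^ 2) := by
    have : 0 ≤ n - 1 := by linarith
    positivity
  rcases le_total β 2 with h2 | h2
  · have h1 : (n - 1) * (β * n + 2) / (β * n ^ 2) ≤ 1 + n⁻¹ := by
      rw [div_le_iff₀ (by positivity)]
      have : (1 + n⁻¹) * (β * n ^ 2) = β * n ^ 2 + β * n := by field_simp
      rw [this]
      nlinarith
    have h3 : adjacentDefect d β ≤ 1 - n⁻¹ :=
      (adjacentDefect_le_one_sub hd hβ h2).trans (sub_le_sub_left (inv_anti₀ hd3 hn3) 1)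
    have hi : 0 < n⁻¹ := by positivity
    calc _ ≤ (1 - n⁻¹) * (1 + n⁻¹) := mul_le_mul h3 h1 hr (hδ.trans h3)
      _ ≤ 1 := by nlinarith
  · refine mul_le_one₀ (adjacentDefect_le_one hd hb) hr ?_
    rw [div_le_one (by positivity)]
    nlinarith

/-- The weight `1 - p` of the isotropic end for a chain with `M` bonds. -/
def isoWeight (d : ℕ) (β : ℝ) (M : ℕ) : ℝ :=
  -- The number of adjacent odd-even pairs over the number of all odd-even pairs; the divisions by 2
  -- are integer divisions.
  ((M : ℝ) - 1) / (((M + 1) / 2 : ℕ) * (M / 2 : ℕ)) * defectRatio d M β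

/-- With a odd and b even bonds, a + b - 1 ≤ ab is (a - 1)(b - 1) ≥ 0, and (a + b)² - 1 ≤ 4ab is (a
- b)² ≤ 1. The second bound makes the weight vanish in the limit. -/
theorem bondRatio_le {M : ℕ} (hM : 2 ≤ M) :
    ((M : ℝ) - 1) / (((M + 1) / 2 : ℕ) * (M / 2 : ℕ)) ≤ 1 ∧
    ((M : ℝ) - 1) / (((M + 1) / 2 : ℕ) * (M / 2 : ℕ)) ≤ 4 / (M + 1) := by
  set a := (M + 1) / 2 with ha
  set b := M / 2 with hb
  have hM' : M = a + b := by omega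
  have hb1 : 1 ≤ b := by omega
  have ha1 : b ≤ a := by omega
  have ha2 : a ≤ b + 1 := by omega
  have h0 : (1 : ℝ) ≤ b := by exact_mod_cast hb1
  have h1 : (b : ℝ) ≤ a := by exact_mod_cast ha1
  have h2 : (a : ℝ) ≤ b + 1 := by exact_mod_cast ha2
  have h3 : (M : ℝ) = a + b := by exact_mod_cast hM'
  have h4 : (0 : ℝ) < a * b := by nlinarith
  rw [h3]
  constructor
  · rw [div_le_one h4]
    nlinarith
  · rw [div_le_div_iff₀ h4 (by linarith)]
    nlinarith

theorem bondRatio_nonneg {M : ℕ} (hM : 2 ≤ M) :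
    0 ≤ ((M : ℝ) - 1) / (((M + 1) / 2 : ℕ) * (M / 2 : ℕ)) := by
  have : (2 : ℝ) ≤ M := by exact_mod_cast hM
  exact div_nonneg (by linarith) (by positivity)

theorem isoWeight_nonneg (hd : 2 ≤ d) (hβ : 1 ≤ β) {M : ℕ} (hM : 2 ≤ M) : 0 ≤ isoWeight d β M :=
  mul_nonneg (bondRatio_nonneg hM) (defectRatio_nonneg hd (by linarith) M)

theorem isoWeight_le_one (hd : 2 ≤ d) (hβ : 1 ≤ β) {M : ℕ} (hM : 2 ≤ M) : isoWeight d β M ≤ 1 :=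
  mul_le_one₀ (bondRatio_le hM).1 (defectRatio_nonneg hd (by linarith) M)
    (defectRatio_le_one hd hβ hM)

theorem tendsto_isoWeight (hd : 2 ≤ d) (hβ : 1 ≤ β) :
    Tendsto (isoWeight d β) atTop (𝓝 0) := by
  have h : Tendsto (fun M : ℕ => 4 / ((M : ℝ) + 1)) atTop (𝓝 0) :=
    tendsto_const_nhds.div_atTop
      (tendsto_atTop_add_const_right _ _ tendsto_natCast_atTop_atTop)
  refine squeeze_zero' ?_ ?_ h
  · filter_upwards [eventually_ge_atTop 2] with M hM using isoWeight_nonneg hd hβ hM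
  · filter_upwards [eventually_ge_atTop 2] with M hM
    exact (mul_le_of_le_one_right (bondRatio_nonneg hM) (defectRatio_le_one hd hβ hM)).trans
      (bondRatio_le hM).2

/-- Here 2k bonds means k odd and k even ones, and (2k - 1)/k² = 1 - ((k - 1)/k)². With n =
d^(2k+1), the factor containing d^(-2k+1) equals d²(βn + 2)/(n(βd² + 2)). The identity is algebraic
in β, hence holds for real β > 0. -/
theorem isoWeight_two_mul (hd : 2 ≤ d) (hβ : 0 < β) {k : ℕ} (hk : 1 ≤ k) :
    isoWeight d β (2 * k) = sliderOneSubP d k β := by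
  have hd' : (2 : ℝ) ≤ d := by exact_mod_cast hd
  have hk' : (k : ℝ) ≠ 0 := by exact_mod_cast (by omega : k ≠ 0)
  have hd0 : (d : ℝ) ≠ 0 := by linarith
  have h1 : (2 * k + 1) / 2 = k := by omega
  have h2 : 2 * k / 2 = k := by omega
  have h3 : (d : ℝ) ^ (-2 * (k : ℤ) - 1) = ((d : ℝ) ^ (2 * k + 1))⁻¹ := by
    rw [← zpow_natCast, ← _root_.zpow_neg]
    congr 1
    push_cast
    ring
  have h4 : (d : ℝ) ^ (-2 * (k : ℤ) + 1) = (d : ℝ) ^ 2 * ((d : ℝ) ^ (2 * k + 1))⁻¹ := by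
    rw [← h3, ← zpow_natCast, ← zpow_add₀ hd0]
    congr 1
    push_cast
    ring
  rw [isoWeight, defectRatio, adjacentDefect, sliderOneSubP, h1, h2, h3, h4]
  have hn : (d : ℝ) ^ (2 * k + 1) ≠ 0 := by positivity
  set n : ℝ := (d : ℝ) ^ (2 * k + 1)
  have h5 : (d : ℝ) - 1 ≠ 0 := by linarith
  have h6 : (d : ℝ) + 1 ≠ 0 := by linarith
  have h7 : β * (d : ℝ) ^ 2 + 2 ≠ 0 := by positivity
  have h8 : 1 + β * (d : ℝ) ^ 2 / 2 = (β * (d : ℝ) ^ 2 + 2) / 2 := by ring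
  have h9 : 1 - (((k : ℝ) - 1) / k) ^ 2 = (2 * k - 1) / (k * k) := by
    field_simp
    ring
  have h10 : 1 - (1 - (d : ℝ) ^ 2 * n⁻¹) / ((β * (d : ℝ) ^ 2 + 2) / 2) =
      (d : ℝ) ^ 2 * (β * n + 2) / (n * (β * (d : ℝ) ^ 2 + 2)) := by
    field_simp
    ring
  have h11 : 1 - n⁻¹ = (n - 1) / n := by field_simp
  rw [h8, h9, h10, h11]
  push_cast
  field_simp

theorem tendsto_sliderOneSubP (hd : 2 ≤ d) (hβ : 1 ≤ β) :
    Tendsto (fun k => sliderOneSubP d k β) atTop (𝓝 0) := by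
  have h2 : Tendsto (fun k : ℕ => 2 * k) atTop atTop := tendsto_id.const_mul_atTop' two_pos
  have h := (tendsto_isoWeight hd hβ).comp h2
  refine h.congr' ?_
  filter_upwards [eventually_ge_atTop 1] with k hk
  exact isoWeight_two_mul hd (by linarith) hk

end Weight

/-- The fourth moment and both kurtoses depend on the fourth moment through an increasing affine
map determined by the first three moments. -/
theorem exists_affine_of_mem {γ : (ℕ → ℝ) → ℝ}
    (hγ : γ ∈ ({fourthMoment, rawKurtosis, centralKurtosis} : Set ((ℕ → ℝ) → ℝ))) (m : ℕ → ℝ) :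
    ∃ K s : ℝ, 0 ≤ s ∧ (0 < m 2 - m 1 ^ 2 → 0 < s) ∧
      ∀ m' : ℕ → ℝ, m' 1 = m 1 → m' 2 = m 2 → m' 3 = m 3 → γ m' = (m' 4 + K) * s := by
  rcases hγ with rfl | rfl | rfl
  · exact ⟨0, 1, zero_le_one, fun _ => one_pos, fun m' _ _ _ => by simp [fourthMoment]⟩
  -- For zero variance the inverse is 0, so s = 0 and the kurtosis takes the conventional value 0.
  · refine ⟨0, ((m 2 - m 1 ^ 2) ^ 2)⁻¹, by positivity, fun h => by positivity, ?_⟩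
    intro m' h1 h2 h3
    rw [rawKurtosis, h1, h2, add_zero, div_eq_mul_inv]
  · refine ⟨-4 * m 1 * m 3 + 6 * m 1 ^ 2 * m 2 - 3 * m 1 ^ 4, ((m 2 - m 1 ^ 2) ^ 2)⁻¹,
      by positivity, fun h => by positivity, ?_⟩
    intro m' h1 h2 h3
    rw [centralKurtosis, h1, h2, h3, div_eq_mul_inv]
    ring

/-! ### Comparison of the three fourth moments -/

section Slider

variable {d M : ℕ} (𝕜 : Type*) [RCLike 𝕜] {ρo ρe : Measure (Fin d × Fin d → ℝ)}
  [IsProbabilityMeasure ρo] [IsProbabilityMeasure ρe]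

theorem isoFactor_pos (hd : 2 ≤ d) (hM : 2 ≤ M) :
    0 < 2 / (d : ℝ) ^ 4 * ((oddBonds M).card * (evenBonds M).card *
      (dysonIndex 𝕜 * ((d : ℝ) ^ (M + 1)) ^ 2 /
        (((d : ℝ) ^ (M + 1) - 1) * (dysonIndex 𝕜 * (d : ℝ) ^ (M + 1) + 2)))) := by
  have hβ := dysonIndex_pos 𝕜
  have hd' : (0 : ℝ) < d := by positivity
  have hn : (1 : ℝ) < (d : ℝ) ^ (M + 1) :=
    one_lt_pow₀ (by exact_mod_cast (by omega : 1 < d)) (by omega)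
  have h1 : 0 < (d : ℝ) ^ (M + 1) - 1 := by linarith
  rw [card_oddBonds, card_evenBonds]
  have h2 : (0 : ℝ) < ((M + 1) / 2 : ℕ) := by exact_mod_cast (by omega : 0 < (M + 1) / 2)
  have h3 : (0 : ℝ) < (M / 2 : ℕ) := by exact_mod_cast (by omega : 0 < M / 2)
  positivity

/-- Both differences contain the same product of mean square sums, so the ratio of their
coefficients is free of the eigenvalue laws. The multiplicative form remains valid when that product
is zero. -/
theorem classical_sub_quantum_eq (hd : 2 ≤ d) (hM : 2 ≤ M)
    (ho : ∀ i, Integrable (fun v => v i ^ 4) ρo) (he : ∀ i, Integrable (fun v => v i ^ 4) ρe) :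
    momentClassical 𝕜 ρo ρe M 4 - momentQuantum 𝕜 ρo ρe M 4 = isoWeight d (dysonIndex 𝕜) M *
      (momentClassical 𝕜 ρo ρe M 4 - momentIso 𝕜 ρo ρe M 4) := by
  rw [fourth_classical_sub_quantum 𝕜 hd ho he, fourth_classical_sub_iso 𝕜 hd ho he,
    one_sub_adjacentFactor hd (dysonIndex_eq 𝕜), card_oddBonds, card_evenBonds, isoWeight,
    defectRatio]
  obtain ⟨K, rfl⟩ : ∃ K, M = K + 1 := ⟨M - 1, by omega⟩
  rw [adjacentPairs_succ]
  have hβ := dysonIndex_pos 𝕜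
  have hd' : (d : ℝ) ≠ 0 := by exact_mod_cast (by omega : d ≠ 0)
  have hn : (1 : ℝ) < (d : ℝ) ^ (K + 1 + 1) :=
    one_lt_pow₀ (by exact_mod_cast (by omega : 1 < d)) (by omega)
  have h2 : (((K + 1 + 1) / 2 : ℕ) : ℝ) ≠ 0 := by exact_mod_cast (by omega : (K + 1 + 1) / 2 ≠ 0)
  have h3 : (((K + 1) / 2 : ℕ) : ℝ) ≠ 0 := by exact_mod_cast (by omega : (K + 1) / 2 ≠ 0)
  generalize (((K + 1 + 1) / 2 : ℕ) : ℝ) = a at *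
  generalize (((K + 1) / 2 : ℕ) : ℝ) = b at *
  generalize (d : ℝ) ^ (K + 1 + 1) = n at *
  have h1 : n - 1 ≠ 0 := by linarith
  have h4 : n ≠ 0 := by linarith
  have h5 : dysonIndex 𝕜 * n + 2 ≠ 0 := by
    have : 0 < n := by linarith
    positivity
  have h6 := hβ.ne'
  push_cast
  field_simp
  ring

theorem iso_le_classical (hd : 2 ≤ d) (hM : 2 ≤ M)
    (ho : ∀ i, Integrable (fun v => v i ^ 4) ρo) (he : ∀ i, Integrable (fun v => v i ^ 4) ρe) :
    momentIso 𝕜 ρo ρe M 4 ≤ momentClassical 𝕜 ρo ρe M 4 := by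
  rw [← sub_nonneg, fourth_classical_sub_iso 𝕜 hd ho he]
  exact mul_nonneg (isoFactor_pos 𝕜 hd hM).le
    (mul_nonneg (integral_nonneg centredSq_nonneg) (integral_nonneg centredSq_nonneg))

theorem iso_lt_classical (hd : 2 ≤ d) (hM : 2 ≤ M)
    (ho : ∀ i, Integrable (fun v => v i ^ 4) ρo) (he : ∀ i, Integrable (fun v => v i ^ 4) ρe)
    (hso : ¬ ∀ᵐ v ∂ρo, ∀ i j, v i = v j) (hse : ¬ ∀ᵐ v ∂ρe, ∀ i j, v i = v j) :
    momentIso 𝕜 ρo ρe M 4 < momentClassical 𝕜 ρo ρe M 4 := by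
  rw [← sub_pos, fourth_classical_sub_iso 𝕜 hd ho he]
  exact mul_pos (isoFactor_pos 𝕜 hd hM)
    (mul_pos (integral_centredSq_pos ho hso) (integral_centredSq_pos he hse))

end Slider

end

theorem mainTheorem2 (d : ℕ) (hd : 2 ≤ d) :
    -- real (`β = 1`) and complex (`β = 2`) chains: the weight depends only on `N`, `d`, `β`
    (∀ (𝕜 : Type) [RCLike 𝕜], ∃ p : ℕ → ℝ,
      (∀ M, 2 ≤ M → 0 ≤ p M ∧ p M ≤ 1) ∧
      (∀ k, 1 ≤ k → 1 - p (2 * k) = sliderOneSubP d k (Module.finrank ℝ 𝕜)) ∧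
      Tendsto p atTop (𝓝 1) ∧
      ∀ (ρo ρe : Measure (Fin d × Fin d → ℝ)) [IsProbabilityMeasure ρo] [IsProbabilityMeasure ρe],
        (∀ i, Integrable (fun v => v i ^ 4) ρo) → (∀ i, Integrable (fun v => v i ^ 4) ρe) →
        ∀ M, 2 ≤ M →
        ∀ γ ∈ ({fourthMoment, rawKurtosis, centralKurtosis} : Set ((ℕ → ℝ) → ℝ)),
          γ (momentIso 𝕜 ρo ρe M) ≤ γ (momentQuantum 𝕜 ρo ρe M) ∧
          γ (momentQuantum 𝕜 ρo ρe M) ≤ γ (momentClassical 𝕜 ρo ρe M) ∧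
          γ (momentQuantum 𝕜 ρo ρe M) =
            p M * γ (momentClassical 𝕜 ρo ρe M) + (1 - p M) * γ (momentIso 𝕜 ρo ρe M) ∧
          -- if neither law is concentrated on scalar matrices, the ends differ, so `p M` is unique
          ((¬ ∀ᵐ v ∂ρo, ∀ i j, v i = v j) → (¬ ∀ᵐ v ∂ρe, ∀ i j, v i = v j) →
            γ (momentIso 𝕜 ρo ρe M) < γ (momentClassical 𝕜 ρo ρe M))) ∧
    -- for every real `β ≥ 1` the closed form itself lies in `[0, 1]`, and `p → 1`
    (∀ β : ℝ, 1 ≤ β →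
      (∀ k, 1 ≤ k → 0 ≤ sliderOneSubP d k β ∧ sliderOneSubP d k β ≤ 1) ∧
      Tendsto (fun k => 1 - sliderOneSubP d k β) atTop (𝓝 1)) := by
  -- The weight is given for every number M of bonds; an odd number N = 2k + 1 of sites is M = 2k.
  refine ⟨fun 𝕜 _ => ⟨fun M => 1 - isoWeight d (dysonIndex 𝕜) M, ?_, ?_, ?_, ?_⟩, ?_⟩
  · intro M hM
    have hβ : 1 ≤ dysonIndex 𝕜 := by rcases dysonIndex_eq 𝕜 with h | h <;> rw [h]; norm_num
    have h0 := isoWeight_nonneg hd hβ hM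
    have h1 := isoWeight_le_one hd hβ hM
    constructor <;> linarith
  · intro k hk
    rw [sub_sub_cancel, isoWeight_two_mul hd (dysonIndex_pos 𝕜) hk, dysonIndex]
  · have hβ : 1 ≤ dysonIndex 𝕜 := by rcases dysonIndex_eq 𝕜 with h | h <;> rw [h]; norm_num
    simpa using (tendsto_isoWeight hd hβ).const_sub 1
  · intro ρo ρe _ _ ho he M hM γ hγ
    have hβ : 1 ≤ dysonIndex 𝕜 := by rcases dysonIndex_eq 𝕜 with h | h <;> rw [h]; norm_num
    obtain ⟨K, s, hs, hs', h⟩ := exists_affine_of_mem hγ (momentClassical 𝕜 ρo ρe M)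
    have l1 := lower_moments_eq (ρo := ρo) (ρe := ρe) (M := M) 𝕜 hd (r := 1) (by simp)
    have l2 := lower_moments_eq (ρo := ρo) (ρe := ρe) (M := M) 𝕜 hd (r := 2) (by simp)
    have l3 := lower_moments_eq (ρo := ρo) (ρe := ρe) (M := M) 𝕜 hd (r := 3) (by simp)
    -- The models share the first three moments, so the same K and s serve all three, and only the
    -- fourth moments remain to be compared.
    rw [h _ rfl rfl rfl, h _ l1.1 l2.1 l3.1, h _ l1.2 l2.2 l3.2]
    have hw0 := isoWeight_nonneg hd hβ hM
    have hw1 := isoWeight_le_one hd hβ hM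
    have hq := classical_sub_quantum_eq 𝕜 hd hM ho he
    have hi := iso_le_classical 𝕜 hd hM ho he
    refine ⟨mul_le_mul_of_nonneg_right ?_ hs, mul_le_mul_of_nonneg_right ?_ hs, ?_, ?_⟩
    · nlinarith
    · nlinarith
    · linear_combination -s * hq
    · intro hso hse
      have hodd : (oddBonds M).Nonempty := by
        rw [← Finset.card_pos, card_oddBonds]
        omega
      have := iso_lt_classical 𝕜 hd hM ho he hso hse
      exact mul_lt_mul_of_pos_right (by linarith) (hs' (variance_pos 𝕜 hd hodd ho he hso))
  · intro β hβ
    refine ⟨fun k hk => ?_, by simpa using (tendsto_sliderOneSubP hd hβ).const_sub 1⟩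
    rw [← isoWeight_two_mul hd (by linarith) hk]
    exact ⟨isoWeight_nonneg hd hβ (by omega), isoWeight_le_one hd hβ (by omega)⟩
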